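/- For $a\in\mathbb R$ let $\mathcal A=\begin{pmatrix}0&-a&0\\ a&0&0\\ 0&0&0\end{pmatrix}$, and consider solutions $G\in C^2(\mathbb R;\mathbb R^3)$ of $$(I+\mathcal A)G-sG'=2\,G'\times G'',\qquad |G'(s)|=1,\qquad s\in\mathbb R. \tag{E}$$ For such $G$ write $T=G'$, $c=|T'|$ (curvature), $n=T'/c$ and $b=T\times n$ where $c\ne0$, and $\alpha_G=-aT_3(0)-\tfrac14|(I+\mathcal A)G(0)|^2$. Let $a\neq0$, $B^+=(B^+_1,B^+_2,B^+_3)\in\mathbb S^2$ with $B_3^+\ne\pm1$, $a_+\in[0,2\pi)$ and $b_+\ge0$, and put $A^+=(I+\mathcal A)^{-1}B^+$. Then there is a solution $G$ of (E) for which $c_{+\infty}=\lim_{s\to+\infty}c(s)$ exists, $$c_{+\infty}^2=-aB_3^+-\alpha_G,\qquad b_+^2=a^2(-aB_3^+-\alpha_G)\,(1-(B_3^+)^2),$$ and, as $s\to+\infty$, (i) $G(s)=s\,e^{\mathcal A\log|s|}A^+ +\dfrac{e^{\mathcal A\log|s|}}{s}\{2c_{+\infty}^2B^+-\mathcal AB^+\times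 B^+\}-4\,\dfrac{c_{+\infty}n}{s^2}+O(s^{-3})$; (ii) $T(s)=e^{\mathcal A\log|s|}B^+-2\,\dfrac{c_{+\infty}b}{s}+O(s^{-2})$; (iii) $c_{+\infty}(n-ib)(s)=\dfrac{b_+e^{ia_+}}{|\mathcal AB^+|^2}\,e^{i\phi(s)}e^{\mathcal A\log|s|}\{\mathcal AB^+\times B^+-i\mathcal AB^+\}+O(|s|^{-1})$, where $\phi(s)=\dfrac{s^2}4-\gamma_+\log|s|$ and $\gamma_+=3aB_3^++\alpha_G$; here $c_{+\infty}n$ and $c_{+\infty}b$ are read as $0$ if $c_{+\infty}=0$. This $G$ also satisfies (L) $e^{-\mathcal A\log|s|}G(s)/s\to A^+$, $\;e^{-\mathcal A\log|s|}T(s)\to B^+$, and $\;e^{-i\phi(s)}e^{-\mathcal A\log|s|}(T'-iT\times T')(s)\to\dfrac{b_+e^{ia_+}}{|\mathcal AB^+|^2}(\mathcal AB^+\times B^+-i\mathcal AB^+)$ as $s\to+\infty$, where now $\phi(s)=\frac{s^2}4-(3aB_3^++\alpha)\log|s|$ with $\alpha=-aB_3^+-\dfrac{b_+^2}{a^2(1-(B_3^+)^2)}$.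 If moreover $b_+>0$, then the solution of (E) with the asymptotics (i)–(iii) (including the stated limit and relations for $c_{+\infty}$, $b_+$) is unique, and so is the solution of (E) satisfying (L). The same statements hold with $s\to-\infty$ in place of $s\to+\infty$ throughout, for data $B^-$, $a_-$, $b_-$ and $A^-=(I+\mathcal A)^{-1}B^-$. -/

import Mathlib

open Filter Topology Asymptotics
open scoped Matrix

noncomputable section

namespace SelfSimilarCurve

/-- Euclidean three-space. -/
abbrev E3 : Type := EuclideanSpace ℝ (Fin 3)

/-- The cross product on Euclidean three-space. -/
def cross (u v : E3) : E3 := WithLp.toLp 2 (u.ofLp ⨯₃ v.ofLp)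

/-- A real `3 × 3` matrix acting on Euclidean three-space. -/
def act (M : Matrix (Fin 3) (Fin 3) ℝ) (v : E3) : E3 := WithLp.toLp 2 (M *ᵥ v.ofLp)

/-- The antisymmetric matrix `𝒜` with parameter `a`. -/
def skew (a : ℝ) : Matrix (Fin 3) (Fin 3) ℝ :=
  !![0, -a, 0; a, 0, 0; 0, 0, 0]

/-- The matrix exponential `e^{t 𝒜}`. -/
def expSkew (a t : ℝ) : Matrix (Fin 3) (Fin 3) ℝ := NormedSpace.exp (t • skew a)

/-- `A = (I + 𝒜)⁻¹ B` (the matrix `I + 𝒜` is invertible, its determinant is `1 + a ^ 2`). -/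
def asymVec (a : ℝ) (B : E3) : E3 := act (1 + skew a)⁻¹ B

/-- The complex vector `u - i v` in `ℂ³`. -/
def subI (u v : E3) : EuclideanSpace ℂ (Fin 3) :=
  WithLp.toLp 2 fun j => (u j : ℂ) - Complex.I * (v j : ℂ)

/-- `G` is a (global, classical) solution of `(I + 𝒜) G - s G' = 2 G' × G''`, `|G'| = 1`. -/
def IsSolution (a : ℝ) (G : ℝ → E3) : Prop :=
  ContDiff ℝ 2 G ∧
    ∀ s : ℝ,
      act (1 + skew a) (G s) - s • deriv G s
          = (2 : ℝ) • cross (deriv G s) (deriv (deriv G) s) ∧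
        ‖deriv G s‖ = 1

/-- The unit tangent `T` of a curve parametrized by arc length. -/
def tangent (G : ℝ → E3) (s : ℝ) : E3 := deriv G s

/-- The curvature `c` of a curve parametrized by arc length. -/
def curvature (G : ℝ → E3) (s : ℝ) : ℝ := ‖deriv (tangent G) s‖

/-- The principal normal `n = T' / c`. -/
def normal (G : ℝ → E3) (s : ℝ) : E3 := (curvature G s)⁻¹ • deriv (tangent G) s

/-- The binormal `b = T × n`. -/
def binormal (G : ℝ → E3) (s : ℝ) : E3 := cross (tangent G s) (normal G s)

/-- The constant `α = -a T₃(0) - |(I + 𝒜) G(0)|² / 4` attached to a solution. -/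
def alpha (a : ℝ) (G : ℝ → E3) : ℝ :=
  -a * tangent G 0 2 - (1 / 4) * ‖act (1 + skew a) (G 0)‖ ^ 2

/-- The phase `φ(s) = s² / 4 - γ log |s|`. -/
def phase (γ s : ℝ) : ℝ := s ^ 2 / 4 - γ * Real.log |s|

/-- The complex number `b e^{i θ} / |𝒜 B|²`. -/
def amplitude (a : ℝ) (B : E3) (θ b : ℝ) : ℂ :=
  (b : ℂ) * Complex.exp (Complex.I * (θ : ℂ)) / ((‖act (skew a) B‖ ^ 2 : ℝ) : ℂ)

/-- The asymptotic expansions of `G`, `T` and `c_∞ (n - i b)` along `l` (which is `+∞` or `-∞`),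
with data `B`, `θ` (the angle `a_±`), `b` (the number `b_±`), where `c` is the limit `c_∞`
of the curvature. -/
structure HasExpansion (a : ℝ) (B : E3) (θ b : ℝ) (l : Filter ℝ) (G : ℝ → E3) (c : ℝ) :
    Prop where
  tendsto_curvature : Tendsto (curvature G) l (𝓝 c)
  sq_curvature : c ^ 2 = -a * B 2 - alpha a G
  sq_b : b ^ 2 = a ^ 2 * (-a * B 2 - alpha a G) * (1 - B 2 ^ 2)
  curve_asymp :
    (fun s : ℝ => G s -
      (s • act (expSkew a (Real.log |s|)) (asymVec a B)
        + s⁻¹ • act (expSkew a (Real.log |s|))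
            ((2 * c ^ 2) • B - cross (act (skew a) B) B)
        - (4 * c / s ^ 2) • normal G s)) =O[l] fun s : ℝ => 1 / s ^ 3
  tangent_asymp :
    (fun s : ℝ => tangent G s -
      (act (expSkew a (Real.log |s|)) B - (2 * c / s) • binormal G s))
        =O[l] fun s : ℝ => 1 / s ^ 2
  frame_asymp :
    (fun s : ℝ => (c : ℂ) • subI (normal G s) (binormal G s) -
      (amplitude a B θ b *
          Complex.exp (Complex.I * (phase (3 * a * B 2 + alpha a G) s : ℂ))) •
        subI (act (expSkew a (Real.log |s|)) (cross (act (skew a) B) B))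
          (act (expSkew a (Real.log |s|)) (act (skew a) B)))
        =O[l] fun s : ℝ => 1 / |s|

/-- `G` has the asymptotic expansions with data `B`, `θ`, `b` along `l`. -/
def HasAsymptotics (a : ℝ) (B : E3) (θ b : ℝ) (l : Filter ℝ) (G : ℝ → E3) : Prop :=
  ∃ c : ℝ, HasExpansion a B θ b l G c

/-- The value of `α` prescribed by the data at infinity. -/
def alphaData (a : ℝ) (B : E3) (b : ℝ) : ℝ :=
  -a * B 2 - b ^ 2 / (a ^ 2 * (1 - B 2 ^ 2))

/-- The leading-order form of the asymptotics along `l`: the limits of `e^{-𝒜 log |s|} G / s`,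
of `e^{-𝒜 log |s|} T` and of `e^{-i φ(s)} e^{-𝒜 log |s|} (T' - i T × T')`. -/
structure HasLimits (a : ℝ) (B : E3) (θ b : ℝ) (l : Filter ℝ) (G : ℝ → E3) : Prop where
  curve_asymp :
    Tendsto (fun s : ℝ => act (expSkew a (-Real.log |s|)) (s⁻¹ • G s)) l (𝓝 (asymVec a B))
  tangent_asymp :
    Tendsto (fun s : ℝ => act (expSkew a (-Real.log |s|)) (tangent G s)) l (𝓝 B)
  frame_asymp :
    Tendsto
      (fun s : ℝ =>
        Complex.exp (-(Complex.I * (phase (3 * a * B 2 + alphaData a B b) s : ℂ))) •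
          subI (act (expSkew a (-Real.log |s|)) (deriv (tangent G) s))
            (act (expSkew a (-Real.log |s|)) (cross (tangent G s) (deriv (tangent G) s))))
      l
      (𝓝 (amplitude a B θ b • subI (cross (act (skew a) B) B) (act (skew a) B)))

end SelfSimilarCurve

end

/-!
Why the theorem holds. With `T = G'`, `P = T'` and `N = T × T'`, the equation is equivalent to the
first-order system `G' = T`, `T' = ½ (I + 𝒜)G × T` with the constraints `|T| = 1` and
`⟪(I + 𝒜)G, T⟫ = s` (`IsSolution.isCurve`, `IsCurve.isSolution`). It has the conserved quantity
`α = -a T₃ - |T'|²`, and `(I + 𝒜)G = s T + 2 N`. So `P` and `N` are bounded by a constant depending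
on `a` and `α` only. Since `|T|` is constant, `G` grows at most linearly and the Cauchy problem is
globally solvable (`exists_isCurve`).

*The curve and the tangent.* In the frame rotating with `e^{𝒜 log s}` the derivative of `G / s` is
`-2 s⁻² N`, and `N` oscillates, being `2 / s` times the derivative of `P` up to lower order. One
integration by parts gives `G / s` up to `O(s⁻²)`, and further ones, in which only the mean
`R(T) = a e₃ - (3 a T₃ + 2 α) T` of the forcing survives, give it up to `O(s⁻⁴)`
(`IsFrame.isBigO_curve`). The expansion of `T` follows from `(I + 𝒜)G = s T + 2 N`.

*The frame.* The vertical components `y = T₃` and `h = P₃ - i N₃` form a closed system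
`y' = Re h`, `h' = (i s / 2) h + Π(y)` with a quadratic polynomial `Π`. An explicit correction of
`h` by terms of order `1 / s` turns it into `f' = i φ' f + O(s⁻²)` with `φ' = s / 2 - γ / s`, so
that `e^{-iφ} h` converges with rate `1 / s` (`exists_amplitude_bound`). Away from the poles the
whole of `P - i N` is recovered from `T` and `h` (`smul_subI_cross`). Hence both forms of the
asymptotics are equivalent to the same three conditions: the value of `α`, the limit of
`e^{-𝒜 log s} T`, and the limit of `e^{-iφ} h` (`HasReducedLimits`).

*Existence.* Take solutions having the prescribed limiting form as exact data at times tending to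
infinity. They share the value of `α`, so the convergence rates are uniform and the data at `0` lie
in a compact set; a subsequence converges to a solution with the prescribed limits
(`exists_hasReducedLimits`).

*Uniqueness.* The difference of two solutions `(y, h)` of the closed system solves a linear system
with the same oscillatory normal form, for which any bound on a ray far enough out can be halved;
hence `y` and `h` agree there. Then `|T₁ - T₂|² / (1 - y²)` is constant and tends to zero, so the
tangents agree on a ray and the curves everywhere (`HasReducedLimits.unique`).

*The other end.* The reflection `s ↦ -G (-s)` preserves the equation, exchanges the ends and adds
`π` to the angle (`hasExpansion_reflect`, `hasLimits_reflect`).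
-/

noncomputable section

namespace SelfSimilarCurve

/-! ### Coordinates, rotations about the vertical axis, and `e^{t𝒜}` -/

/-- The vertical unit vector `e₃`. -/
def vert : E3 := !₂[0, 0, 1]

/-- The infinitesimal rotation `v ↦ e₃ × v` about the vertical axis, so that `skew a` acts as
`a • J`. -/
def J : E3 →L[ℝ] E3 :=
  LinearMap.toContinuousLinearMap
    { toFun := fun v => !₂[-v 1, v 0, 0]
      map_add' := by intro u v; ext i; fin_cases i <;> simp; ring
      map_smul' := by intro r v; ext i; fin_cases i <;> simp }

@[simp] lemma J_apply_zero (v : E3) : J v 0 = -v 1 := rfl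
@[simp] lemma J_apply_one (v : E3) : J v 1 = v 0 := rfl
@[simp] lemma J_apply_two (v : E3) : J v 2 = 0 := rfl
@[simp] lemma vert_zero : vert 0 = 0 := rfl
@[simp] lemma vert_one : vert 1 = 0 := rfl
@[simp] lemma vert_two : vert 2 = 1 := rfl

@[simp] lemma cross_zero_coord (u v : E3) : cross u v 0 = u 1 * v 2 - u 2 * v 1 := by
  simp [cross, crossProduct]
@[simp] lemma cross_one_coord (u v : E3) : cross u v 1 = u 2 * v 0 - u 0 * v 2 := by
  simp [cross, crossProduct]
@[simp] lemma cross_two_coord (u v : E3) : cross u v 2 = u 0 * v 1 - u 1 * v 0 := by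
  simp [cross, crossProduct]

lemma E3.ext_coord {u v : E3} (h0 : u 0 = v 0) (h1 : u 1 = v 1) (h2 : u 2 = v 2) : u = v := by
  ext i; fin_cases i; exacts [h0, h1, h2]

lemma inner_coord (u v : E3) : inner ℝ u v = u 0 * v 0 + u 1 * v 1 + u 2 * v 2 := by
  simp [PiLp.inner_apply, Fin.sum_univ_three, mul_comm]

lemma norm_sq_coord (u : E3) : ‖u‖ ^ 2 = u 0 ^ 2 + u 1 ^ 2 + u 2 ^ 2 := by
  simp [EuclideanSpace.norm_sq_eq, Fin.sum_univ_three]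

/-- The rotation by the angle `t` about the vertical axis, in Rodrigues' form
`1 + sin t J + (1 - cos t) J²`. -/
def rot (t : ℝ) : E3 →L[ℝ] E3 :=
  ContinuousLinearMap.id ℝ E3 + Real.sin t • J + (1 - Real.cos t) • J.comp J

@[simp] lemma rot_apply_zero (t : ℝ) (v : E3) :
    rot t v 0 = Real.cos t * v 0 - Real.sin t * v 1 := by
  simp [rot]; ring
@[simp] lemma rot_apply_one (t : ℝ) (v : E3) :
    rot t v 1 = Real.sin t * v 0 + Real.cos t * v 1 := by
  simp [rot]; ring
@[simp] lemma rot_apply_two (t : ℝ) (v : E3) : rot t v 2 = v 2 := by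
  simp [rot]

lemma rot_rot (s t : ℝ) (v : E3) : rot s (rot t v) = rot (s + t) v := by
  apply E3.ext_coord <;> simp [Real.cos_add, Real.sin_add] <;> ring

@[simp] lemma rot_zero (v : E3) : rot 0 v = v := by
  apply E3.ext_coord <;> simp

@[simp] lemma rot_neg_rot (t : ℝ) (v : E3) : rot (-t) (rot t v) = v := by
  rw [rot_rot]; simp

@[simp] lemma rot_rot_neg (t : ℝ) (v : E3) : rot t (rot (-t) v) = v := by
  rw [rot_rot]; simp

@[simp] lemma norm_rot (t : ℝ) (v : E3) : ‖rot t v‖ = ‖v‖ := by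
  rw [← sq_eq_sq₀ (norm_nonneg _) (norm_nonneg _), norm_sq_coord, norm_sq_coord]
  simp
  linear_combination (v 0 ^ 2 + v 1 ^ 2) * Real.sin_sq_add_cos_sq t

lemma J_rot (t : ℝ) (v : E3) : J (rot t v) = rot t (J v) := by
  apply E3.ext_coord <;> simp <;> ring

@[simp] lemma rot_vert (t : ℝ) : rot t vert = vert := by
  apply E3.ext_coord <;> simp

lemma cross_rot (t : ℝ) (u v : E3) : cross (rot t u) (rot t v) = rot t (cross u v) := by
  apply E3.ext_coord <;> simp
  · ring
  · ring
  · linear_combination (u 0 * v 1 - u 1 * v 0) * Real.sin_sq_add_cos_sq t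

lemma hasDerivAt_rot (t : ℝ) : HasDerivAt rot (J.comp (rot t)) t := by
  have h := ((hasDerivAt_const t (ContinuousLinearMap.id ℝ E3)).add
    ((Real.hasDerivAt_sin t).smul_const J)).add
    (((Real.hasDerivAt_cos t).const_sub 1).smul_const (J.comp J))
  refine h.congr_deriv ?_
  ext v i
  fin_cases i <;> simp
  ring

lemma hasDerivAt_rot_apply {θ : ℝ → ℝ} {θ' : ℝ} {f : ℝ → E3} {f' : E3} {s : ℝ}
    (hθ : HasDerivAt θ θ' s) (hf : HasDerivAt f f' s) :
    HasDerivAt (fun s => rot (θ s) (f s)) (rot (θ s) (f' + θ' • J (f s))) s := by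
  have h1 : HasDerivAt (fun s => rot (θ s)) (θ' • J.comp (rot (θ s))) s :=
    (hasDerivAt_rot (θ s)).scomp s hθ
  have h2 := HasDerivAt.clm_apply h1 hf
  refine h2.congr_deriv ?_
  simp [add_comm, J_rot]

/-- The derivative of a curve seen in the frame rotating by the angle `-a log s`. -/
lemma hasDerivAt_unrot (a : ℝ) {f : ℝ → E3} {f' : E3} {s : ℝ} (hs : s ≠ 0)
    (hf : HasDerivAt f f' s) :
    HasDerivAt (fun s => rot (-(a * Real.log s)) (f s))
      (rot (-(a * Real.log s)) f' - (a / s) • J (rot (-(a * Real.log s)) (f s))) s := by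
  have h1 : HasDerivAt (fun s => -(a * Real.log s)) (-(a * s⁻¹)) s :=
    ((Real.hasDerivAt_log hs).const_mul a).neg
  refine (hasDerivAt_rot_apply h1 hf).congr_deriv ?_
  simp [div_eq_mul_inv, sub_eq_add_neg, J_rot]

lemma act_skew (a : ℝ) (v : E3) : act (skew a) v = a • J v := by
  apply E3.ext_coord <;> simp [act, skew, dotProduct, Fin.sum_univ_three]

lemma act_one_add_skew (a : ℝ) (v : E3) : act (1 + skew a) v = v + a • J v := by
  rw [← act_skew]
  simp [act, Matrix.add_mulVec]

lemma isUnit_det_one_add_skew (a : ℝ) : IsUnit (1 + skew a).det := by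
  have : (1 + skew a).det = 1 + a ^ 2 := by
    simp [skew, Matrix.det_fin_three, Matrix.add_apply]
    ring
  rw [this]
  exact (by positivity : (1 + a ^ 2) ≠ 0).isUnit

lemma asymVec_add (a : ℝ) (B : E3) : asymVec a B + a • J (asymVec a B) = B := by
  rw [← act_one_add_skew, asymVec, act, act]
  simp [Matrix.mul_nonsing_inv _ (isUnit_det_one_add_skew a)]

/-- The operator `I + 𝒜` is injective. -/
lemma eq_asymVec (a : ℝ) {v B : E3} (h : v + a • J v = B) : v = asymVec a B := by
  subst h
  rw [← act_one_add_skew, asymVec, act, act]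
  simp [Matrix.nonsing_inv_mul _ (isUnit_det_one_add_skew a)]

section Exponential

-- The derivative of `NormedSpace.exp` needs some norm on the matrices; which one is immaterial.
attribute [local instance] Matrix.linftyOpNormedRing Matrix.linftyOpNormedAlgebra

/-- The one-parameter group `e^{t𝒜}` consists of the rotations about the vertical axis:
`t ↦ rot (-a t) e^{t𝒜} v` has derivative zero. -/
lemma act_expSkew (a t : ℝ) (v : E3) : act (expSkew a t) v = rot (a * t) v := by
  have hact : ∀ M N : Matrix (Fin 3) (Fin 3) ℝ, act (M * N) v = act M (act N v) := by
    intro M N; simp [act]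
  have hd : ∀ s, HasDerivAt (fun s => act (expSkew a s) v)
      (act (skew a) (act (expSkew a s) v)) s := by
    intro s
    have h := hasDerivAt_exp_smul_const' (𝕂 := ℝ) (skew a) s
    let ev : Matrix (Fin 3) (Fin 3) ℝ →ₗ[ℝ] E3 :=
      { toFun := fun M => act M v
        map_add' := by intro M N; simp [act, Matrix.add_mulVec]
        map_smul' := by intro r M; simp [act, Matrix.smul_mulVec] }
    have h2 : HasDerivAt (fun s : ℝ => (LinearMap.toContinuousLinearMap ev) (expSkew a s))
        ((LinearMap.toContinuousLinearMap ev) (skew a * expSkew a s)) s :=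
      (LinearMap.toContinuousLinearMap ev).hasFDerivAt.comp_hasDerivAt s h
    exact h2.congr_deriv (hact _ _)
  have hg : ∀ s, HasDerivAt (fun s => rot (-(a * s)) (act (expSkew a s) v)) 0 s := by
    intro s
    have h1 : HasDerivAt (fun s => -(a * s)) (-(a * 1)) s := ((hasDerivAt_id s).const_mul a).neg
    refine (hasDerivAt_rot_apply h1 (hd s)).congr_deriv ?_
    simp [act_skew]
  have hc := is_const_of_deriv_eq_zero (fun s => (hg s).differentiableAt)
    (fun s => (hg s).deriv) t 0
  have h0 : act (expSkew a 0) v = v := by simp [expSkew, act]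
  simp only [h0, mul_zero, neg_zero, rot_zero] at hc
  calc act (expSkew a t) v = rot (a * t) (rot (-(a * t)) (act (expSkew a t) v)) :=
        (rot_rot_neg _ _).symm
    _ = rot (a * t) v := by rw [hc]

end Exponential

/-! ### The equation as a first-order system -/

/-- The cross product as a continuous bilinear map. -/
def crossL : E3 →L[ℝ] E3 →L[ℝ] E3 :=
  (LinearMap.mk₂ ℝ cross
    (by intros; apply E3.ext_coord <;> simp <;> ring)
    (by intros; apply E3.ext_coord <;> simp <;> ring)
    (by intros; apply E3.ext_coord <;> simp <;> ring)
    (by intros; apply E3.ext_coord <;> simp <;> ring)).toContinuousBilinearMap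

lemma crossL_apply (u v : E3) : crossL u v = cross u v := rfl

lemma hasDerivAt_cross {u v : ℝ → E3} {u' v' : E3} {s : ℝ}
    (hu : HasDerivAt u u' s) (hv : HasDerivAt v v' s) :
    HasDerivAt (fun s => cross (u s) (v s)) (cross (u s) v' + cross u' (v s)) s :=
  crossL.hasDerivAt_of_bilinear (fun _ => hu) (fun _ => hv)

lemma hasDerivAt_coord {f : ℝ → E3} {f' : E3} {s : ℝ} (hf : HasDerivAt f f' s) (i : Fin 3) :
    HasDerivAt (fun s => f s i) (f' i) s :=
  (EuclideanSpace.proj (𝕜 := ℝ) i).hasFDerivAt.comp_hasDerivAt s hf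

/-- The first-order form of the equation: `V = (I + 𝒜) G` and the tangent `T` satisfy
`T' = ½ V × T`, together with the two constraints `|T| = 1` and `⟪V, T⟫ = s`. -/
structure IsCurve (a : ℝ) (G T : ℝ → E3) : Prop where
  hasDerivAt_curve : ∀ s, HasDerivAt G (T s) s
  hasDerivAt_tangent : ∀ s, HasDerivAt T ((1 / 2 : ℝ) • cross (G s + a • J (G s)) (T s)) s
  norm_tangent : ∀ s, ‖T s‖ = 1
  inner_tangent : ∀ s, inner ℝ (G s + a • J (G s)) (T s) = s

lemma sq_coord_of_norm_eq_one {v : E3} (h : ‖v‖ = 1) : v 0 ^ 2 + v 1 ^ 2 + v 2 ^ 2 = 1 := by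
  rw [← norm_sq_coord, h, one_pow]

lemma IsSolution.isCurve {a : ℝ} {G : ℝ → E3} (h : IsSolution a G) :
    IsCurve a G (tangent G) := by
  obtain ⟨hG, hE⟩ := h
  have h1 : ∀ s, HasDerivAt G (tangent G s) s := fun s =>
    (hG.differentiable (by norm_num) s).hasDerivAt
  have h2 : ∀ s, HasDerivAt (tangent G) (deriv (deriv G) s) s := fun s => by
    have : Differentiable ℝ (deriv G) :=
      (contDiff_succ_iff_deriv.1 (show ContDiff ℝ (1 + 1) G from hG)).2.2.differentiable
        (by norm_num)
    exact (this s).hasDerivAt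
  have hn : ∀ s, ‖tangent G s‖ = 1 := fun s => (hE s).2
  have horth : ∀ s, inner ℝ (tangent G s) (deriv (deriv G) s) = 0 := fun s => by
    have e := (h2 s).norm_sq.unique ((hasDerivAt_const s (1 : ℝ)).congr_of_eventuallyEq
      (Eventually.of_forall fun t => by simp [hn t]))
    linarith
  refine ⟨h1, fun s => (h2 s).congr_deriv ?_, hn, fun s => ?_⟩
  all_goals
    have e := (hE s).1
    rw [act_one_add_skew, sub_eq_iff_eq_add] at e
    rw [e]
    change _ = _ at e
    have ho := horth s
    have hs := sq_coord_of_norm_eq_one (hn s)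
    rw [inner_coord] at ho
    simp only [tangent] at ho hs ⊢
  · apply E3.ext_coord <;> simp
    · linear_combination (- deriv (deriv G) s 0) * hs + deriv G s 0 * ho
    · linear_combination (- deriv (deriv G) s 1) * hs + deriv G s 1 * ho
    · linear_combination (- deriv (deriv G) s 2) * hs + deriv G s 2 * ho
  · rw [inner_coord]
    simp
    linear_combination s * hs

lemma IsCurve.isSolution {a : ℝ} {G T : ℝ → E3} (h : IsCurve a G T) : IsSolution a G := by
  have h1 : deriv G = T := funext fun s => (h.hasDerivAt_curve s).deriv
  have h2 : deriv T = fun s => (1 / 2 : ℝ) • cross (G s + a • J (G s)) (T s) :=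
    funext fun s => (h.hasDerivAt_tangent s).deriv
  refine ⟨?_, fun s => ⟨?_, ?_⟩⟩
  · change ContDiff ℝ (1 + 1) G
    rw [contDiff_succ_iff_deriv]
    refine ⟨fun s => (h.hasDerivAt_curve s).differentiableAt, by simp, ?_⟩
    rw [h1, contDiff_one_iff_deriv]
    refine ⟨fun s => (h.hasDerivAt_tangent s).differentiableAt, ?_⟩
    rw [h2]
    have c1 : Continuous G :=
      continuous_iff_continuousAt.2 fun s => (h.hasDerivAt_curve s).continuousAt
    have c2 : Continuous T :=
      continuous_iff_continuousAt.2 fun s => (h.hasDerivAt_tangent s).continuousAt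
    simp only [← crossL_apply]
    fun_prop
  · rw [act_one_add_skew, h1, h2]
    beta_reduce
    have hs := sq_coord_of_norm_eq_one (h.norm_tangent s)
    have hi := h.inner_tangent s
    rw [inner_coord] at hi
    generalize G s + a • J (G s) = V at *
    apply E3.ext_coord <;> simp
    · linear_combination (- V 0) * hs + T s 0 * hi
    · linear_combination (- V 1) * hs + T s 1 * hi
    · linear_combination (- V 2) * hs + T s 2 * hi
  · rw [h1]
    exact h.norm_tangent s

/-- The vector field `R(T) = a e₃ - (3 a T₃ + 2 α) T`, equal to `2 c² T + T × 𝒜T` for a unit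
vector `T` with `c² = -a T₃ - α`; it is the non-oscillating forcing in the equation of `T'`. -/
def forcing (a α : ℝ) (v : E3) : E3 := a • vert - (3 * a * v 2 + 2 * α) • v

/-- A solution written as a first-order system for the curve `G`, the tangent `T`, its derivative
`P = T'` and `N = T × T'`, with conserved quantity `α = -a T₃ - |T'|²`. -/
structure IsFrame (a α : ℝ) (G T P N : ℝ → E3) : Prop where
  hasDerivAt_G : ∀ s, HasDerivAt G (T s) s
  hasDerivAt_T : ∀ s, HasDerivAt T (P s) s
  hasDerivAt_P : ∀ s, HasDerivAt P ((s / 2) • N s - (1 / 2 : ℝ) • forcing a α (T s)) s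
  hasDerivAt_N : ∀ s, HasDerivAt N ((a / 2) • J (T s) - (s / 2) • P s) s
  norm_T : ∀ s, ‖T s‖ = 1
  inner_T_P : ∀ s, inner ℝ (T s) (P s) = 0
  N_eq : ∀ s, N s = cross (T s) (P s)
  norm_P : ∀ s, ‖P s‖ ^ 2 = -a * T s 2 - α
  curve_eq : ∀ s, G s + a • J (G s) = s • T s + (2 : ℝ) • N s

lemma IsCurve.isFrame {a : ℝ} {G T : ℝ → E3} (h : IsCurve a G T) :
    IsFrame a (alpha a G) G T (deriv T) (fun s => cross (T s) (deriv T s)) := by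
  have hP : ∀ s, deriv T s = (1 / 2 : ℝ) • cross (G s + a • J (G s)) (T s) := fun s =>
    (h.hasDerivAt_tangent s).deriv
  have hT : ∀ s, HasDerivAt T (deriv T s) s := fun s => by
    rw [hP]; exact h.hasDerivAt_tangent s
  have htan : tangent G = T := funext fun s => (h.hasDerivAt_curve s).deriv
  have horth : ∀ s, inner ℝ (T s) (deriv T s) = 0 := fun s => by
    rw [hP, inner_coord]; simp; ring
  have hV : ∀ s, G s + a • J (G s) = s • T s + (2 : ℝ) • cross (T s) (deriv T s) := fun s => by
    have hs := sq_coord_of_norm_eq_one (h.norm_tangent s)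
    have hi := h.inner_tangent s
    rw [inner_coord] at hi
    rw [hP]
    generalize G s + a • J (G s) = V at *
    apply E3.ext_coord <;> simp
    · linear_combination (- V 0) * hs + T s 0 * hi
    · linear_combination (- V 1) * hs + T s 1 * hi
    · linear_combination (- V 2) * hs + T s 2 * hi
  -- the derivative of `T'` before the conservation law is known
  have hP' : ∀ s, HasDerivAt (deriv T)
      ((s / 2) • cross (T s) (deriv T s) - (a / 2) • (vert - T s 2 • T s)
        - ‖deriv T s‖ ^ 2 • T s) s := fun s => by
    have e : deriv T = fun s => (1 / 2 : ℝ) • cross (G s + a • J (G s)) (T s) := funext hP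
    have hG := h.hasDerivAt_curve s
    have hV' : HasDerivAt (fun s => G s + a • J (G s)) (T s + a • J (T s)) s :=
      hG.add ((J.hasFDerivAt.comp_hasDerivAt s hG).const_smul a)
    have h3 : HasDerivAt (fun s => (1 / 2 : ℝ) • cross (G s + a • J (G s)) (T s)) _ s :=
      (hasDerivAt_cross hV' (hT s)).const_smul (1 / 2 : ℝ)
    rw [← e] at h3
    refine h3.congr_deriv ?_
    have hs := sq_coord_of_norm_eq_one (h.norm_tangent s)
    have ho := horth s
    rw [inner_coord] at ho
    rw [hV, norm_sq_coord]
    generalize deriv T s = p at *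
    generalize T s = t at *
    apply E3.ext_coord <;> simp
    · linear_combination p 0 * ho
    · linear_combination p 1 * ho
    · linear_combination (-a / 2) * hs + p 2 * ho
  have hcons : ∀ s, ‖deriv T s‖ ^ 2 = -a * T s 2 - alpha a G := fun s => by
    have hd : ∀ s, HasDerivAt (fun s => ‖deriv T s‖ ^ 2 + a * T s 2) 0 s := fun s => by
      refine ((hP' s).norm_sq.add ((hasDerivAt_coord (hT s) 2).const_mul a)).congr_deriv ?_
      have ho := horth s
      rw [inner_coord] at ho ⊢
      generalize deriv T s = p at *
      generalize T s = t at *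
      simp
      linear_combination (a * t 2 - 2 * ‖p‖ ^ 2) * ho
    have e := is_const_of_deriv_eq_zero (fun s => (hd s).differentiableAt)
      (fun s => (hd s).deriv) s 0
    have e0 := hV 0
    have hs := sq_coord_of_norm_eq_one (h.norm_tangent 0)
    have ho := horth 0
    rw [inner_coord] at ho
    have : (1 / 4) * ‖act (1 + skew a) (G 0)‖ ^ 2 = ‖deriv T 0‖ ^ 2 := by
      rw [act_one_add_skew, e0, norm_sq_coord, norm_sq_coord]
      generalize deriv T 0 = p at *
      generalize T 0 = t at *
      simp
      linear_combination (p 0 ^ 2 + p 1 ^ 2 + p 2 ^ 2) * hs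
        - (t 0 * p 0 + t 1 * p 1 + t 2 * p 2) * ho
    simp only [alpha, htan, this]
    linarith
  refine ⟨h.hasDerivAt_curve, hT, fun s => (hP' s).congr_deriv ?_, fun s => ?_, h.norm_tangent,
    horth, fun s => rfl, hcons, hV⟩
  · rw [hcons]
    apply E3.ext_coord <;> simp [forcing] <;> ring
  · refine (hasDerivAt_cross (hT s) (hP' s)).congr_deriv ?_
    have hs := sq_coord_of_norm_eq_one (h.norm_tangent s)
    have ho := horth s
    rw [inner_coord] at ho
    generalize deriv T s = p at *
    generalize T s = t at *
    apply E3.ext_coord <;> simp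
    · linear_combination (-s / 2 * p 0) * hs + s / 2 * t 0 * ho
    · linear_combination (-s / 2 * p 1) * hs + s / 2 * t 1 * ho
    · linear_combination (-s / 2 * p 2) * hs + s / 2 * t 2 * ho

/-! ### Global existence, uniqueness and continuous dependence -/

open scoped Manifold in
lemma hasMFDerivAt_iff_hasDerivAt {E : Type*} [NormedAddCommGroup E] [NormedSpace ℝ E]
    {γ : ℝ → E} {v : E} {t : ℝ} :
    HasMFDerivAt 𝓘(ℝ, ℝ) 𝓘(ℝ, E) γ t ((1 : ℝ →L[ℝ] ℝ).smulRight v : ℝ →L[ℝ] E) ↔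
      HasDerivAt γ v t := by
  have : ((1 : ℝ →L[ℝ] ℝ).smulRight v : ℝ →L[ℝ] E) = ContinuousLinearMap.toSpanSingleton ℝ v := by
    ext; simp
  rw [hasDerivAt_iff_hasFDerivAt, ← this]
  exact hasMFDerivAt_iff_hasFDerivAt

open scoped Manifold in
/-- Integral curves of a `C¹` field on the intervals `(-R, R)` glue to a global one. -/
lemma exists_global_of_forall_Ioo {E : Type*} [NormedAddCommGroup E] [NormedSpace ℝ E]
    [CompleteSpace E] {f : E → E} (hf : ContDiff ℝ 1 f) (x₀ : E)
    (h : ∀ R : ℝ, ∃ γ : ℝ → E, γ 0 = x₀ ∧ ∀ t ∈ Set.Ioo (-R) R, HasDerivAt γ (f (γ t)) t) :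
    ∃ γ : ℝ → E, γ 0 = x₀ ∧ ∀ t, HasDerivAt γ (f (γ t)) t := by
  have hv : ContMDiff 𝓘(ℝ, E) 𝓘(ℝ, E).tangent 1
      (fun x ↦ (⟨x, f x⟩ : TangentBundle 𝓘(ℝ, E) E)) :=
    contMDiff_vectorSpace_iff_contDiff.2 hf
  obtain ⟨γ, h0, hγ⟩ := (exists_isMIntegralCurve_iff_exists_isMIntegralCurveOn_Ioo
    (I := 𝓘(ℝ, E)) (v := f) hv x₀).2 fun R => by
      obtain ⟨γ, h0, hγ⟩ := h R
      refine ⟨γ, h0, fun t ht => ?_⟩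
      exact (hasMFDerivAt_iff_hasDerivAt.2 (hγ t ht)).hasMFDerivWithinAt
  exact ⟨γ, h0, fun t => hasMFDerivAt_iff_hasDerivAt.1 (hγ t)⟩

open scoped Manifold in
lemma integralCurve_unique {E : Type*} [NormedAddCommGroup E] [NormedSpace ℝ E]
    [CompleteSpace E] {f : E → E} (hf : ContDiff ℝ 1 f) {γ γ' : ℝ → E}
    (h : ∀ t, HasDerivAt γ (f (γ t)) t) (h' : ∀ t, HasDerivAt γ' (f (γ' t)) t) {t₀ : ℝ}
    (h0 : γ t₀ = γ' t₀) : γ = γ' :=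
  isMIntegralCurve_Ioo_eq_of_contMDiff_boundaryless (I := 𝓘(ℝ, E)) (v := f) (t₀ := t₀)
    (contMDiff_vectorSpace_iff_contDiff.2 hf)
    (fun t => hasMFDerivAt_iff_hasDerivAt.2 (h t))
    (fun t => hasMFDerivAt_iff_hasDerivAt.2 (h' t)) h0

/-- The autonomous vector field `(G, T) ↦ (T, ½ (I + 𝒜) G × T)`. -/
def curveField (a : ℝ) (x : E3 × E3) : E3 × E3 :=
  (x.2, (1 / 2 : ℝ) • cross (x.1 + a • J x.1) x.2)

lemma contDiff_curveField (a : ℝ) : ContDiff ℝ 1 (curveField a) := by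
  unfold curveField
  simp only [← crossL_apply]
  fun_prop

lemma IsCurve.hasDerivAt_prod {a : ℝ} {G T : ℝ → E3} (h : IsCurve a G T) (s : ℝ) :
    HasDerivAt (fun s => (G s, T s)) (curveField a (G s, T s)) s :=
  (h.hasDerivAt_curve s).prodMk (h.hasDerivAt_tangent s)

lemma IsCurve.eq_of_eq {a : ℝ} {G T G' T' : ℝ → E3} (h : IsCurve a G T) (h' : IsCurve a G' T')
    {t₀ : ℝ} (hG : G t₀ = G' t₀) (hT : T t₀ = T' t₀) : G = G' := by
  have e := integralCurve_unique (contDiff_curveField a) h.hasDerivAt_prod h'.hasDerivAt_prod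
    (t₀ := t₀) (by simp [hG, hT])
  exact funext fun s => congrArg Prod.fst (congrFun e s)

/-- A bounded Lipschitz field has integral curves on every interval `(-R, R)`. -/
lemma exists_Ioo_of_bounded {E : Type*} [NormedAddCommGroup E] [NormedSpace ℝ E]
    [CompleteSpace E] {f : E → E} {K : NNReal} (hf : LipschitzWith K f) {C : ℝ}
    (hC : ∀ x, ‖f x‖ ≤ C) (x₀ : E) (R : ℝ) (hR : 0 < R) :
    ∃ γ : ℝ → E, γ 0 = x₀ ∧ ∀ t ∈ Set.Ioo (-R) R, HasDerivAt γ (f (γ t)) t := by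
  have hC0 : 0 ≤ C := (norm_nonneg _).trans (hC x₀)
  have hpl : IsPicardLindelof (fun _ => f) (tmin := -R) (tmax := R)
      ⟨0, by constructor <;> linarith⟩ x₀ (C.toNNReal * R.toNNReal) 0 C.toNNReal K := by
    refine IsPicardLindelof.of_time_independent (fun x _ => ?_) hf.lipschitzOnWith ?_
    · rw [Real.coe_toNNReal _ hC0]; exact hC x
    · simp [Real.coe_toNNReal _ hC0, Real.coe_toNNReal _ hR.le]
  obtain ⟨γ, h0, hγ⟩ := hpl.exists_eq_forall_mem_Icc_hasDerivWithinAt₀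
  exact ⟨γ, h0, fun t ht => (hγ t (Set.Ioo_subset_Icc_self ht)).hasDerivAt
    (Icc_mem_nhds ht.1 ht.2)⟩

lemma inner_cross_right_self (u v : E3) : inner ℝ v (cross u v) = 0 := by
  rw [inner_coord]; simp; ring

/-- Multiplying the field by a bump function makes it bounded and Lipschitz; since `|T|` stays
constant and `|G'| ≤ 1`, the truncation is not felt on `(-R, R)`. -/
lemma exists_curveField_Ioo (a : ℝ) (g v : E3) (hv : ‖v‖ = 1) (R : ℝ) (hR : 0 < R) :
    ∃ γ : ℝ → E3 × E3, γ 0 = (g, v) ∧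
      ∀ t ∈ Set.Ioo (-R) R, HasDerivAt γ (curveField a (γ t)) t := by
  let χ : ContDiffBump (0 : E3 × E3) := ⟨‖g‖ + R + 1, ‖g‖ + R + 2, by positivity, by linarith⟩
  let f : E3 × E3 → E3 × E3 := fun x => χ x • curveField a x
  have hf : ContDiff ℝ 1 f := (χ.contDiff).smul (contDiff_curveField a)
  have hsupp : HasCompactSupport f := χ.hasCompactSupport.smul_right
  obtain ⟨K, hK⟩ := ContDiff.lipschitzWith_of_hasCompactSupport hsupp hf one_ne_zero
  obtain ⟨C, hC⟩ := hsupp.exists_bound_of_continuous hf.continuous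
  obtain ⟨γ, h0, hγ⟩ := exists_Ioo_of_bounded hK hC (g, v) R hR
  refine ⟨γ, h0, fun t ht => ?_⟩
  have h1 : ∀ s ∈ Set.Ioo (-R) R, HasDerivAt (fun s => (γ s).1) (χ (γ s) • (γ s).2) s :=
    fun s hs => (hγ s hs).fst
  have h2 : ∀ s ∈ Set.Ioo (-R) R, HasDerivAt (fun s => (γ s).2)
      (χ (γ s) • (1 / 2 : ℝ) • cross ((γ s).1 + a • J (γ s).1) (γ s).2) s :=
    fun s hs => (hγ s hs).snd
  have hmem : (0 : ℝ) ∈ Set.Ioo (-R) R := ⟨by linarith, hR⟩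
  have hn : ∀ s ∈ Set.Ioo (-R) R, ‖(γ s).2‖ = 1 := fun s hs => by
    have hd : ∀ s ∈ Set.Ioo (-R) R, HasDerivAt (fun s => ‖(γ s).2‖ ^ 2) 0 s := fun s hs => by
      refine (h2 s hs).norm_sq.congr_deriv ?_
      simp [inner_smul_right, inner_cross_right_self]
    have e := isOpen_Ioo.is_const_of_deriv_eq_zero isPreconnected_Ioo
      (fun s hs => (hd s hs).differentiableAt.differentiableWithinAt)
      (fun s hs => (hd s hs).deriv) hs hmem
    simp only [h0, hv] at e
    exact (pow_eq_one_iff_of_nonneg (norm_nonneg _) two_ne_zero).1 (e.trans (one_pow 2))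
  have hb : ‖(γ t).1 - g‖ ≤ R := by
    have e := (convex_Ioo (-R) R).norm_image_sub_le_of_norm_hasDerivWithin_le (C := 1)
      (fun s hs => (h1 s hs).hasDerivWithinAt) (fun s hs => by
        rw [norm_smul, hn s hs, mul_one, Real.norm_of_nonneg χ.nonneg]
        exact χ.le_one) hmem ht
    simp only [h0, one_mul, sub_zero, Real.norm_eq_abs] at e
    exact e.trans (abs_lt.2 ht).le
  have hχ : χ (γ t) = 1 := by
    apply χ.one_of_mem_closedBall
    rw [mem_closedBall_zero_iff, Prod.norm_def, hn t ht]
    refine max_le ?_ (by change 1 ≤ ‖g‖ + R + 1; linarith [norm_nonneg g])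
    change _ ≤ ‖g‖ + R + 1
    have := norm_le_norm_add_norm_sub' (γ t).1 g
    linarith
  have := hγ t ht
  simpa only [f, hχ, one_smul] using this

/-- The Cauchy problem for curves is globally solvable. -/
lemma exists_isCurve (a t₀ : ℝ) (g v : E3) (hv : ‖v‖ = 1)
    (hgv : inner ℝ (g + a • J g) v = t₀) :
    ∃ G T : ℝ → E3, IsCurve a G T ∧ G t₀ = g ∧ T t₀ = v := by
  obtain ⟨γ, h0, hγ⟩ := exists_global_of_forall_Ioo (contDiff_curveField a) (g, v) fun R => by
    obtain ⟨γ, h0, hγ⟩ := exists_curveField_Ioo a g v hv (|R| + 1) (by positivity)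
    exact ⟨γ, h0, fun t ht => hγ t ⟨by linarith [ht.1, le_abs_self R],
      by linarith [ht.2, le_abs_self R]⟩⟩
  have hγ' : ∀ s, HasDerivAt (fun s => γ (s - t₀)) (curveField a (γ (s - t₀))) s := fun s =>
    (hγ (s - t₀)).comp_sub_const s t₀
  have h1 : ∀ s, HasDerivAt (fun s => (γ (s - t₀)).1) (γ (s - t₀)).2 s := fun s => (hγ' s).fst
  have h2 : ∀ s, HasDerivAt (fun s => (γ (s - t₀)).2) ((1 / 2 : ℝ) • cross
      ((γ (s - t₀)).1 + a • J (γ (s - t₀)).1) (γ (s - t₀)).2) s := fun s => (hγ' s).snd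
  have hn : ∀ s, ‖(γ (s - t₀)).2‖ = 1 := fun s => by
    have hd : ∀ s, HasDerivAt (fun s => ‖(γ (s - t₀)).2‖ ^ 2) 0 s := fun s => by
      refine (h2 s).norm_sq.congr_deriv ?_
      simp [inner_smul_right, inner_cross_right_self]
    have e := is_const_of_deriv_eq_zero (fun s => (hd s).differentiableAt)
      (fun s => (hd s).deriv) s t₀
    simp only [sub_self, h0, hv] at e
    exact (pow_eq_one_iff_of_nonneg (norm_nonneg _) two_ne_zero).1 (e.trans (one_pow 2))
  refine ⟨_, _, ⟨h1, h2, hn, fun s => ?_⟩, by simp [h0], by simp [h0]⟩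
  have hd : ∀ s, HasDerivAt (fun s =>
      inner ℝ ((γ (s - t₀)).1 + a • J (γ (s - t₀)).1) (γ (s - t₀)).2 - s) 0 s := fun s => by
    have hV := (h1 s).add ((J.hasFDerivAt.comp_hasDerivAt s (h1 s)).const_smul a)
    refine ((hV.inner ℝ (h2 s)).sub (hasDerivAt_id s)).congr_deriv ?_
    have hs := sq_coord_of_norm_eq_one (hn s)
    rw [inner_coord, inner_coord]
    simp
    linear_combination hs
  have e := is_const_of_deriv_eq_zero (fun s => (hd s).differentiableAt)
    (fun s => (hd s).deriv) s t₀
  simp only [sub_self, h0, hgv] at e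
  linarith

lemma IsCurve.norm_curve_le {a : ℝ} {G T : ℝ → E3} (h : IsCurve a G T) (s : ℝ) :
    ‖G s‖ ≤ ‖G 0‖ + |s| := by
  have e := convex_univ.norm_image_sub_le_of_norm_hasDerivWithin_le (C := 1)
      (fun s _ => (h.hasDerivAt_curve s).hasDerivWithinAt)
      (fun s _ => (h.norm_tangent s).le) (Set.mem_univ 0) (Set.mem_univ s)
  simp only [one_mul, sub_zero, Real.norm_eq_abs] at e
  linarith [norm_le_norm_add_norm_sub' (G s) (G 0)]

/-- Continuous dependence of curves on their data at `0`. -/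
lemma IsCurve.tendsto_of_tendsto {a : ℝ} {G T : ℕ → ℝ → E3} {G₀ T₀ : ℝ → E3}
    (h : ∀ n, IsCurve a (G n) (T n)) (h₀ : IsCurve a G₀ T₀)
    (hG : Tendsto (fun n => G n 0) atTop (𝓝 (G₀ 0)))
    (hT : Tendsto (fun n => T n 0) atTop (𝓝 (T₀ 0))) {s : ℝ} (hs : 0 ≤ s) :
    Tendsto (fun n => G n s) atTop (𝓝 (G₀ s)) ∧ Tendsto (fun n => T n s) atTop (𝓝 (T₀ s)) := by
  obtain ⟨D, hD⟩ := hG.norm.bddAbove_range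
  have hD' : ∀ n, ‖G n 0‖ ≤ D := fun n => hD ⟨n, rfl⟩
  have hD0 : ‖G₀ 0‖ ≤ D := le_of_tendsto' hG.norm hD'
  have hDnn : 0 ≤ D := (norm_nonneg _).trans hD0
  obtain ⟨K, hK⟩ := ((contDiff_curveField a).contDiffOn (s := Metric.closedBall
    (0 : E3 × E3) (D + s + 1))).exists_lipschitzOnWith one_ne_zero (convex_closedBall _ _)
    (isCompact_closedBall _ _)
  have hmem : ∀ {G T : ℝ → E3}, IsCurve a G T → ‖G 0‖ ≤ D → ∀ t ∈ Set.Ico 0 s,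
      (G t, T t) ∈ Metric.closedBall (0 : E3 × E3) (D + s + 1) := fun h hD t ht => by
    rw [mem_closedBall_zero_iff, Prod.norm_def, h.norm_tangent]
    refine max_le ?_ (by linarith)
    have := h.norm_curve_le t
    rw [abs_of_nonneg ht.1] at this
    linarith [ht.2]
  have hcont : ∀ {G T : ℝ → E3}, IsCurve a G T →
      ContinuousOn (fun t => (G t, T t)) (Set.Icc 0 s) := fun h t _ =>
    (h.hasDerivAt_prod t).continuousAt.continuousWithinAt
  have key : ∀ n, dist (G n s, T n s) (G₀ s, T₀ s) ≤
      dist (G n 0, T n 0) (G₀ 0, T₀ 0) * Real.exp (K * (s - 0)) := fun n =>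
    dist_le_of_trajectories_ODE_of_mem (v := fun _ => curveField a)
      (s := fun _ => Metric.closedBall (0 : E3 × E3) (D + s + 1)) (fun _ _ => hK)
      (hcont (h n)) (fun t _ => ((h n).hasDerivAt_prod t).hasDerivWithinAt)
      (hmem (h n) (hD' n)) (hcont h₀) (fun t _ => (h₀.hasDerivAt_prod t).hasDerivWithinAt)
      (hmem h₀ hD0) le_rfl s ⟨hs, le_rfl⟩
  have hz : Tendsto (fun n => dist (G n 0, T n 0) (G₀ 0, T₀ 0) * Real.exp (K * (s - 0))) atTop
      (𝓝 0) := by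
    have := (tendsto_iff_dist_tendsto_zero.1 (hG.prodMk_nhds hT)).mul_const
      (Real.exp (K * (s - 0)))
    simpa using this
  have hlim : Tendsto (fun n => (G n s, T n s)) atTop (𝓝 (G₀ s, T₀ s)) :=
    tendsto_iff_dist_tendsto_zero.2 (squeeze_zero (fun _ => dist_nonneg) key hz)
  exact ⟨(continuous_fst.tendsto _).comp hlim, (continuous_snd.tendsto _).comp hlim⟩

/-! ### Uniform bounds and the scalar system for height and amplitude -/

/-- A function with derivative `O(s⁻ᵏ⁻¹)` varies by at most a multiple of `s⁻ᵏ` beyond `s`. -/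
lemma norm_sub_le_of_deriv_le {E : Type*} [NormedAddCommGroup E] [NormedSpace ℝ E]
    {f f' : ℝ → E} {C s t : ℝ} {k : ℕ} (hk : k ≠ 0) (hC : 0 ≤ C) (hs : 0 < s) (hst : s ≤ t)
    (hf : ∀ x ∈ Set.Icc s t, HasDerivAt f (f' x) x)
    (hb : ∀ x ∈ Set.Icc s t, ‖f' x‖ ≤ C * x⁻¹ ^ (k + 1)) :
    ‖f t - f s‖ ≤ C * s⁻¹ ^ k := by
  have hpos : ∀ x ∈ Set.Icc s t, 0 < x := fun x hx => hs.trans_le hx.1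
  have hB : ∀ x ∈ Set.Icc s t, HasDerivAt (fun x => C / k * (s⁻¹ ^ k - x⁻¹ ^ k))
      (C * x⁻¹ ^ (k + 1)) x := fun x hx => by
    have h := (((hasDerivAt_inv (hpos x hx).ne').pow k).const_sub (s⁻¹ ^ k)).const_mul (C / k)
    refine h.congr_deriv ?_
    have : (k : ℝ) ≠ 0 := Nat.cast_ne_zero.2 hk
    obtain ⟨m, rfl⟩ := Nat.exists_eq_succ_of_ne_zero hk
    simp only [Nat.succ_eq_add_one, Nat.add_sub_cancel] at *
    have e : C / ((m + 1 : ℕ) : ℝ) * -(((m + 1 : ℕ) : ℝ) * x⁻¹ ^ m * -(x ^ 2)⁻¹)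
        = C / ((m + 1 : ℕ) : ℝ) * ((m + 1 : ℕ) : ℝ) * (x⁻¹ ^ m * x⁻¹ ^ 2) := by
      rw [← inv_pow x 2]; ring
    rw [e, div_mul_cancel₀ _ this, ← pow_add]
  have h := image_norm_le_of_norm_deriv_right_le_deriv_boundary' (f := fun x => f x - f s)
    (f' := f') (a := s) (b := t)
    (fun x hx => ((hf x hx).sub_const (f s)).continuousAt.continuousWithinAt)
    (fun x hx => ((hf x (Set.Ico_subset_Icc_self hx)).sub_const (f s)).hasDerivWithinAt)
    (B := fun x => C / k * (s⁻¹ ^ k - x⁻¹ ^ k)) (B' := fun x => C * x⁻¹ ^ (k + 1))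
    (by simp) (fun x hx => (hB x hx).continuousAt.continuousWithinAt)
    (fun x hx => (hB x (Set.Ico_subset_Icc_self hx)).hasDerivWithinAt)
    (fun x hx => hb x (Set.Ico_subset_Icc_self hx)) ⟨hst, le_rfl⟩
  refine h.trans ?_
  have h1 : C / k ≤ C := div_le_self hC (by exact_mod_cast Nat.one_le_iff_ne_zero.2 hk)
  have h2 : s⁻¹ ^ k - t⁻¹ ^ k ≤ s⁻¹ ^ k :=
    sub_le_self _ (pow_nonneg (inv_nonneg.2 (hs.le.trans hst)) _)
  calc C / k * (s⁻¹ ^ k - t⁻¹ ^ k) ≤ C / k * s⁻¹ ^ k := by gcongr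
    _ ≤ C * s⁻¹ ^ k := by gcongr

lemma norm_sub_lim_le_of_deriv_le {E : Type*} [NormedAddCommGroup E] [NormedSpace ℝ E]
    {f f' : ℝ → E} {C s : ℝ} {k : ℕ} {l : E} (hk : k ≠ 0) (hC : 0 ≤ C) (hs : 0 < s)
    (hf : ∀ x, s ≤ x → HasDerivAt f (f' x) x)
    (hb : ∀ x, s ≤ x → ‖f' x‖ ≤ C * x⁻¹ ^ (k + 1)) (hl : Tendsto f atTop (𝓝 l)) :
    ‖f s - l‖ ≤ C * s⁻¹ ^ k := by
  have h1 : Tendsto (fun t => ‖f t - f s‖) atTop (𝓝 ‖l - f s‖) := (hl.sub_const _).norm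
  rw [norm_sub_rev]
  refine le_of_tendsto h1 ?_
  filter_upwards [eventually_ge_atTop s] with t ht
  exact norm_sub_le_of_deriv_le hk hC hs ht (fun x hx => hf x hx.1) (fun x hx => hb x hx.1)

lemma isBigO_sub_lim_of_deriv {E : Type*} [NormedAddCommGroup E] [NormedSpace ℝ E]
    {f f' : ℝ → E} {k : ℕ} {l : E} (hk : k ≠ 0)
    (hf : ∀ x, 0 < x → HasDerivAt f (f' x) x)
    (hb : f' =O[atTop] fun x : ℝ => x⁻¹ ^ (k + 1)) (hl : Tendsto f atTop (𝓝 l)) :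
    (fun x => f x - l) =O[atTop] fun x : ℝ => x⁻¹ ^ k := by
  obtain ⟨C, hC, hb⟩ := hb.exists_pos
  obtain ⟨s₀, hs₀⟩ := eventually_atTop.1 hb.bound
  refine IsBigO.of_bound C ?_
  filter_upwards [eventually_ge_atTop s₀, eventually_gt_atTop 0] with s hs hs0
  rw [norm_pow, norm_inv, Real.norm_of_nonneg hs0.le]
  refine norm_sub_lim_le_of_deriv_le hk hC.le hs0 (fun x hx => hf x (hs0.trans_le hx))
    (fun x hx => ?_) hl
  have := hs₀ x (hs.trans hx)
  rwa [norm_pow, norm_inv, Real.norm_of_nonneg (hs0.le.trans hx)] at this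

/-- A curve seen in the frame rotating by the angle `-a log s`, that is `e^{-𝒜 log s} f(s)`. -/
def unrot (a : ℝ) (f : ℝ → E3) (s : ℝ) : E3 := rot (-(a * Real.log s)) (f s)

@[simp] lemma unrot_apply_two (a : ℝ) (f : ℝ → E3) (s : ℝ) : unrot a f s 2 = f s 2 := by
  simp [unrot]

@[simp] lemma norm_unrot (a : ℝ) (f : ℝ → E3) (s : ℝ) : ‖unrot a f s‖ = ‖f s‖ := by
  simp [unrot]

/-- A bound for `|T'|` and `|T × T'|` in terms of the parameters alone. -/
def frameBound (a α : ℝ) : ℝ := |a| + |α| + 1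

lemma frameBound_pos (a α : ℝ) : 0 < frameBound a α := by unfold frameBound; positivity

namespace IsFrame

variable {a α : ℝ} {G T P N : ℝ → E3}

lemma norm_N_sq (H : IsFrame a α G T P N) (s : ℝ) : ‖N s‖ ^ 2 = ‖P s‖ ^ 2 := by
  have hs := sq_coord_of_norm_eq_one (H.norm_T s)
  have ho := H.inner_T_P s
  rw [inner_coord] at ho
  rw [H.N_eq, norm_sq_coord, norm_sq_coord]
  generalize P s = p at *
  generalize T s = t at *
  simp
  linear_combination (p 0 ^ 2 + p 1 ^ 2 + p 2 ^ 2) * hs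
        - (t 0 * p 0 + t 1 * p 1 + t 2 * p 2) * ho

lemma norm_N (H : IsFrame a α G T P N) (s : ℝ) : ‖N s‖ = ‖P s‖ := by
  rw [← sq_eq_sq₀ (norm_nonneg _) (norm_nonneg _), H.norm_N_sq]

lemma abs_height_le (H : IsFrame a α G T P N) (s : ℝ) : |T s 2| ≤ 1 := by
  have hs := sq_coord_of_norm_eq_one (H.norm_T s)
  rw [← sq_le_one_iff_abs_le_one]
  nlinarith [sq_nonneg (T s 0), sq_nonneg (T s 1)]

lemma norm_P_le (H : IsFrame a α G T P N) (s : ℝ) : ‖P s‖ ≤ frameBound a α := by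
  refine abs_le_of_sq_le_sq' ?_ (frameBound_pos a α).le |>.2
  have h1 : -a * T s 2 ≤ |a| := by
    refine (le_abs_self _).trans ?_
    rw [abs_mul, abs_neg]
    exact mul_le_of_le_one_right (abs_nonneg a) (H.abs_height_le s)
  rw [H.norm_P, frameBound]
  nlinarith [neg_abs_le α, abs_nonneg a, abs_nonneg α]

lemma norm_N_le (H : IsFrame a α G T P N) (s : ℝ) : ‖N s‖ ≤ frameBound a α :=
  (H.norm_N s).trans_le (H.norm_P_le s)

lemma hasDerivAt_unrot_T (H : IsFrame a α G T P N) {s : ℝ} (hs : s ≠ 0) :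
    HasDerivAt (unrot a T) (unrot a P s - (a / s) • J (unrot a T s)) s :=
  hasDerivAt_unrot a hs (H.hasDerivAt_T s)

lemma forcing_rot (a α t : ℝ) (v : E3) : rot t (forcing a α v) = forcing a α (rot t v) := by
  simp [forcing]

lemma hasDerivAt_unrot_P (H : IsFrame a α G T P N) {s : ℝ} (hs : s ≠ 0) :
    HasDerivAt (unrot a P) ((s / 2) • unrot a N s - (1 / 2 : ℝ) • forcing a α (unrot a T s)
      - (a / s) • J (unrot a P s)) s := by
  refine (hasDerivAt_unrot a hs (H.hasDerivAt_P s)).congr_deriv ?_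
  simp only [map_sub, map_smul, forcing_rot]
  rfl

/-- The curve divided by `s` in the rotating frame has derivative `O(s⁻²)`. -/
lemma hasDerivAt_unrot_G (H : IsFrame a α G T P N) {s : ℝ} (hs : s ≠ 0) :
    HasDerivAt (fun s => s⁻¹ • unrot a G s) (-(2 * s⁻¹ ^ 2) • unrot a N s) s := by
  have h := (hasDerivAt_inv hs).smul (hasDerivAt_unrot a hs (H.hasDerivAt_G s))
  refine h.congr_deriv ?_
  have e : rot (-(a * Real.log s)) (T s) = s⁻¹ • (unrot a G s + a • J (unrot a G s)
      - (2 : ℝ) • unrot a N s) := by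
    have := congrArg (rot (-(a * Real.log s))) (H.curve_eq s)
    simp only [map_add, map_smul, ← J_rot] at this
    rw [eq_inv_smul_iff₀ hs]
    unfold unrot
    rw [this]; simp
  rw [e]
  change _ + _ • unrot a G s = _
  change _ • (_ - _ • J (unrot a G s)) + _ = _
  module

lemma curve_eq_unrot (H : IsFrame a α G T P N) {s : ℝ} (hs : s ≠ 0) :
    unrot a T s = s⁻¹ • unrot a G s + a • J (s⁻¹ • unrot a G s) - (2 * s⁻¹) • unrot a N s := by
  have := congrArg (rot (-(a * Real.log s))) (H.curve_eq s)
  simp only [map_add, map_smul, ← J_rot] at this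
  change unrot a G s + a • J (unrot a G s) = s • unrot a T s + (2 : ℝ) • unrot a N s at this
  have h2 : unrot a T s = s⁻¹ • (s • unrot a T s) := by rw [inv_smul_smul₀ hs]
  rw [h2, eq_sub_of_add_eq this.symm]
  simp only [map_smul]
  module

lemma norm_unrot_G_sub_le (H : IsFrame a α G T P N) {s t : ℝ} (hs : 0 < s) (hst : s ≤ t) :
    ‖t⁻¹ • unrot a G t - s⁻¹ • unrot a G s‖ ≤ 2 * frameBound a α * s⁻¹ := by
  have := norm_sub_le_of_deriv_le (k := 1) (C := 2 * frameBound a α) one_ne_zero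
    (by linarith [frameBound_pos a α]) hs hst
    (fun x hx => H.hasDerivAt_unrot_G (hs.trans_le hx.1).ne') (fun x hx => ?_)
  · simpa using this
  · rw [norm_smul, norm_unrot, norm_neg, Real.norm_of_nonneg (by positivity)]
    have := H.norm_N_le x
    have : 2 * x⁻¹ ^ 2 * ‖N x‖ ≤ 2 * x⁻¹ ^ 2 * frameBound a α := by gcongr
    linarith

end IsFrame

/-- The vertical component of `T' - i T × T'`. -/
def vertPart (P N : ℝ → E3) (s : ℝ) : ℂ := ⟨P s 2, -(N s 2)⟩

/-- The polynomial `Π(y) = (3a/2) y² + α y - a/2` in the closed scalar system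
`y' = Re h`, `h' = (i s / 2) h + Π(y)` satisfied by `y = T₃` and `h = (T' - i T × T')₃`. -/
def scalarPoly (a α y : ℝ) : ℝ := 3 * a / 2 * y ^ 2 + α * y - a / 2

namespace IsFrame

variable {a α : ℝ} {G T P N : ℝ → E3}

lemma hasDerivAt_height (H : IsFrame a α G T P N) (s : ℝ) :
    HasDerivAt (fun s => T s 2) (vertPart P N s).re s := hasDerivAt_coord (H.hasDerivAt_T s) 2

lemma hasDerivAt_vertPart (H : IsFrame a α G T P N) (s : ℝ) :
    HasDerivAt (vertPart P N)
      (Complex.I * s / 2 * vertPart P N s + scalarPoly a α (T s 2)) s := by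
  have h1 := (hasDerivAt_coord (H.hasDerivAt_P s) 2).ofReal_comp
  have h2 := ((hasDerivAt_coord (H.hasDerivAt_N s) 2).ofReal_comp).const_mul Complex.I
  have e : vertPart P N = fun s => ((P s 2 : ℝ) : ℂ) - Complex.I * ((N s 2 : ℝ) : ℂ) := by
    funext s; apply Complex.ext <;> simp [vertPart]
  have h3 := h1.sub h2
  rw [e]
  refine h3.congr_deriv ?_
  apply Complex.ext
  · simp [forcing, scalarPoly, -Complex.ofReal_pow]
    ring
  · simp [forcing, scalarPoly, -Complex.ofReal_pow]

lemma norm_vertPart_le (H : IsFrame a α G T P N) (s : ℝ) :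
    ‖vertPart P N s‖ ≤ 2 * frameBound a α := by
  have h1 : |P s 2| ≤ ‖P s‖ := PiLp.norm_apply_le (P s) 2
  have h2 : |N s 2| ≤ ‖N s‖ := PiLp.norm_apply_le (N s) 2
  have := Complex.norm_le_abs_re_add_abs_im (vertPart P N s)
  simp only [vertPart, abs_neg] at this ⊢
  linarith [H.norm_P_le s, H.norm_N_le s]

/-- The vertical component of `G / s` differs from that of `T` by an oscillating term. -/
lemma height_sub (H : IsFrame a α G T P N) {s : ℝ} (hs : s ≠ 0) :
    T s 2 - 2 * s⁻¹ * (vertPart P N s).im = (s⁻¹ • unrot a G s) 2 := by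
  have := congrArg (fun v : E3 => v 2) (H.curve_eq_unrot hs)
  simp at this
  simp [vertPart]
  linarith

end IsFrame

/-- The remainder in the equation of the corrected amplitude
`h - (2 i / s) Π(w) + (γ / s²) h̄`, multiplied by `s²`; here `p = 1 / s`, `w = y - (2 / s) Im h`
and `κ = s (w - β)`. -/
def phaseRemainder (a α β p y : ℝ) (h : ℂ) (κ : ℝ) : ℂ :=
  ((6 * a * h.im ^ 2 + 6 * a * κ * h.im + (3 * a * β + α) * scalarPoly a α y
      + 2 * (3 * a * β + α) * scalarPoly a α (y - 2 * p * h.im) : ℝ) : ℂ)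
    + Complex.I * ((2 * scalarPoly a α (y - 2 * p * h.im)
      - 4 * p * (3 * a * (y - 2 * p * h.im) + α) * h.im : ℝ) : ℂ)
    + (((-(2 * (3 * a * β + α) * p) : ℝ) : ℂ)
      + Complex.I * (((3 * a * β + α) ^ 2 * p : ℝ) : ℂ)) * (starRingEnd ℂ) h

/-- The correction `-2 i Π(w) + (γ / s) h̄` of the amplitude, multiplied by `s`. -/
def phaseCorrection (a α β p y : ℝ) (h : ℂ) : ℂ :=
  ((3 * a * β + α) * p : ℝ) * (starRingEnd ℂ) h
    - Complex.I * ((2 * scalarPoly a α (y - 2 * p * h.im) : ℝ) : ℂ)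

lemma hasDerivAt_scalarPoly (a α y : ℝ) : HasDerivAt (scalarPoly a α) (3 * a * y + α) y := by
  refine ((((hasDerivAt_pow 2 y).const_mul (3 * a / 2)).add
    ((hasDerivAt_id y).const_mul α)).sub_const (a / 2)).congr_deriv ?_
  norm_num
  ring

lemma hasDerivAt_phase (γ : ℝ) {s : ℝ} (hs : s ≠ 0) :
    HasDerivAt (phase γ) (s / 2 - γ * s⁻¹) s := by
  have h1 : HasDerivAt (fun s : ℝ => Real.log |s|) s⁻¹ s := by
    simpa only [Real.log_abs] using Real.hasDerivAt_log hs
  refine (((hasDerivAt_pow 2 s).div_const 4).sub (h1.const_mul γ)).congr_deriv ?_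
  norm_num
  ring

lemma hasDerivAt_conj {h : ℝ → ℂ} {h' : ℂ} {s : ℝ} (hh : HasDerivAt h h' s) :
    HasDerivAt (fun s => (starRingEnd ℂ) (h s)) ((starRingEnd ℂ) h') s :=
  (Complex.conjCLE.toContinuousLinearMap.hasFDerivAt).comp_hasDerivAt s hh

lemma norm_exp_neg_I_mul (x : ℝ) : ‖Complex.exp (-(Complex.I * x))‖ = 1 := by
  rw [Complex.norm_exp]; simp

/-- The factor `e^{-iφ}` turns a complex equation `f' = iφ' f + r` into
`(e^{-iφ} f)' = e^{-iφ} r`. -/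
lemma hasDerivAt_exp_phase_mul (γ : ℝ) {f : ℝ → ℂ} {r : ℂ} {s : ℝ} (hs : s ≠ 0)
    (hf : HasDerivAt f (Complex.I * ((s / 2 - γ * s⁻¹ : ℝ) : ℂ) * f s + r) s) :
    HasDerivAt (fun s => Complex.exp (-(Complex.I * phase γ s)) * f s)
      (Complex.exp (-(Complex.I * phase γ s)) * r) s := by
  have h1 := ((((hasDerivAt_phase γ hs).ofReal_comp).const_mul Complex.I).neg.cexp).mul hf
  refine h1.congr_deriv ?_
  simp only [Pi.neg_apply]
  ring

/-- The corrected amplitude satisfies `f' = i φ' f + O(s⁻²)`. -/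
lemma hasDerivAt_corrected (a α β : ℝ) {y : ℝ → ℝ} {h : ℝ → ℂ} {s : ℝ} (hs : s ≠ 0)
    (hy : HasDerivAt y (h s).re s)
    (hh : HasDerivAt h (Complex.I * s / 2 * h s + scalarPoly a α (y s)) s) :
    HasDerivAt (fun s => h s + (s⁻¹ : ℝ) * phaseCorrection a α β s⁻¹ (y s) (h s))
      (Complex.I * ((s / 2 - (3 * a * β + α) * s⁻¹ : ℝ) : ℂ) *
          (h s + (s⁻¹ : ℝ) * phaseCorrection a α β s⁻¹ (y s) (h s))
        + (s⁻¹ ^ 2 : ℝ) * phaseRemainder a α β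
          s⁻¹ (y s) (h s) (s * (y s - 2 * s⁻¹ * (h s).im - β))) s := by
  obtain ⟨d, hd⟩ : ∃ d, d = Complex.I * s / 2 * h s + scalarPoly a α (y s) := ⟨_, rfl⟩
  have hre : d.re = -(s / 2 * (h s).im) + scalarPoly a α (y s) := by simp [hd]
  have him : d.im = s / 2 * (h s).re := by simp [hd]
  rw [← hd] at hh
  have hinv := hasDerivAt_inv hs
  have him' : HasDerivAt (fun s => (h s).im) d.im s :=
    Complex.imCLM.hasFDerivAt.comp_hasDerivAt s hh
  have hw : HasDerivAt (fun s => y s - 2 * s⁻¹ * (h s).im) (2 * s⁻¹ ^ 2 * (h s).im) s := by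
    refine (hy.sub ((hinv.const_mul 2).mul him')).congr_deriv ?_
    rw [him]
    field_simp
    ring
  have hpol := (((hasDerivAt_scalarPoly a α _).comp s hw).const_mul 2).ofReal_comp
  have hconj := ((hinv.const_mul (3 * a * β + α)).ofReal_comp).mul (hasDerivAt_conj hh)
  have hf : HasDerivAt (fun s => h s + (s⁻¹ : ℝ) * phaseCorrection a α β s⁻¹ (y s) (h s)) _ s :=
    hh.add ((hinv.ofReal_comp).mul (hconj.sub (hpol.const_mul Complex.I)))
  refine hf.congr_deriv ?_
  apply Complex.ext
  · simp only [phaseRemainder, phaseCorrection, Complex.add_re, Complex.sub_re, Complex.mul_re,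
      Complex.ofReal_re, Complex.ofReal_im, Complex.I_re, Complex.I_im, Complex.conj_re,
      Complex.conj_im, Complex.add_im, Complex.sub_im, Complex.mul_im]
    rw [hre, him]
    simp only [scalarPoly]
    field_simp
    ring
  · simp only [phaseRemainder, phaseCorrection, Complex.add_re, Complex.sub_re, Complex.mul_re,
      Complex.ofReal_re, Complex.ofReal_im, Complex.I_re, Complex.I_im, Complex.conj_re,
      Complex.conj_im, Complex.add_im, Complex.sub_im, Complex.mul_im]
    rw [hre, him]
    simp only [scalarPoly]
    field_simp
    ring

/-- The amplitude `e^{-iφ} h` is Cauchy with rate `1 / s`, uniformly over all solutions of the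
scalar system satisfying the given bounds. -/
lemma exists_amplitude_bound (a α β K C₁ : ℝ) :
    ∃ C : ℝ, 0 ≤ C ∧ ∀ (y : ℝ → ℝ) (h : ℝ → ℂ) (s t : ℝ),
    1 ≤ s → s ≤ t →
    (∀ x ∈ Set.Icc s t, HasDerivAt y (h x).re x) →
    (∀ x ∈ Set.Icc s t, HasDerivAt h (Complex.I * x / 2 * h x + scalarPoly a α (y x)) x) →
    (∀ x ∈ Set.Icc s t, |y x| ≤ 1) → (∀ x ∈ Set.Icc s t, ‖h x‖ ≤ K) →
    (∀ x ∈ Set.Icc s t, |y x - 2 * x⁻¹ * (h x).im - β| ≤ C₁ * x⁻¹) →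
    ‖Complex.exp (-(Complex.I * phase (3 * a * β + α) t)) * h t
      - Complex.exp (-(Complex.I * phase (3 * a * β + α) s)) * h s‖ ≤ C * s⁻¹ := by
  obtain ⟨C, hC⟩ := ((isCompact_Icc (a := (0 : ℝ)) (b := 1)).prod
    ((isCompact_Icc (a := (-1 : ℝ)) (b := 1)).prod
      ((isCompact_closedBall (0 : ℂ) K).prod
        (isCompact_Icc (a := -C₁) (b := C₁))))).exists_bound_of_continuousOn
    (f := fun x => phaseRemainder a α β x.1 x.2.1 x.2.2.1 x.2.2.2) (Continuous.continuousOn (by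
      unfold phaseRemainder scalarPoly; fun_prop))
  obtain ⟨D, hD⟩ := ((isCompact_Icc (a := (0 : ℝ)) (b := 1)).prod
    ((isCompact_Icc (a := (-1 : ℝ)) (b := 1)).prod
      (isCompact_closedBall (0 : ℂ) K))).exists_bound_of_continuousOn
    (f := fun x => phaseCorrection a α β x.1 x.2.1 x.2.2) (Continuous.continuousOn (by
      unfold phaseCorrection scalarPoly; fun_prop))
  refine ⟨|C| + |D| + |D|, by positivity, fun y h s t hs hst hy hh hy1 hhK hw => ?_⟩
  have hpos : ∀ x ∈ Set.Icc s t, 0 < x := fun x hx => by linarith [hx.1]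
  have hinv : ∀ x ∈ Set.Icc s t, x⁻¹ ∈ Set.Icc (0 : ℝ) 1 := fun x hx =>
    ⟨(inv_pos.2 (hpos x hx)).le, inv_le_one_of_one_le₀ (hs.trans hx.1)⟩
  have hcor : ∀ x ∈ Set.Icc s t, ‖phaseCorrection a α β x⁻¹ (y x) (h x)‖ ≤ |D| := fun x hx =>
    (hD (x⁻¹, y x, h x) ⟨hinv x hx, abs_le.1 (hy1 x hx), by simpa using hhK x hx⟩).trans
      (le_abs_self D)
  have hrem : ∀ x ∈ Set.Icc s t, ‖phaseRemainder a α β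
      x⁻¹ (y x) (h x) (x * (y x - 2 * x⁻¹ * (h x).im - β))‖ ≤ |C| := fun x hx => by
    refine (hC (x⁻¹, y x, h x, x * (y x - 2 * x⁻¹ * (h x).im - β))
      ⟨hinv x hx, abs_le.1 (hy1 x hx), by simpa using hhK x hx, ?_⟩).trans
      (le_abs_self C)
    have hx0 := hpos x hx
    rw [Set.mem_Icc, ← abs_le, abs_mul, abs_of_pos hx0]
    calc x * |y x - 2 * x⁻¹ * (h x).im - β| ≤ x * (C₁ * x⁻¹) :=
          mul_le_mul_of_nonneg_left (hw x hx) hx0.le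
      _ = C₁ := by field_simp
  have key := norm_sub_le_of_deriv_le (k := 1) (C := |C|) one_ne_zero (abs_nonneg C)
    (hpos s ⟨le_rfl, hst⟩) hst
    (fun x hx => hasDerivAt_exp_phase_mul (3 * a * β + α) (hpos x hx).ne'
      (hasDerivAt_corrected a α β (hpos x hx).ne' (hy x hx) (hh x hx)))
    (fun x hx => by
      rw [norm_mul, norm_exp_neg_I_mul, one_mul, norm_mul, Complex.norm_real,
        Real.norm_of_nonneg (by positivity), mul_comm]
      gcongr
      exact hrem x hx)
  have hsm : s ∈ Set.Icc s t := ⟨le_rfl, hst⟩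
  have htm : t ∈ Set.Icc s t := ⟨hst, le_rfl⟩
  have hc : ∀ x ∈ Set.Icc s t, ‖Complex.exp (-(Complex.I * phase (3 * a * β + α) x)) *
      ((x⁻¹ : ℝ) * phaseCorrection a α β x⁻¹ (y x) (h x))‖ ≤ |D| * s⁻¹ := fun x hx => by
    rw [norm_mul, norm_exp_neg_I_mul, one_mul, norm_mul, Complex.norm_real,
      Real.norm_of_nonneg (hinv x hx).1, mul_comm]
    have h0 := (hinv x hx).1
    have h1 : x⁻¹ ≤ s⁻¹ := inv_anti₀ (hpos s ⟨le_rfl, hst⟩) hx.1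
    exact mul_le_mul (hcor x hx) h1 h0 (abs_nonneg D)
  set es := Complex.exp (-(Complex.I * phase (3 * a * β + α) s))
  set et := Complex.exp (-(Complex.I * phase (3 * a * β + α) t))
  set cs := phaseCorrection a α β s⁻¹ (y s) (h s)
  set ct := phaseCorrection a α β t⁻¹ (y t) (h t)
  have e : et * h t - es * h s = (et * (h t + (t⁻¹ : ℝ) * ct) - es * (h s + (s⁻¹ : ℝ) * cs))
      - et * ((t⁻¹ : ℝ) * ct) + es * ((s⁻¹ : ℝ) * cs) := by ring
  rw [e]
  refine (norm_add_le _ _).trans ((add_le_add (norm_sub_le _ _) le_rfl).trans ?_)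
  have h1 := hc t htm
  have h2 := hc s hsm
  rw [pow_one] at key
  linarith

/-! ### Asymptotics of the curve and the tangent -/

lemma continuous_act (M : Matrix (Fin 3) (Fin 3) ℝ) : Continuous (act M) := by
  let f : E3 →ₗ[ℝ] E3 :=
    { toFun := act M
      map_add' := by intro u v; simp [act, Matrix.mulVec_add]
      map_smul' := by intro r v; simp [act, Matrix.mulVec_smul] }
  exact f.continuous_of_finiteDimensional

lemma isBigO_one_comp {X Y : Type*} [NormedAddCommGroup X] [ProperSpace X]
    [NormedAddCommGroup Y] {l : Filter ℝ} {u : ℝ → X} {Φ : X → Y} (hΦ : Continuous Φ)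
    (hu : u =O[l] fun _ => (1 : ℝ)) : (fun s => Φ (u s)) =O[l] fun _ => (1 : ℝ) := by
  obtain ⟨C, hC⟩ := hu.bound
  obtain ⟨D, hD⟩ := (isCompact_closedBall (0 : X) C).exists_bound_of_continuousOn
    hΦ.continuousOn
  refine IsBigO.of_bound D ?_
  filter_upwards [hC] with s hs
  simpa using hD (u s) (by simpa using hs)

lemma hasDerivAt_inv_pow_smul {f : ℝ → E3} {f' : E3} {s : ℝ} (hs : s ≠ 0)
    (hf : HasDerivAt f f' s) (k : ℕ) :
    HasDerivAt (fun s => s⁻¹ ^ (k + 1) • f s)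
      (s⁻¹ ^ (k + 1) • f' - ((k + 1 : ℝ) * s⁻¹ ^ (k + 2)) • f s) s := by
  have h : HasDerivAt (fun s : ℝ => s⁻¹ ^ (k + 1)) _ s := (hasDerivAt_inv hs).pow (k + 1)
  refine (h.smul hf).congr_deriv ?_
  rw [sub_eq_add_neg, ← neg_smul]
  congr 2
  rw [Nat.add_sub_cancel, ← inv_pow s 2]
  push_cast
  ring

/-- The derivative of the quadratic map `forcing a α` at `B`. -/
def forcingDeriv (a α : ℝ) (B : E3) : E3 →L[ℝ] E3 :=
  -(3 * a * B 2 + 2 * α) • ContinuousLinearMap.id ℝ E3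
    - (3 * a) • (EuclideanSpace.proj (𝕜 := ℝ) (2 : Fin 3)).smulRight B

lemma forcingDeriv_apply (a α : ℝ) (B v : E3) :
    forcingDeriv a α B v = -(3 * a * B 2 + 2 * α) • v - (3 * a * v 2) • B := by
  simp [forcingDeriv, smul_smul]

lemma forcing_add (a α : ℝ) (B v : E3) :
    forcing a α (B + v) = forcing a α B + forcingDeriv a α B v - (3 * a * v 2) • v := by
  rw [forcingDeriv_apply]
  simp only [forcing, PiLp.add_apply]
  module

lemma continuous_forcing (a α : ℝ) : Continuous (forcing a α) := by
  unfold forcing; fun_prop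

namespace IsFrame

variable {a α : ℝ} {G T P N : ℝ → E3}

lemma hasDerivAt_pow_smul_unrot_T (H : IsFrame a α G T P N) {s : ℝ} (hs : s ≠ 0) (k : ℕ) :
    HasDerivAt (fun s => s⁻¹ ^ (k + 1) • unrot a T s)
      (s⁻¹ ^ (k + 1) • unrot a P s - (a * s⁻¹ ^ (k + 2)) • J (unrot a T s)
        - ((k + 1 : ℝ) * s⁻¹ ^ (k + 2)) • unrot a T s) s := by
  refine (hasDerivAt_inv_pow_smul hs (H.hasDerivAt_unrot_T hs) k).congr_deriv ?_
  rw [div_eq_mul_inv]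
  module

lemma hasDerivAt_pow_smul_unrot_P (H : IsFrame a α G T P N) {s : ℝ} (hs : s ≠ 0) (k : ℕ) :
    HasDerivAt (fun s => s⁻¹ ^ (k + 1) • unrot a P s)
      ((1 / 2 * s⁻¹ ^ k) • unrot a N s - (1 / 2 * s⁻¹ ^ (k + 1)) • forcing a α (unrot a T s)
        - (a * s⁻¹ ^ (k + 2)) • J (unrot a P s)
        - ((k + 1 : ℝ) * s⁻¹ ^ (k + 2)) • unrot a P s) s := by
  refine (hasDerivAt_inv_pow_smul hs (H.hasDerivAt_unrot_P hs) k).congr_deriv ?_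
  have e : 1 / 2 * s⁻¹ ^ k = s⁻¹ ^ (k + 1) * (s / 2) := by
    rw [pow_succ]; field_simp
  rw [div_eq_mul_inv a, e]
  module

lemma isBigO_unrot_T (H : IsFrame a α G T P N) (l : Filter ℝ) :
    unrot a T =O[l] fun _ => (1 : ℝ) :=
  IsBigO.of_bound 1 (Eventually.of_forall fun s => by simp [H.norm_T])

lemma isBigO_unrot_P (H : IsFrame a α G T P N) (l : Filter ℝ) :
    unrot a P =O[l] fun _ => (1 : ℝ) :=
  IsBigO.of_bound (frameBound a α) (Eventually.of_forall fun s => by simp [H.norm_P_le])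

lemma isBigO_unrot_N (H : IsFrame a α G T P N) (l : Filter ℝ) :
    unrot a N =O[l] fun _ => (1 : ℝ) :=
  IsBigO.of_bound (frameBound a α) (Eventually.of_forall fun s => by simp [H.norm_N_le])

end IsFrame

lemma isBigO_inv_one : (fun s : ℝ => s⁻¹) =O[atTop] fun _ => (1 : ℝ) :=
  (tendsto_inv_atTop_zero (𝕜 := ℝ)).isBigO_one ℝ

lemma isBigO_inv_pow_smul {E : Type*} [NormedAddCommGroup E] [NormedSpace ℝ E] {f : ℝ → E}
    (hf : f =O[atTop] fun _ => (1 : ℝ)) (k : ℕ) :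
    (fun s : ℝ => s⁻¹ ^ k • f s) =O[atTop] fun s : ℝ => s⁻¹ ^ k := by
  simpa using (isBigO_refl (fun s : ℝ => s⁻¹ ^ k) atTop).smul hf

lemma isBigO_inv_pow_of_le {m n : ℕ} (h : m ≤ n) :
    (fun s : ℝ => s⁻¹ ^ n) =O[atTop] fun s : ℝ => s⁻¹ ^ m := by
  obtain ⟨k, rfl⟩ := Nat.exists_eq_add_of_le h
  have h1 : (fun s : ℝ => s⁻¹ ^ k) =O[atTop] fun _ => (1 : ℝ) := by
    simpa using isBigO_inv_one.pow k
  simpa [pow_add, mul_comm] using isBigO_inv_pow_smul h1 m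

lemma tendsto_inv_pow_smul {E : Type*} [NormedAddCommGroup E] [NormedSpace ℝ E] {f : ℝ → E}
    (hf : f =O[atTop] fun _ => (1 : ℝ)) (k : ℕ) :
    Tendsto (fun s : ℝ => s⁻¹ ^ (k + 1) • f s) atTop (𝓝 0) := by
  refine (isBigO_inv_pow_smul hf (k + 1)).trans_tendsto ?_
  simpa using (tendsto_inv_atTop_zero (𝕜 := ℝ)).pow (k + 1)

namespace IsFrame

variable {a α : ℝ} {G T P N : ℝ → E3} {B : E3}

lemma tendsto_unrot_G (H : IsFrame a α G T P N) (hB : Tendsto (unrot a T) atTop (𝓝 B)) :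
    Tendsto (fun s => s⁻¹ • unrot a G s) atTop (𝓝 (asymVec a B)) := by
  have h1 : Tendsto (fun s => unrot a T s + (2 : ℝ) • s⁻¹ ^ (0 + 1) • unrot a N s) atTop
      (𝓝 (B + (2 : ℝ) • (0 : E3))) :=
    hB.add ((tendsto_inv_pow_smul (H.isBigO_unrot_N _) 0).const_smul _)
  rw [smul_zero, add_zero] at h1
  refine ((continuous_act _).tendsto B |>.comp h1).congr' ?_
  filter_upwards [eventually_ne_atTop 0] with s hs
  refine (eq_asymVec a ?_).symm
  beta_reduce
  rw [H.curve_eq_unrot hs]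
  simp only [zero_add, pow_one]
  module

/-- Improvement of the rate from `O(s⁻¹)` to `O(s⁻²)`, by one integration by parts of the
oscillating term. -/
lemma isBigO_unrot_G_sub (H : IsFrame a α G T P N) (hB : Tendsto (unrot a T) atTop (𝓝 B)) :
    (fun s => s⁻¹ • unrot a G s - asymVec a B) =O[atTop] fun s : ℝ => s⁻¹ ^ 2 := by
  let Φ : ℝ × E3 × E3 → E3 := fun x => (-2 : ℝ) • forcing a α x.2.1
        - x.1 • ((4 * a) • J x.2.2 + (12 : ℝ) • x.2.2)
  have hΦ : Continuous Φ := by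
    have := continuous_forcing a α
    fun_prop
  have hd : ∀ s : ℝ, 0 < s → HasDerivAt
      (fun s => s⁻¹ • unrot a G s + (4 : ℝ) • s⁻¹ ^ (2 + 1) • unrot a P s)
      (s⁻¹ ^ 3 • Φ (s⁻¹, unrot a T s, unrot a P s)) s := fun s hs => by
    simp only [Φ]
    refine ((H.hasDerivAt_unrot_G hs.ne').add
      ((H.hasDerivAt_pow_smul_unrot_P hs.ne' 2).const_smul (4 : ℝ))).congr_deriv ?_
    push_cast
    module
  have hbd : (fun s : ℝ => Φ (s⁻¹, unrot a T s, unrot a P s)) =O[atTop] fun _ => (1 : ℝ) :=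
    isBigO_one_comp hΦ
      (isBigO_inv_one.prod_left ((H.isBigO_unrot_T _).prod_left (H.isBigO_unrot_P _)))
  have hl : Tendsto (fun s => s⁻¹ • unrot a G s + (4 : ℝ) • s⁻¹ ^ (2 + 1) • unrot a P s) atTop
      (𝓝 (asymVec a B)) := by
    simpa using (H.tendsto_unrot_G hB).add
      ((tendsto_inv_pow_smul (H.isBigO_unrot_P _) 2).const_smul (4 : ℝ))
  have key := isBigO_sub_lim_of_deriv (k := 2) two_ne_zero hd
    (isBigO_inv_pow_smul hbd 3) hl
  have h3 : (fun s : ℝ => (4 : ℝ) • s⁻¹ ^ (2 + 1) • unrot a P s) =O[atTop]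
      fun s : ℝ => s⁻¹ ^ 2 :=
    ((isBigO_inv_pow_smul (H.isBigO_unrot_P _) 3).const_smul_left (4 : ℝ)).trans
      (isBigO_inv_pow_of_le (by norm_num))
  refine (key.sub h3).congr_left fun s => ?_
  module

lemma unrot_T_eq (H : IsFrame a α G T P N) {s : ℝ} (hs : s ≠ 0) :
    unrot a T s - B = (s⁻¹ • unrot a G s - asymVec a B)
      + a • J (s⁻¹ • unrot a G s - asymVec a B) - (2 * s⁻¹) • unrot a N s := by
  rw [H.curve_eq_unrot hs]
  simp only [map_sub, map_smul]
  linear_combination (norm := module) (1 : ℝ) • asymVec_add a B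

lemma isBigO_tangent (H : IsFrame a α G T P N) (hB : Tendsto (unrot a T) atTop (𝓝 B)) :
    (fun s => unrot a T s - B + (2 * s⁻¹) • unrot a N s) =O[atTop] fun s : ℝ => s⁻¹ ^ 2 := by
  have h1 := H.isBigO_unrot_G_sub hB
  have h2 := h1.add (((J.isBigO_comp _ _).trans h1).const_smul_left a)
  refine h2.congr' ?_ EventuallyEq.rfl
  filter_upwards [eventually_ne_atTop 0] with s hs
  rw [H.unrot_T_eq hs]
  simp

lemma isBigO_unrot_T_sub (H : IsFrame a α G T P N) (hB : Tendsto (unrot a T) atTop (𝓝 B)) :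
    (fun s => unrot a T s - B) =O[atTop] fun s : ℝ => s⁻¹ := by
  have h1 := (H.isBigO_tangent hB).trans (isBigO_inv_pow_of_le (m := 1) one_le_two)
  have h2 := (isBigO_inv_pow_smul (H.isBigO_unrot_N atTop) 1).const_smul_left (2 : ℝ)
  simp only [pow_one] at h1 h2
  refine (h1.sub h2).congr_left fun s => ?_
  simp only [Pi.smul_apply]
  module

/-- The expansion of the curve in the rotating frame. After correction by multiples of the bounded
fields `T`, `T'`, the derivative is `O(s⁻⁵)`: each oscillating term is absorbed with the equations
of `T` and `T'`, and only the mean of the forcing remains. -/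
lemma isBigO_curve (H : IsFrame a α G T P N) (hB : Tendsto (unrot a T) atTop (𝓝 B)) :
    (fun s => s⁻¹ • unrot a G s - asymVec a B - s⁻¹ ^ 2 • forcing a α B
      + (4 * s⁻¹ ^ 3) • unrot a P s) =O[atTop] fun s : ℝ => s⁻¹ ^ 4 := by
  let D := forcingDeriv a α B
  let M : E3 →L[ℝ] E3 := (12 : ℝ) • ContinuousLinearMap.id ℝ E3 + (4 * a) • J
  -- the rescaled difference of `T + (2 / s) N` from its limit `B`, bounded because `G / s` is
  -- known up to `O(s⁻²)`
  let ε : ℝ → E3 := fun s => s ^ 2 • ((s⁻¹ • unrot a G s - asymVec a B)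
      + a • J (s⁻¹ • unrot a G s - asymVec a B))
  have hε : ε =O[atTop] fun _ => (1 : ℝ) := by
    have h1 := H.isBigO_unrot_G_sub hB
    have h2 := h1.add (((J.isBigO_comp _ _).trans h1).const_smul_left a)
    have h3 := (isBigO_refl (fun s : ℝ => s ^ 2) atTop).smul h2
    refine h3.congr' EventuallyEq.rfl ?_
    filter_upwards [eventually_ne_atTop 0] with s hs
    simp [hs]
  have hτ : ∀ s : ℝ, 0 < s → unrot a T s = B + (s⁻¹ ^ 2 • ε s - (2 * s⁻¹) • unrot a N s) :=
    fun s hs => by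
    rw [← sub_eq_iff_eq_add', H.unrot_T_eq hs.ne', smul_smul, ← mul_pow, inv_mul_cancel₀ hs.ne',
      one_pow, one_smul]
  let Φ : ℝ × E3 × E3 × E3 × E3 → E3 := fun x =>
    let p := x.1; let e := x.2.1; let ν := x.2.2.1; let τ := x.2.2.2.1; let μ := x.2.2.2.2;
    (-2 : ℝ) • D e + (6 * a * (p • e - (2 : ℝ) • ν) 2) • (p • e - (2 : ℝ) • ν)
      - (4 : ℝ) • M τ - a • M (J τ) + (40 * p) • D μ + (4 : ℝ) • D (forcing a α τ)
      + (8 * a * p) • D (J μ)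
  have hΦ : Continuous Φ := by
    have := continuous_forcing a α
    fun_prop
  have hd : ∀ s : ℝ, 0 < s → HasDerivAt
      (fun s => s⁻¹ • unrot a G s + (4 : ℝ) • s⁻¹ ^ (2 + 1) • unrot a P s
        + M (s⁻¹ ^ (3 + 1) • unrot a T s) - (8 : ℝ) • D (s⁻¹ ^ (4 + 1) • unrot a P s)
        - s⁻¹ ^ (1 + 1) • forcing a α B)
      (s⁻¹ ^ 5 • Φ (s⁻¹, ε s, unrot a N s, unrot a T s, unrot a P s)) s := fun s hs => by
    have h1 := ((((H.hasDerivAt_unrot_G hs.ne').add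
      ((H.hasDerivAt_pow_smul_unrot_P hs.ne' 2).const_smul (4 : ℝ))).add
      (M.hasFDerivAt.comp_hasDerivAt s (H.hasDerivAt_pow_smul_unrot_T hs.ne' 3))).sub
      ((D.hasFDerivAt.comp_hasDerivAt s (H.hasDerivAt_pow_smul_unrot_P hs.ne' 4)).const_smul
        (8 : ℝ))).sub (hasDerivAt_inv_pow_smul hs.ne' (hasDerivAt_const s (forcing a α B)) 1)
    refine h1.congr_deriv ?_
    have hq : forcing a α (unrot a T s) = _ :=
      (congrArg (forcing a α) (hτ s hs)).trans (forcing_add a α B _)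
    rw [show forcingDeriv a α B = D from rfl] at hq
    simp only [Φ]
    generalize forcing a α (unrot a T s) = q at *
    generalize unrot a T s = τ at *
    generalize unrot a P s = μ at *
    generalize unrot a N s = ν at *
    have hM : ∀ v, M v = (12 : ℝ) • v + (4 * a) • J v := fun v => rfl
    simp only [map_sub, map_smul, hM, PiLp.sub_apply, PiLp.smul_apply, smul_eq_mul,
      smul_zero] at hq ⊢
    push_cast
    linear_combination (norm := module) (-2 * s⁻¹ ^ 3) • hq
  have hbd : (fun s : ℝ => Φ (s⁻¹, ε s, unrot a N s, unrot a T s, unrot a P s)) =O[atTop]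
      fun _ => (1 : ℝ) :=
    isBigO_one_comp hΦ (isBigO_inv_one.prod_left (hε.prod_left ((H.isBigO_unrot_N _).prod_left
      ((H.isBigO_unrot_T _).prod_left (H.isBigO_unrot_P _)))))
  have hl : Tendsto (fun s => s⁻¹ • unrot a G s + (4 : ℝ) • s⁻¹ ^ (2 + 1) • unrot a P s
        + M (s⁻¹ ^ (3 + 1) • unrot a T s) - (8 : ℝ) • D (s⁻¹ ^ (4 + 1) • unrot a P s)
        - s⁻¹ ^ (1 + 1) • forcing a α B) atTop (𝓝 (asymVec a B)) := by
    have t1 := (tendsto_inv_pow_smul (H.isBigO_unrot_P atTop) 2).const_smul (4 : ℝ)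
    have t2 := (M.continuous.tendsto 0).comp (tendsto_inv_pow_smul (H.isBigO_unrot_T atTop) 3)
    have t3 := ((D.continuous.tendsto 0).comp
      (tendsto_inv_pow_smul (H.isBigO_unrot_P atTop) 4)).const_smul (8 : ℝ)
    have t4 := tendsto_inv_pow_smul (isBigO_const_const (forcing a α B) one_ne_zero atTop) 1
    have t := ((((H.tendsto_unrot_G hB).add t1).add t2).sub t3).sub t4
    simpa using t
  have key := isBigO_sub_lim_of_deriv (k := 4) four_ne_zero hd (isBigO_inv_pow_smul hbd 5) hl
  have k1 : (fun s : ℝ => M (s⁻¹ ^ (3 + 1) • unrot a T s)) =O[atTop] fun s : ℝ => s⁻¹ ^ 4 :=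
    (M.isBigO_comp _ _).trans (isBigO_inv_pow_smul (H.isBigO_unrot_T _) 4)
  have k2 : (fun s : ℝ => (8 : ℝ) • D (s⁻¹ ^ (4 + 1) • unrot a P s)) =O[atTop]
      fun s : ℝ => s⁻¹ ^ 4 :=
    ((D.isBigO_comp _ _).trans ((isBigO_inv_pow_smul (H.isBigO_unrot_P _) 5).trans
      (isBigO_inv_pow_of_le (by norm_num)))).const_smul_left (8 : ℝ)
  refine ((key.sub k1).add k2).congr_left fun s => ?_
  module

/-- The rate of convergence of the amplitude. -/
lemma isBigO_amplitude (H : IsFrame a α G T P N) (hB : Tendsto (unrot a T) atTop (𝓝 B)) {z : ℂ}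
    (hz : Tendsto (fun s => Complex.exp (-(Complex.I * phase (3 * a * B 2 + α) s))
      * vertPart P N s) atTop (𝓝 z)) :
    (fun s => Complex.exp (-(Complex.I * phase (3 * a * B 2 + α) s)) * vertPart P N s - z)
      =O[atTop] fun s : ℝ => s⁻¹ := by
  obtain ⟨C, hC, h⟩ := exists_amplitude_bound a α (B 2) (2 * frameBound a α)
    (2 * frameBound a α)
  have hA : asymVec a B 2 = B 2 := by
    have := congrArg (fun v : E3 => v 2) (asymVec_add a B)
    simpa using this
  have hw : ∀ x : ℝ, 0 < x → |T x 2 - 2 * x⁻¹ * (vertPart P N x).im - B 2|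
      ≤ 2 * frameBound a α * x⁻¹ := fun x hx => by
    have hlim : Tendsto (fun t => ‖t⁻¹ • unrot a G t - x⁻¹ • unrot a G x‖) atTop
        (𝓝 ‖asymVec a B - x⁻¹ • unrot a G x‖) := ((H.tendsto_unrot_G hB).sub_const _).norm
    have hle : ‖asymVec a B - x⁻¹ • unrot a G x‖ ≤ 2 * frameBound a α * x⁻¹ := by
      refine le_of_tendsto hlim ?_
      filter_upwards [eventually_ge_atTop x] with t ht
      exact H.norm_unrot_G_sub_le hx ht
    rw [H.height_sub hx.ne', ← hA, abs_sub_comm]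
    exact (PiLp.norm_apply_le (asymVec a B - x⁻¹ • unrot a G x) 2).trans hle
  refine IsBigO.of_bound C ?_
  filter_upwards [eventually_ge_atTop 1] with s hs
  rw [Real.norm_of_nonneg (by positivity), norm_sub_rev]
  refine le_of_tendsto (hz.sub_const _).norm ?_
  filter_upwards [eventually_ge_atTop s] with t ht
  exact h (fun s => T s 2) (vertPart P N) s t hs ht (fun x _ => H.hasDerivAt_height x)
    (fun x _ => H.hasDerivAt_vertPart x) (fun x _ => H.abs_height_le x)
    (fun x _ => H.norm_vertPart_le x) (fun x hx => hw x (by linarith [hx.1]))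

end IsFrame

/-! ### Recovery of the frame from its vertical component -/

lemma subI_apply (u v : E3) (i : Fin 3) : subI u v i = (u i : ℂ) - Complex.I * (v i : ℂ) := rfl

lemma smul_subI (z : ℂ) (u v : E3) :
    z • subI u v = subI (z.re • u + z.im • v) (z.re • v - z.im • u) := by
  ext i
  apply Complex.ext
  · simp [subI_apply]
  · simp [subI_apply]
    ring

lemma subI_sub (u v u' v' : E3) : subI u v - subI u' v' = subI (u - u') (v - v') := by
  ext i
  simp [subI_apply]
  ring

lemma norm_subI_sq (u v : E3) : ‖subI u v‖ ^ 2 = ‖u‖ ^ 2 + ‖v‖ ^ 2 := by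
  rw [EuclideanSpace.norm_sq_eq, Fin.sum_univ_three, norm_sq_coord, norm_sq_coord]
  simp [subI_apply, ← Complex.normSq_eq_norm_sq, Complex.normSq_apply]
  ring

lemma norm_subI_rot (t : ℝ) (u v : E3) : ‖subI (rot t u) (rot t v)‖ = ‖subI u v‖ := by
  rw [← sq_eq_sq₀ (norm_nonneg _) (norm_nonneg _), norm_subI_sq, norm_subI_sq, norm_rot, norm_rot]

lemma norm_subI_rot_sub (t : ℝ) (z : ℂ) (u v u' v' : E3) :
    ‖subI (rot t u) (rot t v) - z • subI (rot t u') (rot t v')‖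
      = ‖subI u v - z • subI u' v'‖ := by
  conv_rhs => rw [smul_subI, subI_sub, ← norm_subI_rot t]
  rw [smul_subI, subI_sub]
  simp

lemma norm_le_norm_subI (u v : E3) : ‖u‖ ≤ ‖subI u v‖ := by
  rw [← sq_le_sq₀ (norm_nonneg _) (norm_nonneg _), norm_subI_sq]
  linarith [sq_nonneg ‖v‖]

/-- `subI` as a real-linear map. -/
def subIL : E3 × E3 →L[ℝ] EuclideanSpace ℂ (Fin 3) :=
  LinearMap.toContinuousLinearMap
    { toFun := fun x => subI x.1 x.2
      map_add' := by intro x y; ext i; simp [subI_apply]; ring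
      map_smul' := by intro r x; ext i; simp [subI_apply]; ring }

/-- For a unit vector `t` and `p ⟂ t`, the complex vector `p - i t × p` is determined by its
vertical component, because it is a multiple of `(e₃ - t₃ t) + i e₃ × t`. -/
lemma smul_subI_cross {t p : E3} (ht : ‖t‖ = 1) (hp : inner ℝ t p = 0) :
    ((1 - t 2 ^ 2 : ℝ) : ℂ) • subI p (cross t p)
      = (⟨p 2, -(cross t p 2)⟩ : ℂ) • subI (vert - t 2 • t) (-J t) := by
  have hs := sq_coord_of_norm_eq_one ht
  rw [inner_coord] at hp
  rw [smul_subI, smul_subI]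
  simp only [Complex.ofReal_re, Complex.ofReal_im, zero_smul, add_zero, sub_zero]
  congr 1
  · apply E3.ext_coord <;> simp
    · linear_combination -p 0 * hs + t 0 * hp
    · linear_combination -p 1 * hs + t 1 * hp
    · ring
  · apply E3.ext_coord <;> simp
    · linear_combination t 2 * p 1 * hs - t 2 * t 1 * hp
    · linear_combination -t 2 * p 0 * hs + t 2 * t 0 * hp
    · ring

lemma inner_rot (t : ℝ) (u v : E3) : inner ℝ (rot t u) (rot t v) = inner ℝ u v := by
  rw [inner_coord, inner_coord]
  simp
  linear_combination (u 0 * v 0 + u 1 * v 1) * Real.sin_sq_add_cos_sq t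

/-- The map expressing `e^{-iφ} e^{-𝒜 log s} (T' - i T × T')` through the amplitude and the
tangent. -/
def frameMap (x : ℂ × E3) : EuclideanSpace ℂ (Fin 3) :=
  (x.1 * (((1 - x.2 2 ^ 2)⁻¹ : ℝ) : ℂ)) • subI (vert - x.2 2 • x.2) (-J x.2)

lemma differentiableAt_frameMap {z : ℂ} {B : E3} (hB : 1 - B 2 ^ 2 ≠ 0) :
    DifferentiableAt ℝ frameMap (z, B) := by
  have h2 : DifferentiableAt ℝ (fun x : ℂ × E3 => x.2 2) (z, B) :=
    ((EuclideanSpace.proj (𝕜 := ℝ) (2 : Fin 3)).comp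
      (ContinuousLinearMap.snd ℝ ℂ E3)).differentiableAt
  have h3 : DifferentiableAt ℝ (fun x : ℂ × E3 => (1 - x.2 2 ^ 2)⁻¹) (z, B) :=
    ((h2.pow 2).const_sub 1).inv hB
  have h4 : DifferentiableAt ℝ (fun x : ℂ × E3 => (((1 - x.2 2 ^ 2)⁻¹ : ℝ) : ℂ)) (z, B) :=
    Complex.ofRealCLM.differentiableAt.comp _ h3
  have h5 : DifferentiableAt ℝ (fun x : ℂ × E3 => (vert - x.2 2 • x.2, -J x.2)) (z, B) :=
    ((h2.smul differentiableAt_snd).const_sub vert).prodMk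
      ((J.differentiableAt.comp _ differentiableAt_snd).neg)
  exact (differentiableAt_fst.mul h4).smul (subIL.differentiableAt.comp _ h5)

namespace IsFrame

variable {a α : ℝ} {G T P N : ℝ → E3} {B : E3}

lemma unrot_frame_eq (H : IsFrame a α G T P N) {s : ℝ} (hs : 1 - T s 2 ^ 2 ≠ 0) (z : ℂ) :
    z • subI (unrot a P s) (unrot a N s) = frameMap (z * vertPart P N s, unrot a T s) := by
  have hN : unrot a N s = cross (unrot a T s) (unrot a P s) := by
    rw [unrot, H.N_eq, ← cross_rot]; rfl
  have h := smul_subI_cross (t := unrot a T s) (p := unrot a P s)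
    (by rw [norm_unrot, H.norm_T]) ((inner_rot _ _ _).trans (H.inner_T_P s))
  rw [← hN] at h
  simp only [unrot_apply_two] at h
  have hc : ((1 - T s 2 ^ 2 : ℝ) : ℂ) ≠ 0 := Complex.ofReal_ne_zero.2 hs
  have h2 : subI (unrot a P s) (unrot a N s) = (((1 - T s 2 ^ 2 : ℝ) : ℂ)⁻¹ * vertPart P N s) •
      subI (vert - T s 2 • unrot a T s) (-J (unrot a T s)) := by
    rw [mul_smul]
    exact (eq_inv_smul_iff₀ hc).2 h
  rw [h2, frameMap, smul_smul]
  simp only [unrot_apply_two, Complex.ofReal_inv]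
  congr 1
  ring

lemma isBigO_frame (H : IsFrame a α G T P N) (hB : Tendsto (unrot a T) atTop (𝓝 B)) {z : ℂ}
    (hβ : 1 - B 2 ^ 2 ≠ 0)
    (hz : Tendsto (fun s => Complex.exp (-(Complex.I * phase (3 * a * B 2 + α) s))
      * vertPart P N s) atTop (𝓝 z)) :
    (fun s => Complex.exp (-(Complex.I * phase (3 * a * B 2 + α) s)) •
      subI (unrot a P s) (unrot a N s) - frameMap (z, B)) =O[atTop] fun s : ℝ => s⁻¹ := by
  have h1 := (differentiableAt_frameMap (z := z) hβ).isBigO_sub.comp_tendsto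
    (hz.prodMk_nhds hB)
  have h2 := h1.trans ((H.isBigO_amplitude hB hz).prod_left (H.isBigO_unrot_T_sub hB))
  refine h2.congr' ?_ EventuallyEq.rfl
  have hy : Tendsto (fun s => T s 2) atTop (𝓝 (B 2)) := by
    have := ((EuclideanSpace.proj (𝕜 := ℝ) (2 : Fin 3)).continuous.tendsto B).comp hB
    simpa [Function.comp_def] using this
  filter_upwards [((hy.pow 2).const_sub 1).eventually_ne hβ] with s hs
  rw [H.unrot_frame_eq hs]
  rfl

end IsFrame

lemma norm_act_skew_sq (a : ℝ) {B : E3} (hB : ‖B‖ = 1) :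
    ‖act (skew a) B‖ ^ 2 = a ^ 2 * (1 - B 2 ^ 2) := by
  rw [act_skew, norm_sq_coord]
  simp
  linear_combination a ^ 2 * sq_coord_of_norm_eq_one hB

lemma one_sub_sq_pos_of_ne {B : E3} (hB : ‖B‖ = 1) (hβ : 1 - B 2 ^ 2 ≠ 0) : 0 < 1 - B 2 ^ 2 := by
  have := sq_coord_of_norm_eq_one hB
  exact lt_of_le_of_ne (by nlinarith [sq_nonneg (B 0), sq_nonneg (B 1)]) hβ.symm

lemma one_sub_sq_pos {B : E3} (hB : ‖B‖ = 1) (hB1 : B 2 ≠ 1) (hB2 : B 2 ≠ -1) :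
    0 < 1 - B 2 ^ 2 := by
  refine one_sub_sq_pos_of_ne hB fun h => ?_
  have : (B 2 - 1) * (B 2 + 1) = 0 := by linarith
  rcases mul_eq_zero.1 this with h | h
  · exact hB1 (by linarith)
  · exact hB2 (by linarith)

/-- The limit of the vertical amplitude prescribed by the data. -/
def amplitudeLimit (a θ b : ℝ) : ℂ := -((b / a : ℝ) : ℂ) * Complex.exp (Complex.I * θ)

lemma frameMap_amplitudeLimit {a : ℝ} (ha : a ≠ 0) {B : E3} (hB : ‖B‖ = 1)
    (hβ : 1 - B 2 ^ 2 ≠ 0) (θ b : ℝ) :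
    frameMap (amplitudeLimit a θ b, B)
      = amplitude a B θ b • subI (cross (act (skew a) B) B) (act (skew a) B) := by
  have e1 : cross (act (skew a) B) B = (-a) • (vert - B 2 • B) := by
    have hs := sq_coord_of_norm_eq_one hB
    rw [act_skew]
    apply E3.ext_coord <;> simp
    · ring
    · ring
    · linear_combination (-a) * hs
  have e2 : act (skew a) B = (-a) • (-J B) := by rw [act_skew]; simp
  have e3 : ∀ u v : E3, subI ((-a) • u) ((-a) • v) = (((-a : ℝ)) : ℂ) • subI u v := fun u v => by
    rw [smul_subI]; simp
  rw [amplitude, norm_act_skew_sq a hB, e1, e2, e3, smul_smul, frameMap, amplitudeLimit]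
  congr 1
  have ha' : (a : ℂ) ≠ 0 := by exact_mod_cast ha
  have hβ' := Complex.ofReal_ne_zero.2 hβ
  push_cast at hβ'
  push_cast
  field_simp

lemma curvature_smul_normal (G : ℝ → E3) (s : ℝ) :
    curvature G s • normal G s = deriv (tangent G) s := by
  rw [normal]
  by_cases h : curvature G s = 0
  · rw [h, zero_smul]
    exact (norm_eq_zero.1 h).symm
  · rw [smul_inv_smul₀ h]

lemma norm_normal_le (G : ℝ → E3) (s : ℝ) : ‖normal G s‖ ≤ 1 := by
  rw [normal, norm_smul, norm_inv, curvature, norm_norm]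
  exact inv_mul_le_one

lemma curvature_smul_binormal (G : ℝ → E3) (s : ℝ) :
    curvature G s • binormal G s = cross (tangent G s) (deriv (tangent G) s) := by
  rw [← curvature_smul_normal, binormal, ← crossL_apply, ← crossL_apply, map_smul]

lemma norm_cross_le (u v : E3) : ‖cross u v‖ ≤ ‖u‖ * ‖v‖ := by
  rw [← sq_le_sq₀ (norm_nonneg _) (by positivity), mul_pow, norm_sq_coord, norm_sq_coord,
    norm_sq_coord]
  simp
  nlinarith [sq_nonneg (u 0 * v 0 + u 1 * v 1 + u 2 * v 2)]

lemma norm_binormal_le {a : ℝ} {G : ℝ → E3} (hG : IsSolution a G) (s : ℝ) :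
    ‖binormal G s‖ ≤ 1 := by
  refine (norm_cross_le _ _).trans ?_
  rw [show ‖tangent G s‖ = 1 from (hG.2 s).2, one_mul]
  exact norm_normal_le G s

lemma IsSolution.isFrame {a : ℝ} {G : ℝ → E3} (h : IsSolution a G) :
    IsFrame a (alpha a G) G (tangent G) (deriv (tangent G))
      (fun s => cross (tangent G s) (deriv (tangent G) s)) := h.isCurve.isFrame

/-! ### Reduced asymptotic data -/

/-- The vertical component of the limit of the frame. -/
lemma amplitude_mul_vert {a : ℝ} (ha : a ≠ 0) {B : E3} (hB : ‖B‖ = 1)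
    (hβ : 1 - B 2 ^ 2 ≠ 0) (θ b : ℝ) :
    amplitude a B θ b * subI (cross (act (skew a) B) B) (act (skew a) B) 2
      = amplitudeLimit a θ b := by
  have h := congrArg (fun v : EuclideanSpace ℂ (Fin 3) => v 2)
    (frameMap_amplitudeLimit ha hB hβ θ b)
  simp only [PiLp.smul_apply, smul_eq_mul] at h
  rw [← h, frameMap]
  have hβ' := Complex.ofReal_ne_zero.2 hβ
  push_cast at hβ'
  simp [subI_apply]
  field_simp

lemma IsFrame.normSq_vertPart {a α : ℝ} {G T P N : ℝ → E3} (H : IsFrame a α G T P N) (s : ℝ) :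
    ‖vertPart P N s‖ ^ 2 = (-a * T s 2 - α) * (1 - T s 2 ^ 2) := by
  rw [← H.norm_P, ← Complex.normSq_eq_norm_sq, Complex.normSq_apply, vertPart, H.N_eq,
    norm_sq_coord]
  have hs := sq_coord_of_norm_eq_one (H.norm_T s)
  have hp := H.inner_T_P s
  rw [inner_coord] at hp
  generalize P s = p at *
  generalize T s = t at *
  simp
  linear_combination (p 0 ^ 2 + p 1 ^ 2) * hs
    - (t 0 * p 0 + t 1 * p 1 - t 2 * p 2) * hp

lemma norm_amplitudeLimit_sq (a θ b : ℝ) : ‖amplitudeLimit a θ b‖ ^ 2 = (b / a) ^ 2 := by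
  rw [amplitudeLimit, norm_mul, norm_neg, Complex.norm_real, Complex.norm_exp]
  simp [div_pow]

/-- The asymptotic data of a curve in their reduced form: the value of `α` and the limits of the
tangent and of the vertical amplitude. -/
structure HasReducedLimits (a : ℝ) (B : E3) (θ b : ℝ) (G : ℝ → E3) : Prop where
  alpha_eq : alpha a G = alphaData a B b
  tendsto_tangent : Tendsto (unrot a (tangent G)) atTop (𝓝 B)
  tendsto_amplitude : Tendsto (fun s =>
    Complex.exp (-(Complex.I * phase (3 * a * B 2 + alpha a G) s)) *
      vertPart (deriv (tangent G)) (fun s => cross (tangent G s) (deriv (tangent G) s)) s) atTop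
    (𝓝 (amplitudeLimit a θ b))

lemma act_expSkew_neg_log (a s : ℝ) (v : E3) :
    act (expSkew a (-Real.log |s|)) v = rot (-(a * Real.log s)) v := by
  rw [act_expSkew, Real.log_abs, mul_neg]

lemma act_expSkew_log (a s : ℝ) (v : E3) :
    act (expSkew a (Real.log |s|)) v = rot (a * Real.log s) v := by
  rw [act_expSkew, Real.log_abs]

lemma tendsto_coord {ι : Type*} {f : ι → E3} {l : Filter ι} {v : E3}
    (h : Tendsto f l (𝓝 v)) (i : Fin 3) :
    Tendsto (fun s => f s i) l (𝓝 (v i)) :=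
  ((EuclideanSpace.proj (𝕜 := ℝ) i).continuous.tendsto v).comp h

lemma alpha_eq_alphaData {a B₃ b α : ℝ} (ha : a ≠ 0) (hβ : 1 - B₃ ^ 2 ≠ 0)
    (h : b ^ 2 = a ^ 2 * (-a * B₃ - α) * (1 - B₃ ^ 2)) :
    α = -a * B₃ - b ^ 2 / (a ^ 2 * (1 - B₃ ^ 2)) := by
  rw [h]
  field_simp
  ring

lemma HasLimits.reduced {a : ℝ} (ha : a ≠ 0) {B : E3} (hB : ‖B‖ = 1) (hβ : 1 - B 2 ^ 2 ≠ 0)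
    {θ b : ℝ} {G : ℝ → E3} (hG : IsSolution a G) (h : HasLimits a B θ b atTop G) :
    HasReducedLimits a B θ b G := by
  have H := hG.isFrame
  have hT : Tendsto (unrot a (tangent G)) atTop (𝓝 B) := by
    refine h.tangent_asymp.congr fun s => ?_
    rw [act_expSkew_neg_log]
    rfl
  have hA : Tendsto (fun s =>
      Complex.exp (-(Complex.I * phase (3 * a * B 2 + alphaData a B b) s)) *
      vertPart (deriv (tangent G)) (fun s => cross (tangent G s) (deriv (tangent G) s)) s) atTop
      (𝓝 (amplitudeLimit a θ b)) := by
    rw [← amplitude_mul_vert ha hB hβ]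
    refine (((EuclideanSpace.proj (𝕜 := ℂ) (2 : Fin 3)).continuous.tendsto _).comp
      h.frame_asymp).congr fun s => ?_
    simp only [Function.comp_apply, map_smul, smul_eq_mul]
    congr 1
    change subI _ _ 2 = _
    rw [act_expSkew_neg_log, act_expSkew_neg_log, subI_apply]
    apply Complex.ext <;> simp [vertPart]
  have hα : alpha a G = alphaData a B b := by
    refine alpha_eq_alphaData ha hβ ?_
    have h1 : Tendsto (fun s => (-a * tangent G s 2 - alpha a G) * (1 - tangent G s 2 ^ 2)) atTop
        (𝓝 ((-a * B 2 - alpha a G) * (1 - B 2 ^ 2))) := by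
      have := tendsto_coord hT 2
      simp only [unrot_apply_two] at this
      exact ((this.const_mul (-a)).sub_const _).mul ((this.pow 2).const_sub 1)
    have h2 := (hA.norm).pow 2
    simp only [norm_mul, norm_exp_neg_I_mul, one_mul, norm_amplitudeLimit_sq,
      H.normSq_vertPart] at h2
    have h3 := tendsto_nhds_unique h2 h1
    rw [div_pow, div_eq_iff (pow_ne_zero 2 ha)] at h3
    linarith
  exact ⟨hα, hT, by rw [hα]; exact hA⟩

lemma HasAsymptotics.reduced {a : ℝ} (ha : a ≠ 0) {B : E3} (hB : ‖B‖ = 1)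
    (hβ : 1 - B 2 ^ 2 ≠ 0) {θ b : ℝ} {G : ℝ → E3} (hG : IsSolution a G)
    (h : HasAsymptotics a B θ b atTop G) : HasReducedLimits a B θ b G := by
  obtain ⟨c, h⟩ := h
  refine ⟨alpha_eq_alphaData ha hβ h.sq_b, ?_, ?_⟩
  · have h1 : Tendsto (fun s : ℝ => tangent G s -
        (act (expSkew a (Real.log |s|)) B - (2 * c / s) • binormal G s)) atTop (𝓝 0) := by
      refine h.tangent_asymp.trans_tendsto ?_
      simpa using (tendsto_inv_atTop_zero (𝕜 := ℝ)).pow 2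
    have h2 : Tendsto (fun s : ℝ => (2 * c / s) • binormal G s) atTop (𝓝 0) := by
      have hb : (binormal G) =O[atTop] fun _ => (1 : ℝ) :=
        IsBigO.of_bound 1 (Eventually.of_forall fun s => by simpa using norm_binormal_le hG s)
      have := (tendsto_inv_pow_smul hb 0).const_smul (2 * c)
      simpa [smul_smul, div_eq_mul_inv] using this
    have h3 := (h1.sub h2).norm
    simp only [sub_zero, norm_zero] at h3
    rw [tendsto_iff_norm_sub_tendsto_zero]
    refine h3.congr fun s => ?_
    rw [act_expSkew_log, ← norm_rot (a * Real.log s) (unrot a (tangent G) s - B), map_sub, unrot,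
      rot_rot_neg]
    congr 1
    abel
  · have hlim : ∀ z : ℂ, Tendsto (fun s => vertPart (deriv (tangent G))
        (fun s => cross (tangent G s) (deriv (tangent G) s)) s -
          z * Complex.exp (Complex.I * phase (3 * a * B 2 + alpha a G) s)) atTop (𝓝 0) →
        Tendsto (fun s => Complex.exp (-(Complex.I * phase (3 * a * B 2 + alpha a G) s)) *
          vertPart (deriv (tangent G)) (fun s => cross (tangent G s) (deriv (tangent G) s)) s)
          atTop (𝓝 z) := fun z hz => by
      rw [tendsto_iff_norm_sub_tendsto_zero]
      have := hz.norm
      rw [norm_zero] at this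
      refine this.congr fun s => ?_
      rw [← one_mul ‖_ - _‖, ← norm_exp_neg_I_mul (phase (3 * a * B 2 + alpha a G) s), ← norm_mul,
        mul_sub, mul_left_comm, ← Complex.exp_add]
      simp
    apply hlim
    have h1 : Tendsto (fun s : ℝ => (c : ℂ) • subI (normal G s) (binormal G s) -
      (amplitude a B θ b *
          Complex.exp (Complex.I * (phase (3 * a * B 2 + alpha a G) s : ℂ))) •
        subI (act (expSkew a (Real.log |s|)) (cross (act (skew a) B) B))
          (act (expSkew a (Real.log |s|)) (act (skew a) B))) atTop (𝓝 0) := by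
      refine h.frame_asymp.trans_tendsto ?_
      simpa [Function.comp_def] using (tendsto_inv_atTop_zero (𝕜 := ℝ)).comp tendsto_abs_atTop_atTop
    have h2 := ((EuclideanSpace.proj (𝕜 := ℂ) (2 : Fin 3)).continuous.tendsto _).comp h1
    rw [map_zero] at h2
    have hbd : (fun s => subI (normal G s) (binormal G s) 2) =O[atTop] fun _ => (1 : ℝ) := by
      refine IsBigO.of_bound 2 (Eventually.of_forall fun s => ?_)
      have e1 : ‖((normal G s 2 : ℝ) : ℂ)‖ ≤ 1 := by
        rw [Complex.norm_real]
        exact (PiLp.norm_apply_le _ 2).trans (norm_normal_le G s)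
      have e2 : ‖((binormal G s 2 : ℝ) : ℂ)‖ ≤ 1 := by
        rw [Complex.norm_real]
        exact (PiLp.norm_apply_le _ 2).trans (norm_binormal_le hG s)
      rw [subI_apply]
      refine (norm_sub_le _ _).trans ?_
      rw [norm_mul, Complex.norm_I, one_mul, norm_one]
      linarith
    have h3 : Tendsto (fun s => ((curvature G s - c : ℝ) : ℂ) *
        subI (normal G s) (binormal G s) 2) atTop (𝓝 0) := by
      have e : Tendsto (fun s => curvature G s - c) atTop (𝓝 0) := by
        simpa using h.tendsto_curvature.sub_const c
      have e2 : (fun s => ((curvature G s - c : ℝ) : ℂ)) =O[atTop] fun s => curvature G s - c :=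
        IsBigO.of_bound 1 (Eventually.of_forall fun s => by
          rw [one_mul, Complex.norm_real])
      refine (e2.mul hbd).trans_tendsto ?_
      simpa using e
    have h4 := h2.add h3
    rw [add_zero] at h4
    refine h4.congr fun s => ?_
    have e1 : vertPart (deriv (tangent G))
        (fun s => cross (tangent G s) (deriv (tangent G) s)) s
        = (curvature G s : ℂ) * subI (normal G s) (binormal G s) 2 := by
      have p1 : deriv (tangent G) s 2 = curvature G s * normal G s 2 := by
        rw [← curvature_smul_normal]; rfl
      have p2 : cross (tangent G s) (deriv (tangent G) s) 2 = curvature G s * binormal G s 2 := by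
        rw [← curvature_smul_binormal]; rfl
      simp only [vertPart, p1, p2, subI_apply]
      apply Complex.ext <;> simp
    rw [e1, ← amplitude_mul_vert ha hB hβ]
    simp only [Function.comp_apply, map_sub, map_smul, smul_eq_mul]
    change (c : ℂ) * subI _ _ 2 - _ * subI _ _ 2 + _ = _
    rw [act_expSkew_log, act_expSkew_log]
    simp only [subI_apply, rot_apply_two]
    push_cast
    ring

/-! ### Expansions from the reduced data -/

namespace HasReducedLimits

variable {a : ℝ} {B : E3} {θ b : ℝ} {G : ℝ → E3}

lemma neg_sub_alpha (h : HasReducedLimits a B θ b G) :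
    -a * B 2 - alpha a G = b ^ 2 / (a ^ 2 * (1 - B 2 ^ 2)) := by
  rw [h.alpha_eq, alphaData]; ring

lemma isBigO_frame (h : HasReducedLimits a B θ b G) (hG : IsSolution a G) (ha : a ≠ 0)
    (hB : ‖B‖ = 1) (hβ : 1 - B 2 ^ 2 ≠ 0) :
    (fun s => Complex.exp (-(Complex.I * phase (3 * a * B 2 + alpha a G) s)) •
      subI (unrot a (deriv (tangent G)) s)
        (unrot a (fun s => cross (tangent G s) (deriv (tangent G) s)) s)
      - amplitude a B θ b • subI (cross (act (skew a) B) B) (act (skew a) B))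
      =O[atTop] fun s : ℝ => s⁻¹ := by
  rw [← frameMap_amplitudeLimit ha hB hβ]
  exact hG.isFrame.isBigO_frame h.tendsto_tangent hβ h.tendsto_amplitude

/-- The curvature converges with rate `1 / s`. If its limit `c` is positive this follows from
`c(s)² - c² = -a (T₃(s) - B₃)`; if `c = 0` the whole frame `T' - i T × T'` is `O(1 / s)`. -/
lemma isBigO_curvature (h : HasReducedLimits a B θ b G) (hG : IsSolution a G) (ha : a ≠ 0)
    (hB : ‖B‖ = 1) (hβ : 1 - B 2 ^ 2 ≠ 0) :
    (fun s => Real.sqrt (-a * B 2 - alpha a G) - curvature G s) =O[atTop] fun s : ℝ => s⁻¹ := by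
  have H := hG.isFrame
  have hβ0 := one_sub_sq_pos_of_ne hB hβ
  have hnn : 0 ≤ -a * B 2 - alpha a G := by rw [h.neg_sub_alpha]; positivity
  set c := Real.sqrt (-a * B 2 - alpha a G) with hc
  have hc2 : c ^ 2 = -a * B 2 - alpha a G := Real.sq_sqrt hnn
  rcases (Real.sqrt_nonneg (-a * B 2 - alpha a G)).eq_or_lt with h0 | h0
  · have hb : b = 0 := by
      rw [← hc] at h0
      rw [← h0, h.neg_sub_alpha] at hc2
      have : b ^ 2 = 0 := by
        by_contra hne
        have : 0 < b ^ 2 / (a ^ 2 * (1 - B 2 ^ 2)) := by positivity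
        linarith
      exact pow_eq_zero_iff two_ne_zero |>.1 this
    have h1 := h.isBigO_frame hG ha hB hβ
    simp only [hb, amplitude, Complex.ofReal_zero, zero_mul, zero_div, zero_smul, sub_zero] at h1
    refine IsBigO.trans (IsBigO.of_bound 1 (Eventually.of_forall fun s => ?_)) h1
    rw [hc, ← h0, zero_sub, norm_neg, one_mul, norm_smul, norm_exp_neg_I_mul, one_mul, curvature,
      norm_norm, ← norm_unrot a]
    exact norm_le_norm_subI _ _
  · have h1 := H.isBigO_unrot_T_sub h.tendsto_tangent
    refine IsBigO.trans (IsBigO.of_bound (|a| / c) (Eventually.of_forall fun s => ?_)) h1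
    have e1 : (c - curvature G s) * (c + curvature G s) = a * (tangent G s 2 - B 2) := by
      have := H.norm_P s
      change curvature G s ^ 2 = _ at this
      linear_combination hc2 - this
    have e2 : |tangent G s 2 - B 2| ≤ ‖unrot a (tangent G) s - B‖ := by
      simpa using PiLp.norm_apply_le (unrot a (tangent G) s - B) 2
    have hcs : 0 ≤ curvature G s := norm_nonneg _
    have e3 : |c - curvature G s| * (c + curvature G s) = |a| * |tangent G s 2 - B 2| := by
      rw [← abs_mul, ← e1, abs_mul, abs_of_nonneg (a := c + curvature G s) (by positivity)]
    rw [div_mul_eq_mul_div, le_div_iff₀ h0, Real.norm_eq_abs]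
    calc |c - curvature G s| * c ≤ |c - curvature G s| * (c + curvature G s) := by
          gcongr; linarith
      _ ≤ |a| * ‖unrot a (tangent G) s - B‖ := by rw [e3]; gcongr

/-- In a product with a bounded field the curvature may be replaced by its limit. -/
lemma isBigO_mul_sub (h : HasReducedLimits a B θ b G) (hG : IsSolution a G) (ha : a ≠ 0)
    (hB : ‖B‖ = 1) (hβ : 1 - B 2 ^ 2 ≠ 0) {E : Type*} [NormedAddCommGroup E] [NormedSpace ℝ E]
    {f : ℝ → E} {C : ℝ} (hf : ∀ s, ‖f s‖ ≤ C) :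
    (fun s => Real.sqrt (-a * B 2 - alpha a G) • f s - curvature G s • f s)
      =O[atTop] fun s : ℝ => s⁻¹ := by
  have h1 : f =O[atTop] fun _ => (1 : ℝ) :=
    IsBigO.of_bound C (Eventually.of_forall fun s => by simpa using hf s)
  simpa [sub_smul] using (h.isBigO_curvature hG ha hB hβ).smul h1

lemma hasExpansion (h : HasReducedLimits a B θ b G) (hG : IsSolution a G) (ha : a ≠ 0)
    (hB : ‖B‖ = 1) (hβ : 1 - B 2 ^ 2 ≠ 0) :
    HasExpansion a B θ b atTop G (Real.sqrt (-a * B 2 - alpha a G)) := by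
  have H := hG.isFrame
  have hβ0 := one_sub_sq_pos_of_ne hB hβ
  have hnn : 0 ≤ -a * B 2 - alpha a G := by rw [h.neg_sub_alpha]; positivity
  have hc2 := Real.sq_sqrt hnn
  have hn := h.isBigO_mul_sub hG ha hB hβ (norm_normal_le G)
  have hb := h.isBigO_mul_sub hG ha hB hβ (norm_binormal_le hG)
  simp only [curvature_smul_normal] at hn
  simp only [curvature_smul_binormal] at hb
  have hcurv := h.isBigO_curvature hG ha hB hβ
  set c := Real.sqrt (-a * B 2 - alpha a G)
  refine ⟨?_, hc2, ?_, ?_, ?_, ?_⟩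
  · have := hcurv.trans_tendsto tendsto_inv_atTop_zero
    simpa using this.const_sub c
  · rw [h.neg_sub_alpha]; field_simp
  · have h1 := H.isBigO_curve h.tendsto_tangent
    have h2 : (fun s : ℝ => s • (s⁻¹ • unrot a G s - asymVec a B
        - s⁻¹ ^ 2 • forcing a (alpha a G) B
        + (4 * s⁻¹ ^ 3) • unrot a (deriv (tangent G)) s)) =O[atTop] fun s : ℝ => s⁻¹ ^ 3 := by
      refine ((isBigO_refl (fun s : ℝ => s) atTop).smul h1).congr' EventuallyEq.rfl ?_
      filter_upwards [eventually_ne_atTop 0] with s hs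
      simp only [smul_eq_mul]
      field_simp
    have h3 : (fun s : ℝ => (4 : ℝ) • s⁻¹ ^ 2 • (c • normal G s - deriv (tangent G) s))
        =O[atTop] fun s : ℝ => s⁻¹ ^ 3 := by
      have := ((isBigO_refl (fun s : ℝ => s⁻¹ ^ 2) atTop).smul hn).const_smul_left (4 : ℝ)
      exact this.congr_right fun s => by simp only [smul_eq_mul]; ring
    have h4 := (isBigO_norm_left.1 ((isBigO_norm_left.2 h2).congr_left
      fun s => (norm_rot (a * Real.log s) _).symm)).add h3
    refine h4.congr' ?_ (Eventually.of_forall fun s => by simp)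
    filter_upwards [eventually_ne_atTop 0] with s hs
    have e1 : forcing a (alpha a G) B = (2 * c ^ 2) • B - cross (act (skew a) B) B := by
      have hs := sq_coord_of_norm_eq_one hB
      rw [hc2, act_skew]
      apply E3.ext_coord <;> simp [forcing]
      · ring
      · ring
      · linear_combination (-a) * hs
    rw [act_expSkew_log, act_expSkew_log, ← e1]
    have e2 : G s = rot (a * Real.log s) (unrot a G s) := (rot_rot_neg _ _).symm
    have e3 : deriv (tangent G) s = rot (a * Real.log s) (unrot a (deriv (tangent G)) s) :=
      (rot_rot_neg _ _).symm
    have e4 : s * s⁻¹ ^ 2 = s⁻¹ := by field_simp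
    have e5 : s * (4 * s⁻¹ ^ 3) = 4 * s⁻¹ ^ 2 := by field_simp
    simp only [smul_add, smul_sub, smul_smul, map_add, map_sub, map_smul, ← e2, ← e3, e4, e5,
      mul_inv_cancel₀ hs, one_smul]
    rw [show 4 * c / s ^ 2 = 4 * s⁻¹ ^ 2 * c by rw [inv_pow]; ring]
    module
  · have h1 := H.isBigO_tangent h.tendsto_tangent
    have h3 : (fun s : ℝ => (2 : ℝ) • s⁻¹ • (c • binormal G s
        - cross (tangent G s) (deriv (tangent G) s))) =O[atTop] fun s : ℝ => s⁻¹ ^ 2 := by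
      have := ((isBigO_refl (fun s : ℝ => s⁻¹) atTop).smul hb).const_smul_left (2 : ℝ)
      exact this.congr_right fun s => by simp only [smul_eq_mul]; ring
    have h4 := (isBigO_norm_left.1 ((isBigO_norm_left.2 h1).congr_left
      fun s => (norm_rot (a * Real.log s) _).symm)).add h3
    refine h4.congr (fun s => ?_) (fun s => by simp)
    rw [act_expSkew_log]
    have e2 : rot (a * Real.log s) (unrot a (tangent G) s) = tangent G s := rot_rot_neg _ _
    have e3 : rot (a * Real.log s) (unrot a
        (fun s => cross (tangent G s) (deriv (tangent G) s)) s)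
        = cross (tangent G s) (deriv (tangent G) s) := rot_rot_neg _ _
    simp only [map_add, map_sub, map_smul, e2, e3]
    rw [show 2 * c / s = 2 * s⁻¹ * c by ring]
    module
  · have h1 := h.isBigO_frame hG ha hB hβ
    have h2 : (fun s : ℝ => subI (c • normal G s - deriv (tangent G) s)
        (c • binormal G s - cross (tangent G s) (deriv (tangent G) s)))
        =O[atTop] fun s : ℝ => s⁻¹ :=
      (subIL.isBigO_comp (fun s => (c • normal G s - deriv (tangent G) s,
        c • binormal G s - cross (tangent G s) (deriv (tangent G) s))) atTop).trans
        (hn.prod_left hb)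
    have h3 : (fun s : ℝ => subI (deriv (tangent G) s)
        (cross (tangent G s) (deriv (tangent G) s)) - (amplitude a B θ b *
          Complex.exp (Complex.I * (phase (3 * a * B 2 + alpha a G) s : ℂ))) •
        subI (rot (a * Real.log s) (cross (act (skew a) B) B))
          (rot (a * Real.log s) (act (skew a) B))) =O[atTop] fun s : ℝ => s⁻¹ := by
      refine isBigO_norm_left.1 ((isBigO_norm_left.2 h1).congr_left fun s => ?_)
      have e2 : rot (a * Real.log s) (unrot a (deriv (tangent G)) s) = deriv (tangent G) s :=
        rot_rot_neg _ _
      have e3 : rot (a * Real.log s) (unrot a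
        (fun s => cross (tangent G s) (deriv (tangent G) s)) s)
        = cross (tangent G s) (deriv (tangent G) s) := rot_rot_neg _ _
      have h := norm_subI_rot_sub (a * Real.log s) (amplitude a B θ b *
          Complex.exp (Complex.I * (phase (3 * a * B 2 + alpha a G) s : ℂ)))
          (unrot a (deriv (tangent G)) s)
          (unrot a (fun s => cross (tangent G s) (deriv (tangent G) s)) s)
          (cross (act (skew a) B) B) (act (skew a) B)
      rw [e2, e3] at h
      rw [h, ← one_mul ‖subI _ _ - _‖,
        ← norm_exp_neg_I_mul (phase (3 * a * B 2 + alpha a G) s), ← norm_smul, smul_sub,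
        smul_smul, mul_left_comm, ← Complex.exp_add]
      simp
    refine (h2.add h3).congr' (Eventually.of_forall fun s => ?_) ?_
    · beta_reduce
      rw [act_expSkew_log, act_expSkew_log, ← subI_sub]
      have : (c : ℂ) • subI (normal G s) (binormal G s)
          = subI (c • normal G s) (c • binormal G s) := by
        rw [smul_subI]; simp
      rw [this]
      abel
    · filter_upwards [eventually_ge_atTop 0] with s hs
      rw [abs_of_nonneg hs, one_div]

lemma hasLimits (h : HasReducedLimits a B θ b G) (hG : IsSolution a G) (ha : a ≠ 0)
    (hB : ‖B‖ = 1) (hβ : 1 - B 2 ^ 2 ≠ 0) : HasLimits a B θ b atTop G := by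
  have H := hG.isFrame
  refine ⟨?_, ?_, ?_⟩
  · refine (H.tendsto_unrot_G h.tendsto_tangent).congr fun s => ?_
    rw [act_expSkew_neg_log, map_smul]
    rfl
  · refine h.tendsto_tangent.congr fun s => ?_
    rw [act_expSkew_neg_log]
    rfl
  · have h1 := (h.isBigO_frame hG ha hB hβ).trans_tendsto tendsto_inv_atTop_zero
    have h2 := h1.add_const (amplitude a B θ b • subI (cross (act (skew a) B) B) (act (skew a) B))
    simp only [sub_add_cancel, zero_add] at h2
    rw [← h.alpha_eq]
    refine h2.congr fun s => ?_
    rw [act_expSkew_neg_log, act_expSkew_neg_log]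
    rfl

end HasReducedLimits

/-! ### Existence with prescribed data at infinity -/

lemma norm_J_le (v : E3) : ‖J v‖ ≤ ‖v‖ := by
  rw [← sq_le_sq₀ (norm_nonneg _) (norm_nonneg _), norm_sq_coord, norm_sq_coord]
  simp
  nlinarith [sq_nonneg (v 2)]

lemma norm_le_norm_add_J (a : ℝ) (v : E3) : ‖v‖ ≤ ‖v + a • J v‖ := by
  rw [← sq_le_sq₀ (norm_nonneg _) (norm_nonneg _), norm_sq_coord, norm_sq_coord]
  simp
  nlinarith [mul_nonneg (sq_nonneg a) (sq_nonneg (v 0)),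
    mul_nonneg (sq_nonneg a) (sq_nonneg (v 1))]

lemma IsCurve.tangent_eq {a : ℝ} {G T : ℝ → E3} (h : IsCurve a G T) : tangent G = T :=
  funext fun s => (h.hasDerivAt_curve s).deriv

/-- A curve with prescribed tangent and prescribed vertical amplitude at a given time. -/
lemma exists_isCurve_of_amplitude (a s : ℝ) {t : E3} (ht : ‖t‖ = 1) (hβ : 1 - t 2 ^ 2 ≠ 0)
    (h : ℂ) : ∃ G T : ℝ → E3, IsCurve a G T ∧ T s = t ∧
      vertPart (deriv T) (fun s => cross (T s) (deriv T s)) s = h ∧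
      alpha a G = -a * t 2 - ‖h‖ ^ 2 / (1 - t 2 ^ 2) := by
  have hs := sq_coord_of_norm_eq_one ht
  -- the vector orthogonal to `t` with vertical amplitude `h`
  let p : E3 := (1 - t 2 ^ 2)⁻¹ • (h.re • (vert - t 2 • t) - h.im • J t)
  have hp2 : p 2 = h.re := by
    simp [p]
    field_simp
  have hN2 : cross t p 2 = -h.im := by
    simp [p]
    field_simp
    linear_combination (-h.im) * hs
  have hpt : inner ℝ t p = 0 := by
    rw [inner_coord]
    simp [p]
    linear_combination (-(1 - t 2 ^ 2)⁻¹ * h.re * t 2) * hs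
  have hV := asymVec_add a (s • t + (2 : ℝ) • cross t p)
  obtain ⟨G, T, hc, hG, hT⟩ := exists_isCurve a s (asymVec a (s • t + (2 : ℝ) • cross t p)) t ht
    (by
      rw [hV, inner_coord]
      simp
      linear_combination s * hs)
  have hP : deriv T s = p := by
    rw [(hc.hasDerivAt_tangent s).deriv, hG, hV, hT]
    rw [inner_coord] at hpt
    generalize p = p at *
    apply E3.ext_coord <;> simp
    · linear_combination p 0 * hs - t 0 * hpt
    · linear_combination p 1 * hs - t 1 * hpt
    · linear_combination p 2 * hs - t 2 * hpt
  have hv : vertPart (deriv T) (fun s => cross (T s) (deriv T s)) s = h := by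
    simp only [vertPart, hP, hT, hp2, hN2, neg_neg]
  refine ⟨G, T, hc, hT, hv, ?_⟩
  have := hc.isFrame.normSq_vertPart s
  rw [hv, hT] at this
  rw [this]
  field_simp
  ring

/-- Solutions with prescribed data at the time `t` satisfy, on `[1, t]`, bounds independent of
`t`. -/
lemma exists_uniform_bound (a α β : ℝ) : ∃ C : ℝ, 0 ≤ C ∧
    ∀ (G T P N : ℝ → E3) (B : E3) (z : ℂ) (t : ℝ), IsFrame a α G T P N → B 2 = β → 1 ≤ t →
    unrot a T t = B → Complex.exp (-(Complex.I * phase (3 * a * β + α) t)) * vertPart P N t = z →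
    ∀ x ∈ Set.Icc 1 t, ‖unrot a T x - B‖ ≤ C * x⁻¹ ∧
      ‖Complex.exp (-(Complex.I * phase (3 * a * β + α) x)) * vertPart P N x - z‖ ≤ C * x⁻¹ := by
  let K := frameBound a α
  have hK : 0 < K := frameBound_pos a α
  obtain ⟨C, hC, hamp⟩ := exists_amplitude_bound a α β (2 * K) (6 * K)
  refine ⟨C + (2 * K * (1 + |a|) + 4 * K), by positivity, ?_⟩
  intro G T P N B z t H hβ ht hTt hzt x hx
  have hpos : ∀ x ∈ Set.Icc 1 t, 0 < x := fun x hx => one_pos.trans_le hx.1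
  have hinv : ∀ x ∈ Set.Icc 1 t, t⁻¹ ≤ x⁻¹ := fun x hx => inv_anti₀ (hpos x hx) hx.2
  have hx0 := hpos x hx
  have ht0 : 0 < t := one_pos.trans_le ht
  constructor
  · have e : unrot a T x - B = (x⁻¹ • unrot a G x - t⁻¹ • unrot a G t)
        + a • J (x⁻¹ • unrot a G x - t⁻¹ • unrot a G t)
        - (2 * x⁻¹) • unrot a N x + (2 * t⁻¹) • unrot a N t := by
      rw [← hTt, H.curve_eq_unrot hx0.ne', H.curve_eq_unrot ht0.ne', map_sub]
      module
    have h1 : ‖x⁻¹ • unrot a G x - t⁻¹ • unrot a G t‖ ≤ 2 * K * x⁻¹ := by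
      rw [norm_sub_rev]; exact H.norm_unrot_G_sub_le hx0 hx.2
    have h2 : ‖a • J (x⁻¹ • unrot a G x - t⁻¹ • unrot a G t)‖ ≤ |a| * (2 * K * x⁻¹) := by
      rw [norm_smul, Real.norm_eq_abs]
      gcongr
      exact (norm_J_le _).trans h1
    have h3 : ‖(2 * x⁻¹) • unrot a N x‖ ≤ 2 * x⁻¹ * K := by
      rw [norm_smul, norm_unrot, Real.norm_of_nonneg (by positivity)]
      gcongr
      exact H.norm_N_le x
    have h4 : ‖(2 * t⁻¹) • unrot a N t‖ ≤ 2 * x⁻¹ * K := by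
      rw [norm_smul, norm_unrot, Real.norm_of_nonneg (by positivity)]
      have := hinv x hx
      gcongr
      exact H.norm_N_le t
    rw [e]
    refine (norm_add_le _ _).trans ((add_le_add (norm_sub_le _ _) le_rfl).trans ?_)
    have h5 := norm_add_le (x⁻¹ • unrot a G x - t⁻¹ • unrot a G t)
      (a • J (x⁻¹ • unrot a G x - t⁻¹ • unrot a G t))
    have h6 : 0 ≤ C * x⁻¹ := by positivity
    linarith
  · have hw : ∀ x ∈ Set.Icc 1 t,
        |T x 2 - 2 * x⁻¹ * (vertPart P N x).im - β| ≤ 6 * K * x⁻¹ := fun x hx => by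
      have hx0 := hpos x hx
      rw [H.height_sub hx0.ne']
      have e1 : β = (t⁻¹ • unrot a G t) 2 + 2 * t⁻¹ * (vertPart P N t).im := by
        rw [← H.height_sub ht0.ne', ← hβ, ← hTt, unrot_apply_two]; ring
      have e2 := PiLp.norm_apply_le (x⁻¹ • unrot a G x - t⁻¹ • unrot a G t) 2
      have e3 : ‖x⁻¹ • unrot a G x - t⁻¹ • unrot a G t‖ ≤ 2 * K * x⁻¹ := by
        rw [norm_sub_rev]; exact H.norm_unrot_G_sub_le hx0 hx.2
      have e4 : |2 * t⁻¹ * (vertPart P N t).im| ≤ 2 * x⁻¹ * (2 * K) := by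
        rw [abs_mul, abs_of_nonneg (by positivity)]
        have := hinv x hx
        gcongr
        exact (Complex.abs_im_le_norm _).trans (H.norm_vertPart_le t)
      rw [e1, ← sub_sub]
      refine (abs_sub _ _).trans ?_
      rw [Real.norm_eq_abs, PiLp.sub_apply] at e2
      linarith
    have h1 := hamp (fun s => T s 2) (vertPart P N) x t hx.1 hx.2
      (fun x _ => H.hasDerivAt_height x) (fun x _ => H.hasDerivAt_vertPart x)
      (fun x _ => H.abs_height_le x) (fun x _ => H.norm_vertPart_le x)
      (fun y hy => hw y ⟨hx.1.trans hy.1, hy.2⟩)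
    rw [hzt, norm_sub_rev] at h1
    have h6 : 0 ≤ (2 * K * (1 + |a|) + 4 * K) * x⁻¹ := by positivity
    linarith

lemma alpha_eq_of_isCurve {a : ℝ} {G T : ℝ → E3} (h : IsCurve a G T) :
    alpha a G = -a * T 0 2 - (1 / 4) * ‖G 0 + a • J (G 0)‖ ^ 2 := by
  rw [alpha, h.tangent_eq, act_one_add_skew]

lemma IsCurve.tendsto_vertPart {a x : ℝ} {G T : ℕ → ℝ → E3} {G₀ T₀ : ℝ → E3}
    (hc : ∀ n, IsCurve a (G n) (T n)) (hc₀ : IsCurve a G₀ T₀)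
    (hG : Tendsto (fun n => G n x) atTop (𝓝 (G₀ x)))
    (hT : Tendsto (fun n => T n x) atTop (𝓝 (T₀ x))) :
    Tendsto (fun n => vertPart (deriv (T n)) (fun s => cross (T n s) (deriv (T n) s)) x) atTop
      (𝓝 (vertPart (deriv T₀) (fun s => cross (T₀ s) (deriv T₀ s)) x)) := by
  have hcross : ∀ {u v : ℕ → E3} {u₀ v₀ : E3}, Tendsto u atTop (𝓝 u₀) → Tendsto v atTop (𝓝 v₀) →
      Tendsto (fun n => cross (u n) (v n)) atTop (𝓝 (cross u₀ v₀)) := fun hu hv =>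
    (crossL.continuous₂.tendsto _).comp (hu.prodMk_nhds hv)
  have hP : Tendsto (fun n => deriv (T n) x) atTop (𝓝 (deriv T₀ x)) := by
    rw [(hc₀.hasDerivAt_tangent x).deriv]
    simp only [((hc _).hasDerivAt_tangent x).deriv]
    have h1 : Tendsto (fun n => cross (G n x + a • J (G n x)) (T n x)) atTop
        (𝓝 (cross (G₀ x + a • J (G₀ x)) (T₀ x))) :=
      hcross (hG.add (((J.continuous.tendsto (G₀ x)).comp hG).const_smul a)) hT
    exact h1.const_smul _
  have hN : Tendsto (fun n => cross (T n x) (deriv (T n) x)) atTop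
      (𝓝 (cross (T₀ x) (deriv T₀ x))) :=
    hcross hT hP
  have e : ∀ P N : ℝ → E3, vertPart P N x = (P x 2 : ℂ) - Complex.I * (N x 2 : ℂ) := fun P N => by
    apply Complex.ext <;> simp [vertPart]
  simp only [e]
  have h1 : Tendsto (fun n => ((deriv (T n) x 2 : ℝ) : ℂ)) atTop (𝓝 ((deriv T₀ x 2 : ℝ) : ℂ)) :=
    (Complex.continuous_ofReal.tendsto _).comp (tendsto_coord hP 2)
  have h2 : Tendsto (fun n => ((cross (T n x) (deriv (T n) x) 2 : ℝ) : ℂ)) atTop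
      (𝓝 ((cross (T₀ x) (deriv T₀ x) 2 : ℝ) : ℂ)) :=
    (Complex.continuous_ofReal.tendsto _).comp (tendsto_coord hN 2)
  exact h1.sub (h2.const_mul Complex.I)

/-- Curves with a common value of `α` have data at `0` in a compact set, hence a subsequence
that converges, pointwise on `[0, ∞)`, to a curve with the same value of `α`. -/
lemma exists_limit_curve {a α : ℝ} {G T : ℕ → ℝ → E3} (hc : ∀ n, IsCurve a (G n) (T n))
    (hα : ∀ n, alpha a (G n) = α) :
    ∃ (σ : ℕ → ℕ) (G₀ T₀ : ℝ → E3), StrictMono σ ∧ IsCurve a G₀ T₀ ∧ alpha a G₀ = α ∧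
      ∀ x, 0 ≤ x → Tendsto (fun n => G (σ n) x) atTop (𝓝 (G₀ x)) ∧
        Tendsto (fun n => T (σ n) x) atTop (𝓝 (T₀ x)) := by
  have hmem : ∀ n, (G n 0, T n 0) ∈ Metric.closedBall (0 : E3) (2 * frameBound a α) ×ˢ
      Metric.closedBall (0 : E3) 1 := fun n => by
    have hF := (hc n).isFrame
    rw [hα n] at hF
    refine ⟨?_, by simp [hF.norm_T]⟩
    rw [mem_closedBall_zero_iff]
    refine (norm_le_norm_add_J a _).trans ?_
    rw [hF.curve_eq 0, zero_smul, zero_add, norm_smul, Real.norm_eq_abs, abs_two]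
    have := hF.norm_N_le 0
    linarith
  obtain ⟨⟨g, v⟩, -, σ, hσ, hlim⟩ := ((isCompact_closedBall (0 : E3) (2 * frameBound a α)).prod
    (isCompact_closedBall (0 : E3) 1)).tendsto_subseq hmem
  have hg : Tendsto (fun n => G (σ n) 0) atTop (𝓝 g) :=
    (continuous_fst.tendsto (g, v)).comp hlim
  have hv : Tendsto (fun n => T (σ n) 0) atTop (𝓝 v) :=
    (continuous_snd.tendsto (g, v)).comp hlim
  have hVg : Tendsto (fun n => G (σ n) 0 + a • J (G (σ n) 0)) atTop (𝓝 (g + a • J g)) :=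
    hg.add (((J.continuous.tendsto g).comp hg).const_smul a)
  have hv1 : ‖v‖ = 1 :=
    tendsto_nhds_unique hv.norm (by simp only [(hc _).norm_tangent]; exact tendsto_const_nhds)
  have hgv : inner ℝ (g + a • J g) v = 0 :=
    tendsto_nhds_unique (hVg.inner hv)
      (by simp only [(hc _).inner_tangent]; exact tendsto_const_nhds)
  obtain ⟨G₀, T₀, hc₀, hG₀, hT₀⟩ := exists_isCurve a 0 g v hv1 hgv
  refine ⟨σ, G₀, T₀, hσ, hc₀, ?_, fun x hx => IsCurve.tendsto_of_tendsto (fun n => hc (σ n)) hc₀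
    (hG₀ ▸ hg) (hT₀ ▸ hv) hx⟩
  rw [alpha_eq_of_isCurve hc₀, hG₀, hT₀]
  have h1 : Tendsto (fun n => -a * T (σ n) 0 2 - (1 / 4) * ‖G (σ n) 0 + a • J (G (σ n) 0)‖ ^ 2)
      atTop (𝓝 (-a * v 2 - (1 / 4) * ‖g + a • J g‖ ^ 2)) :=
    ((tendsto_coord hv 2).const_mul (-a)).sub ((hVg.norm.pow 2).const_mul (1 / 4))
  refine tendsto_nhds_unique h1 ?_
  simp only [← alpha_eq_of_isCurve (hc _), hα]
  exact tendsto_const_nhds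

/-- Curves that carry the limiting form as exact data at the times `n + 1`. -/
lemma exists_isCurve_seq {a : ℝ} {B : E3} (hB : ‖B‖ = 1) (hβ : 1 - B 2 ^ 2 ≠ 0) (θ b γ : ℝ) :
    ∃ G T : ℕ → ℝ → E3, ∀ n : ℕ, IsCurve a (G n) (T n) ∧ unrot a (T n) (n + 1) = B ∧
      Complex.exp (-(Complex.I * phase γ (n + 1))) *
        vertPart (deriv (T n)) (fun s => cross (T n s) (deriv (T n) s)) (n + 1)
          = amplitudeLimit a θ b ∧ alpha a (G n) = alphaData a B b := by
  have hdata : ∀ n : ℕ, ∃ G T : ℝ → E3, IsCurve a G T ∧ unrot a T (n + 1) = B ∧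
      Complex.exp (-(Complex.I * phase γ (n + 1))) *
        vertPart (deriv T) (fun s => cross (T s) (deriv T s)) (n + 1)
          = amplitudeLimit a θ b ∧ alpha a G = alphaData a B b := fun n => by
    obtain ⟨G, T, hc, hT, hv, hαG⟩ := exists_isCurve_of_amplitude a (n + 1)
      (t := rot (a * Real.log (n + 1)) B) (by rw [norm_rot, hB]) (by simpa using hβ)
      (Complex.exp (Complex.I * phase γ (n + 1)) * amplitudeLimit a θ b)
    refine ⟨G, T, hc, by rw [unrot, hT, rot_neg_rot], ?_, hαG.trans ?_⟩
    · rw [hv, ← mul_assoc, ← Complex.exp_add, neg_add_cancel, Complex.exp_zero, one_mul]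
    · rw [norm_mul, mul_comm Complex.I, Complex.norm_exp_ofReal_mul_I, one_mul,
        norm_amplitudeLimit_sq, alphaData, rot_apply_two, div_pow, div_div]
  choose G T h using hdata
  exact ⟨G, T, h⟩

/-- Solutions with the prescribed asymptotic data exist: take curves with the limiting form as
exact data at times tending to infinity; the bounds on them are uniform and pass to the limit of a
subsequence. -/
lemma exists_hasReducedLimits {a : ℝ} {B : E3} (hB : ‖B‖ = 1)
    (hβ : 1 - B 2 ^ 2 ≠ 0) (θ b : ℝ) :
    ∃ G : ℝ → E3, IsSolution a G ∧ HasReducedLimits a B θ b G := by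
  obtain ⟨G, T, hGT⟩ := exists_isCurve_seq hB hβ θ b (3 * a * B 2 + alphaData a B b)
  obtain ⟨C, hC, hunif⟩ := exists_uniform_bound a (alphaData a B b) (B 2)
  have hbound := fun n : ℕ => hunif (G n) (T n) _ _ B (amplitudeLimit a θ b) (n + 1)
    (by rw [← (hGT n).2.2.2]; exact (hGT n).1.isFrame) rfl (by simp) (hGT n).2.1 (hGT n).2.2.1
  obtain ⟨σ, G₀, T₀, hσ, hc₀, hα₀, hconv⟩ :=
    exists_limit_curve (fun n => (hGT n).1) (fun n => (hGT n).2.2.2)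
  have hlarge : ∀ x : ℝ, 1 ≤ x → ∀ᶠ n in atTop, x ∈ Set.Icc (1 : ℝ) (σ n + 1) := fun x hx => by
    filter_upwards [(tendsto_natCast_atTop_atTop.comp hσ.tendsto_atTop).eventually_ge_atTop x]
      with n hn
    exact ⟨hx, by simp only [Function.comp_apply] at hn; linarith⟩
  have hz : Tendsto (fun x : ℝ => C * x⁻¹) atTop (𝓝 0) := by
    simpa using (tendsto_inv_atTop_zero (𝕜 := ℝ)).const_mul C
  refine ⟨G₀, hc₀.isSolution, hα₀, ?_, ?_⟩
  · rw [hc₀.tangent_eq, tendsto_iff_norm_sub_tendsto_zero]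
    refine squeeze_zero' (Eventually.of_forall fun _ => norm_nonneg _)
      ((eventually_ge_atTop 1).mono fun x hx => ?_) hz
    have h1 : Tendsto (fun n => unrot a (T (σ n)) x) atTop (𝓝 (unrot a T₀ x)) :=
      ((rot _).continuous.tendsto _).comp (hconv x (by linarith)).2
    refine le_of_tendsto (h1.sub_const B).norm ?_
    filter_upwards [hlarge x hx] with n hn using (hbound (σ n) x hn).1
  · rw [hc₀.tangent_eq, hα₀, tendsto_iff_norm_sub_tendsto_zero]
    refine squeeze_zero' (Eventually.of_forall fun _ => norm_nonneg _)
      ((eventually_ge_atTop 1).mono fun x hx => ?_) hz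
    have h1 := IsCurve.tendsto_vertPart (fun n => (hGT (σ n)).1) hc₀
      (hconv x (by linarith)).1 (hconv x (by linarith)).2
    refine le_of_tendsto ((h1.const_mul _).sub_const _).norm ?_
    filter_upwards [hlarge x hx] with n hn using (hbound (σ n) x hn).2

/-! ### Uniqueness -/

/-- The remainder in the equation of the corrected difference `d - (2 i γ / s) W + (γ / s²) d̄` of
two amplitudes, multiplied by `s²`; here `p = 1 / s` and `κ = s W`. It is linear in `(κ, d)`. -/
def differenceRemainder (γ p η κ : ℝ) (d : ℂ) : ℂ :=
  ((η * (κ + 2 * d.im) + γ * (γ + p * η) * p * (κ + 2 * d.im) + 2 * γ ^ 2 * p * κ : ℝ) : ℂ)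
    + Complex.I * ((2 * γ * p * κ - 4 * γ * p * d.im : ℝ) : ℂ)
    + (((-(2 * γ * p) : ℝ) : ℂ) + Complex.I * ((γ ^ 2 * p : ℝ) : ℂ)) * (starRingEnd ℂ) d

lemma norm_differenceRemainder_le {γ p η κ E M : ℝ} {d : ℂ} (hp : 0 ≤ p) (hp1 : p ≤ 1)
    (hη : |η| ≤ E) (hκ : |κ| ≤ 2 * M) (hd : ‖d‖ ≤ M) :
    ‖differenceRemainder γ p η κ d‖ ≤
      (4 * E + 4 * |γ| * (|γ| + E) + 5 * γ ^ 2 + 10 * |γ|) * M := by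
  have hM : 0 ≤ M := (norm_nonneg _).trans hd
  have hE : 0 ≤ E := (abs_nonneg _).trans hη
  have him : |d.im| ≤ M := (Complex.abs_im_le_norm d).trans hd
  have hk : |κ + 2 * d.im| ≤ 4 * M := by
    refine (abs_add_le _ _).trans ?_
    rw [abs_mul, abs_two]
    linarith
  have hpη : |γ + p * η| ≤ |γ| + E := by
    refine (abs_add_le _ _).trans ?_
    rw [abs_mul, abs_of_nonneg hp]
    nlinarith [abs_nonneg η]
  have hbd : ∀ c x X : ℝ, 0 ≤ c → |x| ≤ X → |c * p * x| ≤ c * X := fun c x X hc hx => by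
    rw [abs_mul, abs_of_nonneg (by positivity)]
    exact mul_le_mul (by nlinarith) hx (abs_nonneg _) hc
  have h1 : |η * (κ + 2 * d.im)| ≤ E * (4 * M) := by
    rw [abs_mul]; exact mul_le_mul hη hk (abs_nonneg _) hE
  have h2 : |γ * (γ + p * η) * p * (κ + 2 * d.im)| ≤ |γ| * (|γ| + E) * (4 * M) := by
    have e := hbd (|γ| * |γ + p * η|) (κ + 2 * d.im) (4 * M) (by positivity) hk
    rw [abs_mul, abs_mul, abs_mul, abs_abs, abs_abs] at e
    rw [abs_mul, abs_mul, abs_mul]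
    refine e.trans ?_
    gcongr
  have h3 : |2 * γ ^ 2 * p * κ| ≤ 2 * γ ^ 2 * (2 * M) := hbd _ _ _ (by positivity) hκ
  have h4 : |2 * γ * p * κ| ≤ 2 * |γ| * (2 * M) := by
    have e := hbd (2 * |γ|) κ (2 * M) (by positivity) hκ
    simpa [abs_mul] using e
  have h5 : |4 * γ * p * d.im| ≤ 4 * |γ| * M := by
    have e := hbd (4 * |γ|) d.im M (by positivity) him
    simpa [abs_mul] using e
  have h6 : |2 * γ * p| ≤ 2 * |γ| := by
    have e := hbd (2 * |γ|) 1 1 (by positivity) (by simp)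
    simpa [abs_mul] using e
  have h7 : |γ ^ 2 * p| ≤ γ ^ 2 := by
    have e := hbd (γ ^ 2) 1 1 (by positivity) (by simp)
    simpa using e
  have n1 : ‖((-(2 * γ * p) : ℝ) : ℂ) + Complex.I * ((γ ^ 2 * p : ℝ) : ℂ)‖ ≤ 2 * |γ| + γ ^ 2 := by
    refine (norm_add_le _ _).trans ?_
    rw [norm_mul, Complex.norm_I, one_mul, Complex.norm_real, Complex.norm_real, Real.norm_eq_abs,
      Real.norm_eq_abs, abs_neg]
    exact add_le_add h6 h7
  have n2 : ‖(((-(2 * γ * p) : ℝ) : ℂ) + Complex.I * ((γ ^ 2 * p : ℝ) : ℂ)) * (starRingEnd ℂ) d‖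
      ≤ (2 * |γ| + γ ^ 2) * M := by
    rw [norm_mul, Complex.norm_conj]
    exact mul_le_mul n1 hd (norm_nonneg _) (by positivity)
  have n3 : ‖Complex.I * ((2 * γ * p * κ - 4 * γ * p * d.im : ℝ) : ℂ)‖
      ≤ 2 * |γ| * (2 * M) + 4 * |γ| * M := by
    rw [norm_mul, Complex.norm_I, one_mul, Complex.norm_real, Real.norm_eq_abs]
    exact (abs_sub _ _).trans (add_le_add h4 h5)
  have n4 : ‖((η * (κ + 2 * d.im) + γ * (γ + p * η) * p * (κ + 2 * d.im)
      + 2 * γ ^ 2 * p * κ : ℝ) : ℂ)‖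
      ≤ E * (4 * M) + |γ| * (|γ| + E) * (4 * M) + 2 * γ ^ 2 * (2 * M) := by
    rw [Complex.norm_real, Real.norm_eq_abs]
    exact (abs_add_le _ _).trans (add_le_add ((abs_add_le _ _).trans (add_le_add h1 h2)) h3)
  rw [differenceRemainder]
  refine (norm_add_le _ _).trans ((add_le_add ((norm_add_le _ _).trans (add_le_add n4 n3)) n2).trans
    (le_of_eq ?_))
  ring

/-- The linear system satisfied by the difference of two solutions of the scalar system, in the
normal form `f' = i φ' f + O(s⁻²)`. -/
lemma hasDerivAt_corrected_sub (γ η : ℝ) {W : ℝ → ℝ} {d : ℝ → ℂ} {s : ℝ} (hs : s ≠ 0)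
    (hW : HasDerivAt W (2 * s⁻¹ ^ 2 * (d s).im) s)
    (hd : HasDerivAt d (Complex.I * s / 2 * d s
      + ((γ + s⁻¹ * η) * (W s + 2 * s⁻¹ * (d s).im) : ℝ)) s) :
    HasDerivAt (fun s => d s + ((γ * s⁻¹ ^ 2 : ℝ) : ℂ) * (starRingEnd ℂ) (d s)
        - Complex.I * ((2 * γ * s⁻¹ * W s : ℝ) : ℂ))
      (Complex.I * ((s / 2 - γ * s⁻¹ : ℝ) : ℂ) *
          (d s + ((γ * s⁻¹ ^ 2 : ℝ) : ℂ) * (starRingEnd ℂ) (d s)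
            - Complex.I * ((2 * γ * s⁻¹ * W s : ℝ) : ℂ))
        + (s⁻¹ ^ 2 : ℝ) * differenceRemainder γ s⁻¹ η (s * W s) (d s)) s := by
  obtain ⟨d', hd'⟩ : ∃ d', d' = Complex.I * s / 2 * d s
      + ((γ + s⁻¹ * η) * (W s + 2 * s⁻¹ * (d s).im) : ℝ) := ⟨_, rfl⟩
  have hre : d'.re = -(s / 2 * (d s).im) + (γ + s⁻¹ * η) * (W s + 2 * s⁻¹ * (d s).im) := by
    rw [hd', Complex.add_re, Complex.ofReal_re]
    simp
  have him : d'.im = s / 2 * (d s).re := by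
    rw [hd', Complex.add_im, Complex.ofReal_im]
    simp
  rw [← hd'] at hd
  have hinv := hasDerivAt_inv hs
  have h1 : HasDerivAt (fun s : ℝ => γ * s⁻¹ ^ 2) _ s := (hinv.pow 2).const_mul γ
  have h2 : HasDerivAt (fun s : ℝ => 2 * γ * s⁻¹ * W s) _ s := (hinv.const_mul (2 * γ)).mul hW
  have hf : HasDerivAt (fun s => d s + ((γ * s⁻¹ ^ 2 : ℝ) : ℂ) * (starRingEnd ℂ) (d s)
        - Complex.I * ((2 * γ * s⁻¹ * W s : ℝ) : ℂ)) _ s :=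
    (hd.add (h1.ofReal_comp.mul (hasDerivAt_conj hd))).sub (h2.ofReal_comp.const_mul Complex.I)
  refine hf.congr_deriv ?_
  apply Complex.ext
  · simp only [differenceRemainder, Complex.add_re, Complex.sub_re, Complex.mul_re,
      Complex.ofReal_re, Complex.ofReal_im, Complex.I_re, Complex.I_im, Complex.conj_re,
      Complex.conj_im, Complex.add_im, Complex.sub_im, Complex.mul_im]
    rw [hre, him]
    norm_num
    field_simp
    ring
  · simp only [differenceRemainder, Complex.add_re, Complex.sub_re, Complex.mul_re,
      Complex.ofReal_re, Complex.ofReal_im, Complex.I_re, Complex.I_im, Complex.conj_re,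
      Complex.conj_im, Complex.add_im, Complex.sub_im, Complex.mul_im]
    rw [hre, him]
    norm_num
    field_simp
    ring

/-- A solution of the linear difference system that tends to zero vanishes for large `s`: any bound
for it on a ray far enough out can be halved. -/
lemma eventually_eq_zero_of_tendsto {γ E : ℝ} {η W : ℝ → ℝ} {d : ℝ → ℂ}
    (hη : ∀ᶠ s in atTop, |η s| ≤ E)
    (hW : ∀ s, 0 < s → HasDerivAt W (2 * s⁻¹ ^ 2 * (d s).im) s)
    (hd : ∀ s, 0 < s → HasDerivAt d (Complex.I * s / 2 * d s
      + ((γ + s⁻¹ * η s) * (W s + 2 * s⁻¹ * (d s).im) : ℝ)) s)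
    (hW0 : Tendsto W atTop (𝓝 0)) (hd0 : Tendsto d atTop (𝓝 0)) :
    ∀ᶠ s in atTop, W s = 0 ∧ d s = 0 := by
  obtain ⟨s₁, hs₁⟩ := eventually_atTop.1 hη
  have hE : 0 ≤ E := (abs_nonneg _).trans (hs₁ s₁ le_rfl)
  obtain ⟨s₂, hs₂⟩ := eventually_atTop.1
    ((tendsto_zero_iff_norm_tendsto_zero.1 hd0).eventually_le_const one_pos)
  let K := 4 * E + 4 * |γ| * (|γ| + E) + 5 * γ ^ 2 + 10 * |γ|
  have hK : 0 ≤ K := by positivity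
  -- beyond `s₀` the constant `(K + 5 |γ|) / s` in the estimate of `d` is at most `1 / 2`
  let s₀ := max (max s₁ s₂) (max 1 (2 * (K + 5 * |γ|)))
  have hmem : ∀ s, s₀ ≤ s → s₁ ≤ s ∧ s₂ ≤ s ∧ 1 ≤ s ∧ 2 * (K + 5 * |γ|) ≤ s := fun s hs =>
    ⟨(le_max_left _ _).trans ((le_max_left _ _).trans hs),
      (le_max_right _ _).trans ((le_max_left _ _).trans hs),
      (le_max_left _ _).trans ((le_max_right _ _).trans hs),
      (le_max_right _ _).trans ((le_max_right _ _).trans hs)⟩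
  have hpos : ∀ s, s₀ ≤ s → 0 < s := fun s hs => one_pos.trans_le (hmem s hs).2.2.1
  have hinv1 : ∀ s, s₀ ≤ s → s⁻¹ ≤ 1 := fun s hs => inv_le_one_of_one_le₀ (hmem s hs).2.2.1
  -- `W` is the integral of its derivative from infinity
  have hWle : ∀ M, (∀ s, s₀ ≤ s → ‖d s‖ ≤ M) → ∀ s, s₀ ≤ s → |W s| ≤ 2 * M * s⁻¹ :=
    fun M hM s hs => by
      have hM0 : 0 ≤ M := (norm_nonneg _).trans (hM s hs)
      have := norm_sub_lim_le_of_deriv_le (k := 1) (C := 2 * M) one_ne_zero (by positivity)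
        (hpos s hs) (fun x hx => hW x (hpos x (hs.trans hx))) (fun x hx => ?_) hW0
      · simpa using this
      · rw [Real.norm_eq_abs, abs_mul, abs_of_nonneg (by positivity)]
        have := (Complex.abs_im_le_norm _).trans (hM x (hs.trans hx))
        calc 2 * x⁻¹ ^ 2 * |(d x).im| ≤ 2 * x⁻¹ ^ 2 * M := by gcongr
          _ = 2 * M * x⁻¹ ^ (1 + 1) := by ring
  -- the corrected difference `f` is `O(M / s)` since it tends to zero, and `d - f = O(M / s)`
  have hhalf : ∀ M, (∀ s, s₀ ≤ s → ‖d s‖ ≤ M) → ∀ s, s₀ ≤ s → ‖d s‖ ≤ M / 2 :=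
    fun M hM s hs => by
      have hM0 : 0 ≤ M := (norm_nonneg _).trans (hM s hs)
      have hs0 := hpos s hs
      let f := fun s => d s + ((γ * s⁻¹ ^ 2 : ℝ) : ℂ) * (starRingEnd ℂ) (d s)
        - Complex.I * ((2 * γ * s⁻¹ * W s : ℝ) : ℂ)
      have hf0 : Tendsto f atTop (𝓝 0) := by
        have hp : Tendsto (fun s : ℝ => s⁻¹) atTop (𝓝 0) := tendsto_inv_atTop_zero
        have h1 : Tendsto (fun s : ℝ => ((γ * s⁻¹ ^ 2 : ℝ) : ℂ)) atTop (𝓝 ((γ * 0 ^ 2 : ℝ) : ℂ)) :=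
          (Complex.continuous_ofReal.tendsto _).comp ((hp.pow 2).const_mul γ)
        have h2 : Tendsto (fun s : ℝ => ((2 * γ * s⁻¹ * W s : ℝ) : ℂ)) atTop
            (𝓝 ((2 * γ * 0 * 0 : ℝ) : ℂ)) :=
          (Complex.continuous_ofReal.tendsto _).comp ((hp.const_mul (2 * γ)).mul hW0)
        have h3 : Tendsto (fun s => (starRingEnd ℂ) (d s)) atTop (𝓝 ((starRingEnd ℂ) 0)) :=
          (Complex.continuous_conj.tendsto 0).comp hd0
        have h4 := (hd0.add (h1.mul h3)).sub (h2.const_mul Complex.I)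
        rw [map_zero, mul_zero, add_zero, mul_zero, Complex.ofReal_zero, mul_zero, sub_zero] at h4
        exact h4
      have hg0 : Tendsto (fun s => Complex.exp (-(Complex.I * phase γ s)) * f s) atTop (𝓝 0) := by
        rw [tendsto_zero_iff_norm_tendsto_zero]
        simpa only [norm_mul, norm_exp_neg_I_mul, one_mul] using
          tendsto_zero_iff_norm_tendsto_zero.1 hf0
      have h1 := norm_sub_lim_le_of_deriv_le (k := 1) (C := K * M) one_ne_zero (by positivity)
        hs0 (fun x hx => hasDerivAt_exp_phase_mul γ (hpos x (hs.trans hx)).ne'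
          (hasDerivAt_corrected_sub γ (η x) (hpos x (hs.trans hx)).ne'
            (hW x (hpos x (hs.trans hx))) (hd x (hpos x (hs.trans hx)))))
        (fun x hx => by
          have hx0 := hpos x (hs.trans hx)
          rw [norm_mul, norm_exp_neg_I_mul, one_mul, norm_mul, Complex.norm_real,
            Real.norm_of_nonneg (by positivity), mul_comm]
          gcongr
          refine norm_differenceRemainder_le (inv_nonneg.2 hx0.le) (hinv1 x (hs.trans hx))
            (hs₁ x (hmem x (hs.trans hx)).1) ?_ (hM x (hs.trans hx))
          rw [abs_mul, abs_of_pos hx0]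
          calc x * |W x| ≤ x * (2 * M * x⁻¹) := by
                have := hWle M hM x (hs.trans hx)
                gcongr
            _ = 2 * M := by field_simp) hg0
      rw [sub_zero, norm_mul, norm_exp_neg_I_mul, one_mul, pow_one] at h1
      have e : d s = f s - ((γ * s⁻¹ ^ 2 : ℝ) : ℂ) * (starRingEnd ℂ) (d s)
          + Complex.I * ((2 * γ * s⁻¹ * W s : ℝ) : ℂ) := by simp only [f]; ring
      have hp1 := hinv1 s hs
      have hp0 : 0 < s⁻¹ := inv_pos.2 hs0
      have hpp : s⁻¹ ^ 2 ≤ s⁻¹ := by nlinarith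
      have h2 : ‖((γ * s⁻¹ ^ 2 : ℝ) : ℂ) * (starRingEnd ℂ) (d s)‖ ≤ |γ| * s⁻¹ * M := by
        rw [norm_mul, Complex.norm_conj, Complex.norm_real, Real.norm_eq_abs, abs_mul,
          abs_of_nonneg (by positivity : 0 ≤ s⁻¹ ^ 2)]
        have := hM s hs
        gcongr
      have h3 : ‖Complex.I * ((2 * γ * s⁻¹ * W s : ℝ) : ℂ)‖ ≤ 4 * |γ| * s⁻¹ * M := by
        rw [norm_mul, Complex.norm_I, one_mul, Complex.norm_real, Real.norm_eq_abs, abs_mul,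
          abs_mul, abs_mul, abs_two, abs_of_pos hp0]
        calc 2 * |γ| * s⁻¹ * |W s| ≤ 2 * |γ| * s⁻¹ * (2 * M * s⁻¹) := by
              have := hWle M hM s hs
              gcongr
          _ = 4 * |γ| * M * s⁻¹ ^ 2 := by ring
          _ ≤ 4 * |γ| * M * s⁻¹ := by gcongr
          _ = 4 * |γ| * s⁻¹ * M := by ring
      have h4 : (K + 5 * |γ|) * s⁻¹ ≤ 1 / 2 := by
        rw [← div_eq_mul_inv, div_le_iff₀ hs0]
        linarith [(hmem s hs).2.2.2]
      have h5 : (K + 5 * |γ|) * s⁻¹ * M ≤ 1 / 2 * M := by gcongr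
      rw [e]
      refine (norm_add_le _ _).trans ((add_le_add ((norm_sub_le _ _).trans
        (add_le_add h1 h2)) h3).trans ?_)
      linarith
  have hiter : ∀ n : ℕ, ∀ s, s₀ ≤ s → ‖d s‖ ≤ (1 / 2) ^ n := fun n => by
    induction n with
    | zero => exact fun s hs => by simpa using hs₂ s (hmem s hs).2.1
    | succ n ih =>
      intro s hs
      refine (hhalf _ ih s hs).trans (le_of_eq ?_)
      rw [pow_succ]
      ring
  have hzero : ∀ s, s₀ ≤ s → ‖d s‖ ≤ 0 := fun s hs =>
    ge_of_tendsto' (tendsto_pow_atTop_nhds_zero_of_lt_one (by norm_num) (by norm_num))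
      fun n => hiter n s hs
  filter_upwards [eventually_ge_atTop s₀] with s hs
  exact ⟨by simpa using hWle 0 hzero s hs, norm_le_zero_iff.1 (hzero s hs)⟩

/-- Two solutions of the scalar system with the same asymptotic data agree for large `s`. -/
lemma eventually_eq_of_scalar_system {a α β : ℝ} {y₁ y₂ : ℝ → ℝ} {h₁ h₂ : ℝ → ℂ}
    (hy₁ : ∀ s, HasDerivAt y₁ (h₁ s).re s) (hy₂ : ∀ s, HasDerivAt y₂ (h₂ s).re s)
    (hh₁ : ∀ s : ℝ, HasDerivAt h₁ (Complex.I * s / 2 * h₁ s + scalarPoly a α (y₁ s)) s)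
    (hh₂ : ∀ s : ℝ, HasDerivAt h₂ (Complex.I * s / 2 * h₂ s + scalarPoly a α (y₂ s)) s)
    (hβ₁ : (fun s => y₁ s - β) =O[atTop] fun s : ℝ => s⁻¹)
    (hβ₂ : (fun s => y₂ s - β) =O[atTop] fun s : ℝ => s⁻¹)
    (hh : Tendsto (fun s => h₁ s - h₂ s) atTop (𝓝 0)) :
    ∀ᶠ s in atTop, y₁ s = y₂ s ∧ h₁ s = h₂ s := by
  let η : ℝ → ℝ := fun s => 3 * a / 2 * (s * (y₁ s - β + (y₂ s - β)))
  let W : ℝ → ℝ := fun s => y₁ s - y₂ s - 2 * s⁻¹ * (h₁ s - h₂ s).im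
  obtain ⟨E, hE⟩ : ∃ E, ∀ᶠ s in atTop, |η s| ≤ E := by
    have h1 : η =O[atTop] fun s : ℝ => s * s⁻¹ :=
      ((isBigO_refl _ _).mul (hβ₁.add hβ₂)).const_mul_left _
    obtain ⟨C, hC⟩ := h1.bound
    refine ⟨C, ?_⟩
    filter_upwards [hC, eventually_gt_atTop 0] with s hs hs0
    simpa [mul_inv_cancel₀ hs0.ne'] using hs
  have hd : ∀ s, HasDerivAt (fun s => h₁ s - h₂ s) (Complex.I * s / 2 * (h₁ s - h₂ s)
      + ((scalarPoly a α (y₁ s) - scalarPoly a α (y₂ s) : ℝ) : ℂ)) s := fun s => by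
    refine ((hh₁ s).sub (hh₂ s)).congr_deriv ?_
    push_cast
    ring
  have hp : Tendsto (fun s : ℝ => s⁻¹) atTop (𝓝 0) := tendsto_inv_atTop_zero
  have hWd : ∀ s, 0 < s → HasDerivAt W (2 * s⁻¹ ^ 2 * (h₁ s - h₂ s).im) s := fun s hs => by
    have him : HasDerivAt (fun s => (h₁ s - h₂ s).im) _ s :=
      Complex.imCLM.hasFDerivAt.comp_hasDerivAt s (hd s)
    have h1 : HasDerivAt W _ s := ((hy₁ s).sub (hy₂ s)).sub
      (((hasDerivAt_inv hs.ne').const_mul 2).mul him)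
    refine h1.congr_deriv ?_
    rw [Complex.imCLM_apply, Complex.add_im, Complex.ofReal_im]
    simp
    field_simp
    ring
  have hW0 : Tendsto W atTop (𝓝 0) := by
    have h1 : Tendsto (fun s => y₁ s - y₂ s) atTop (𝓝 0) :=
      ((hβ₁.sub hβ₂).trans_tendsto hp).congr fun s => by ring
    have h2 : Tendsto (fun s => (h₁ s - h₂ s).im) atTop (𝓝 0) :=
      (Complex.continuous_im.tendsto 0).comp hh
    simpa [W] using h1.sub ((hp.const_mul 2).mul h2)
  have key := eventually_eq_zero_of_tendsto (γ := 3 * a * β + α) hE hWd (fun s hs => ?_) hW0 hh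
  · filter_upwards [key] with s ⟨h1, h2⟩
    refine ⟨?_, sub_eq_zero.1 h2⟩
    simp only [W, h2] at h1
    simpa [sub_eq_zero] using h1
  · refine (hd s).congr_deriv ?_
    congr 2
    simp only [η, W, scalarPoly]
    field_simp
    ring

/-- Two unit tangents with the same height and the same vertical amplitude on a ray, whose distance
tends to zero, agree there: `|T₁ - T₂|² / (1 - T₃²)` is constant. -/
lemma tangent_eq_of_vertPart_eq {a α s₀ β : ℝ} {G₁ T₁ P₁ N₁ G₂ T₂ P₂ N₂ : ℝ → E3}
    (H₁ : IsFrame a α G₁ T₁ P₁ N₁) (H₂ : IsFrame a α G₂ T₂ P₂ N₂) (hs₀ : 0 < s₀)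
    (hy : ∀ s, s₀ ≤ s → T₁ s 2 = T₂ s 2)
    (hh : ∀ s, s₀ ≤ s → vertPart P₁ N₁ s = vertPart P₂ N₂ s)
    (hpos : ∀ s, s₀ ≤ s → 1 - T₁ s 2 ^ 2 ≠ 0) (hβ : 1 - β ^ 2 ≠ 0)
    (hlim : Tendsto (fun s => T₁ s 2) atTop (𝓝 β))
    (hT : Tendsto (fun s => ‖T₁ s - T₂ s‖) atTop (𝓝 0)) {s : ℝ} (hs : s₀ ≤ s) :
    T₁ s = T₂ s := by
  let q : ℝ → ℝ := fun s => ‖T₁ s - T₂ s‖ ^ 2 / (1 - T₁ s 2 ^ 2)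
  have hP : ∀ {G T P N : ℝ → E3}, IsFrame a α G T P N → ∀ s, (1 - T s 2 ^ 2) • P s
      = P s 2 • (vert - T s 2 • T s) + N s 2 • J (T s) := fun {G T P N} H s => by
    have hs := sq_coord_of_norm_eq_one (H.norm_T s)
    have hi := H.inner_T_P s
    rw [inner_coord] at hi
    rw [H.N_eq]
    apply E3.ext_coord <;> simp
    · linear_combination -P s 0 * hs + T s 0 * hi
    · linear_combination -P s 1 * hs + T s 1 * hi
    · ring
  have hq : ∀ x, s₀ ≤ x → HasDerivAt q 0 x := fun x hx => by
    have h1 := ((H₁.hasDerivAt_T x).sub (H₂.hasDerivAt_T x)).norm_sq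
    have h2 := ((hasDerivAt_coord (H₁.hasDerivAt_T x) 2).pow 2).const_sub 1
    have h3 : HasDerivAt q _ x := h1.div h2 (hpos x hx)
    refine h3.congr_deriv ?_
    have e1 := hP H₁ x
    have e2 := hP H₂ x
    have ev := hh x hx
    have er : P₁ x 2 = P₂ x 2 := congrArg Complex.re ev
    have ei : N₁ x 2 = N₂ x 2 := neg_injective (congrArg Complex.im ev)
    have hne := hpos x hx
    rw [← er, ← ei, ← hy x hx] at e2
    have e3 : (1 - T₁ x 2 ^ 2) * inner ℝ (T₁ x - T₂ x) (P₁ x - P₂ x)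
        = -(P₁ x 2 * T₁ x 2) * ‖T₁ x - T₂ x‖ ^ 2 := by
      rw [← inner_smul_right, smul_sub, e1, e2, norm_sq_coord, inner_coord]
      simp
      ring
    rw [div_eq_zero_iff]
    left
    simp only [Pi.sub_apply]
    linear_combination 2 * e3
  have hq0 : Tendsto q atTop (𝓝 0) := by
    have h1 : Tendsto q atTop (𝓝 (0 ^ 2 / (1 - β ^ 2))) :=
      (hT.pow 2).div ((hlim.pow 2).const_sub 1) hβ
    simpa using h1
  have h1 := norm_sub_lim_le_of_deriv_le (k := 1) (C := 0) (s := s) one_ne_zero le_rfl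
    (hs₀.trans_le hs) (fun x hx => hq x (hs.trans hx)) (fun x _ => by simp) hq0
  have h2 : q s = 0 := by simpa using h1
  have h3 : ‖T₁ s - T₂ s‖ ^ 2 = 0 := (div_eq_zero_iff.1 h2).resolve_right (hpos s hs)
  exact sub_eq_zero.1 (norm_eq_zero.1 (pow_eq_zero_iff two_ne_zero |>.1 h3))

/-- A solution is determined by its reduced asymptotic data. -/
lemma HasReducedLimits.unique {a θ b : ℝ} {B : E3} {G₁ G₂ : ℝ → E3} (hβ : 1 - B 2 ^ 2 ≠ 0)
    (hG₁ : IsSolution a G₁) (hG₂ : IsSolution a G₂)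
    (h₁ : HasReducedLimits a B θ b G₁) (h₂ : HasReducedLimits a B θ b G₂) : G₁ = G₂ := by
  have H₁ := hG₁.isFrame
  have H₂ := hG₂.isFrame
  have hA₁ := h₁.tendsto_amplitude
  have hA₂ := h₂.tendsto_amplitude
  rw [h₁.alpha_eq] at H₁ hA₁
  rw [h₂.alpha_eq] at H₂ hA₂
  have hT₁ := tendsto_coord h₁.tendsto_tangent 2
  simp only [unrot_apply_two] at hT₁
  have hO : ∀ {G T P N : ℝ → E3}, IsFrame a (alphaData a B b) G T P N →
      Tendsto (unrot a T) atTop (𝓝 B) → (fun s => T s 2 - B 2) =O[atTop] fun s : ℝ => s⁻¹ :=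
    fun {G T P N} H h => by
      refine IsBigO.trans (IsBigO.of_bound 1 (Eventually.of_forall fun s => ?_))
        (H.isBigO_unrot_T_sub h)
      rw [one_mul, ← unrot_apply_two a]
      exact PiLp.norm_apply_le (unrot a T s - B) 2
  have hdh : Tendsto (fun s => vertPart (deriv (tangent G₁))
        (fun s => cross (tangent G₁ s) (deriv (tangent G₁) s)) s
      - vertPart (deriv (tangent G₂))
        (fun s => cross (tangent G₂ s) (deriv (tangent G₂) s)) s) atTop (𝓝 0) := by
    have h3 := (hA₁.sub hA₂).norm
    rw [sub_self, norm_zero] at h3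
    rw [tendsto_zero_iff_norm_tendsto_zero]
    refine h3.congr fun s => ?_
    rw [← mul_sub, norm_mul, norm_exp_neg_I_mul, one_mul]
  have hev := eventually_eq_of_scalar_system H₁.hasDerivAt_height H₂.hasDerivAt_height
    H₁.hasDerivAt_vertPart H₂.hasDerivAt_vertPart (hO H₁ h₁.tendsto_tangent)
    (hO H₂ h₂.tendsto_tangent) hdh
  have hne : ∀ᶠ s in atTop, 1 - tangent G₁ s 2 ^ 2 ≠ 0 :=
    ((hT₁.pow 2).const_sub 1).eventually_ne hβ
  have hdT : Tendsto (fun s => ‖tangent G₁ s - tangent G₂ s‖) atTop (𝓝 0) := by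
    have h3 := (h₁.tendsto_tangent.sub h₂.tendsto_tangent).norm
    rw [sub_self, norm_zero] at h3
    refine h3.congr fun s => ?_
    rw [unrot, unrot, ← map_sub, norm_rot]
  obtain ⟨s₀, hs₀⟩ := eventually_atTop.1 ((hev.and hne).and (eventually_gt_atTop 0))
  have hT : ∀ s, s₀ ≤ s → tangent G₁ s = tangent G₂ s := fun s hs =>
    tangent_eq_of_vertPart_eq H₁ H₂ (hs₀ s₀ le_rfl).2 (fun s hs => (hs₀ s hs).1.1.1)
      (fun s hs => (hs₀ s hs).1.1.2) (fun s hs => (hs₀ s hs).1.2) hβ hT₁ hdT hs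
  have hnear : tangent G₁ =ᶠ[𝓝 (s₀ + 1)] tangent G₂ := by
    filter_upwards [Ioi_mem_nhds (lt_add_one s₀)] with s hs using hT s (le_of_lt hs)
  have hV := H₁.curve_eq (s₀ + 1)
  rw [hnear.eq_of_nhds, hnear.deriv_eq, ← H₂.curve_eq (s₀ + 1)] at hV
  exact hG₁.isCurve.eq_of_eq hG₂.isCurve
    ((eq_asymVec a hV).trans (eq_asymVec a rfl).symm) hnear.eq_of_nhds

/-! ### Reflection and the end at minus infinity -/

/-- The reflected curve `s ↦ -G (-s)`; reflection is a symmetry of the equation which exchanges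
the two ends. -/
def reflect (G : ℝ → E3) (s : ℝ) : E3 := -G (-s)

lemma reflect_reflect (G : ℝ → E3) : reflect (reflect G) = G := by
  funext s; simp [reflect]

lemma tangent_reflect (G : ℝ → E3) (s : ℝ) : tangent (reflect G) s = tangent G (-s) := by
  change deriv (fun s => -G (-s)) s = deriv G (-s)
  rw [deriv.fun_neg, deriv_comp_neg, neg_neg]

lemma deriv_tangent_reflect (G : ℝ → E3) (s : ℝ) :
    deriv (tangent (reflect G)) s = -deriv (tangent G) (-s) := by
  rw [funext (tangent_reflect G), deriv_comp_neg]

lemma curvature_reflect (G : ℝ → E3) (s : ℝ) : curvature (reflect G) s = curvature G (-s) := by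
  rw [curvature, deriv_tangent_reflect, norm_neg, curvature]

lemma normal_reflect (G : ℝ → E3) (s : ℝ) : normal (reflect G) s = -normal G (-s) := by
  rw [normal, deriv_tangent_reflect, curvature_reflect, smul_neg, normal]

lemma cross_neg_right (u v : E3) : cross u (-v) = -cross u v := by
  apply E3.ext_coord <;> simp <;> ring

lemma binormal_reflect (G : ℝ → E3) (s : ℝ) : binormal (reflect G) s = -binormal G (-s) := by
  rw [binormal, tangent_reflect, normal_reflect, cross_neg_right, binormal]

lemma act_neg (M : Matrix (Fin 3) (Fin 3) ℝ) (v : E3) : act M (-v) = -act M v := by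
  simp [act, Matrix.mulVec_neg]

lemma alpha_reflect (a : ℝ) (G : ℝ → E3) : alpha a (reflect G) = alpha a G := by
  simp [alpha, tangent_reflect, reflect, act_neg]

lemma subI_neg (u v : E3) : subI (-u) (-v) = -subI u v := by
  ext i
  simp [subI_apply]
  ring

lemma phase_neg (γ s : ℝ) : phase γ (-s) = phase γ s := by
  simp [phase]

lemma amplitude_add_pi (a : ℝ) (B : E3) (θ b : ℝ) :
    amplitude a B (θ + Real.pi) b = -amplitude a B θ b := by
  simp only [amplitude]
  rw [Complex.ofReal_add, mul_add, Complex.exp_add, mul_comm Complex.I (Real.pi : ℂ),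
    Complex.exp_pi_mul_I]
  ring

lemma isSolution_reflect {a : ℝ} {G : ℝ → E3} (h : IsSolution a G) : IsSolution a (reflect G) := by
  refine ⟨(h.1.comp contDiff_neg).neg, fun s => ?_⟩
  have h1 := h.2 (-s)
  have e1 : deriv (reflect G) s = deriv G (-s) := tangent_reflect G s
  have e2 : deriv (deriv (reflect G)) s = -deriv (deriv G) (-s) := deriv_tangent_reflect G s
  rw [e1, e2, cross_neg_right, reflect, act_neg, smul_neg, ← h1.1]
  refine ⟨?_, h1.2⟩
  module

lemma hasExpansion_reflect {a : ℝ} {G : ℝ → E3} {B : E3} {θ b c : ℝ} {l l' : Filter ℝ}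
    (hl : Tendsto Neg.neg l' l)
    (h : HasExpansion a B θ b l G c) :
    HasExpansion a B (θ + Real.pi) b l' (reflect G) c := by
  have hO : ∀ {E : Type} [NormedAddCommGroup E] {f f' : ℝ → E} {g g' : ℝ → ℝ}, f =O[l] g →
      (∀ s, ‖f' s‖ = ‖f (-s)‖) → (∀ s, ‖g' s‖ = ‖g (-s)‖) → f' =O[l'] g' := by
    intro E _ f f' g g' hfg hf hg
    have h1 := hfg.comp_tendsto hl
    rw [← isBigO_norm_norm] at h1 ⊢
    simpa only [Function.comp_apply, ← hf, ← hg] using h1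
  refine ⟨?_, ?_, ?_, hO h.curve_asymp (fun s => ?_) (fun s => ?_),
    hO h.tangent_asymp (fun s => ?_) (fun s => ?_), hO h.frame_asymp (fun s => ?_) (fun s => ?_)⟩
  · exact (h.tendsto_curvature.comp hl).congr fun s => (curvature_reflect G s).symm
  · rw [alpha_reflect, h.sq_curvature]
  · rw [alpha_reflect, h.sq_b]
  · rw [normal_reflect, reflect, abs_neg, ← norm_neg, neg_sq, inv_neg]
    congr 1
    module
  · simp [div_eq_mul_inv]
  · rw [tangent_reflect, binormal_reflect, abs_neg, div_neg]
    congr 1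
    module
  · simp
  · rw [normal_reflect, binormal_reflect, subI_neg, amplitude_add_pi, alpha_reflect, phase_neg,
      abs_neg, ← norm_neg]
    congr 1
    module
  · simp

lemma hasAsymptotics_reflect {a : ℝ} {G : ℝ → E3} {B : E3} {θ b : ℝ} {l l' : Filter ℝ}
    (hl : Tendsto Neg.neg l' l)
    (h : HasAsymptotics a B θ b l G) : HasAsymptotics a B (θ + Real.pi) b l' (reflect G) :=
  let ⟨c, hc⟩ := h
  ⟨c, hasExpansion_reflect hl hc⟩

lemma hasLimits_reflect {a : ℝ} {G : ℝ → E3} {B : E3} {θ b : ℝ} {l l' : Filter ℝ}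
    (hl : Tendsto Neg.neg l' l)
    (h : HasLimits a B θ b l G) : HasLimits a B (θ + Real.pi) b l' (reflect G) := by
  refine ⟨(h.curve_asymp.comp hl).congr fun s => ?_,
    (h.tangent_asymp.comp hl).congr fun s => ?_, ?_⟩
  · simp [reflect, inv_neg]
  · simp [tangent_reflect]
  · rw [amplitude_add_pi, neg_smul]
    refine ((h.frame_asymp.comp hl).neg).congr fun s => ?_
    simp only [Function.comp_apply]
    rw [deriv_tangent_reflect, tangent_reflect, cross_neg_right, act_neg, act_neg, subI_neg,
      smul_neg, abs_neg, phase_neg]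

/-- Existence and uniqueness along `+∞`, for an arbitrary angle. -/
lemma existence_uniqueness_atTop {a : ℝ} (ha : a ≠ 0) {B : E3} (hB : ‖B‖ = 1)
    (hβ : 1 - B 2 ^ 2 ≠ 0) (θ b : ℝ) :
    (∃ G, IsSolution a G ∧ HasAsymptotics a B θ b atTop G ∧ HasLimits a B θ b atTop G) ∧
      (∀ G₁ G₂, IsSolution a G₁ → IsSolution a G₂ → HasAsymptotics a B θ b atTop G₁ →
        HasAsymptotics a B θ b atTop G₂ → G₁ = G₂) ∧
      ∀ G₁ G₂, IsSolution a G₁ → IsSolution a G₂ → HasLimits a B θ b atTop G₁ →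
        HasLimits a B θ b atTop G₂ → G₁ = G₂ := by
  refine ⟨?_, fun G₁ G₂ h₁ h₂ k₁ k₂ => ?_, fun G₁ G₂ h₁ h₂ k₁ k₂ => ?_⟩
  · obtain ⟨G, hG, h⟩ := exists_hasReducedLimits hB hβ θ b
    exact ⟨G, hG, ⟨_, h.hasExpansion hG ha hB hβ⟩, h.hasLimits hG ha hB hβ⟩
  · exact (k₁.reduced ha hB hβ h₁).unique hβ h₁ h₂ (k₂.reduced ha hB hβ h₂)
  · exact (k₁.reduced ha hB hβ h₁).unique hβ h₁ h₂ (k₂.reduced ha hB hβ h₂)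

/-- The case of `-∞` reduces to that of `+∞` by the reflection `s ↦ -G (-s)`, which turns the angle
`θ` into `θ + π`. -/
lemma existence_uniqueness {a : ℝ} (ha : a ≠ 0) {B : E3} (hB : ‖B‖ = 1)
    (hβ : 1 - B 2 ^ 2 ≠ 0) (θ b : ℝ) {l : Filter ℝ}
    (hl : l = atTop ∨ l = atBot) :
    (∃ G, IsSolution a G ∧ HasAsymptotics a B θ b l G ∧ HasLimits a B θ b l G) ∧
      (∀ G₁ G₂, IsSolution a G₁ → IsSolution a G₂ → HasAsymptotics a B θ b l G₁ →
        HasAsymptotics a B θ b l G₂ → G₁ = G₂) ∧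
      ∀ G₁ G₂, IsSolution a G₁ → IsSolution a G₂ → HasLimits a B θ b l G₁ →
        HasLimits a B θ b l G₂ → G₁ = G₂ := by
  rcases hl with rfl | rfl
  · exact existence_uniqueness_atTop ha hB hβ θ b
  have htop : Tendsto (Neg.neg : ℝ → ℝ) atTop atBot := tendsto_neg_atTop_atBot
  have hbot : Tendsto (Neg.neg : ℝ → ℝ) atBot atTop := tendsto_neg_atBot_atTop
  have hinj : ∀ {G₁ G₂ : ℝ → E3}, reflect G₁ = reflect G₂ → G₁ = G₂ := fun {G₁ G₂} h => by
    rw [← reflect_reflect G₁, h, reflect_reflect]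
  refine ⟨?_, fun G₁ G₂ h₁ h₂ k₁ k₂ => hinj ?_, fun G₁ G₂ h₁ h₂ k₁ k₂ => hinj ?_⟩
  · obtain ⟨G, hG, h1, h2⟩ := (existence_uniqueness_atTop ha hB hβ (θ - Real.pi) b).1
    refine ⟨reflect G, isSolution_reflect hG, ?_, ?_⟩
    · simpa using hasAsymptotics_reflect hbot h1
    · simpa using hasLimits_reflect hbot h2
  · exact (existence_uniqueness_atTop ha hB hβ (θ + Real.pi) b).2.1 _ _ (isSolution_reflect h₁)
      (isSolution_reflect h₂) (hasAsymptotics_reflect htop k₁) (hasAsymptotics_reflect htop k₂)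
  · exact (existence_uniqueness_atTop ha hB hβ (θ + Real.pi) b).2.2 _ _ (isSolution_reflect h₁)
      (isSolution_reflect h₂) (hasLimits_reflect htop k₁) (hasLimits_reflect htop k₂)

end SelfSimilarCurve

end

theorem theorem2 (a : ℝ) (ha : a ≠ 0)
    (B : SelfSimilarCurve.E3) (hB : ‖B‖ = 1) (hB1 : B 2 ≠ 1) (hB2 : B 2 ≠ -1)
    (θ : ℝ) (hθ : θ ∈ Set.Ico 0 (2 * Real.pi)) (b : ℝ) (hb : 0 ≤ b)
    (l : Filter ℝ) (hl : l = Filter.atTop ∨ l = Filter.atBot) :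
    (∃ G : ℝ → SelfSimilarCurve.E3,
        SelfSimilarCurve.IsSolution a G ∧
          SelfSimilarCurve.HasAsymptotics a B θ b l G ∧
          SelfSimilarCurve.HasLimits a B θ b l G) ∧
      (0 < b →
        (∃! G : ℝ → SelfSimilarCurve.E3,
            SelfSimilarCurve.IsSolution a G ∧ SelfSimilarCurve.HasAsymptotics a B θ b l G) ∧
          ∃! G : ℝ → SelfSimilarCurve.E3,
            SelfSimilarCurve.IsSolution a G ∧ SelfSimilarCurve.HasLimits a B θ b l G) := by
  have hβ := (SelfSimilarCurve.one_sub_sq_pos hB hB1 hB2).ne'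
  obtain ⟨⟨G, hG, h1, h2⟩, hu1, hu2⟩ := SelfSimilarCurve.existence_uniqueness ha hB hβ θ b hl
  exact ⟨⟨G, hG, h1, h2⟩, fun _ => ⟨⟨G, ⟨hG, h1⟩, fun G' h => hu1 G' G h.1 hG h.2 h1⟩,
    ⟨G, ⟨hG, h2⟩, fun G' h => hu2 G' G h.1 hG h.2 h2⟩⟩⟩
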